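/- Let $q\in(0,1)$, $c\in[0,\infty)$ and $\lambda_n:=(1-q^{2n})^{1/2}$. A representation of the relations $$YX=q^2XY,\qquad X^*X-q^2XX^*=(1-q^2)(Y^2+c)\qquad(1)$$ on a complex Hilbert space $\mathcal K$ is a pair of a densely defined closed operator $X$ and a self-adjoint operator $Y$ with $\ker Y=\{0\}$ such that, products and sums being taken on their natural domains, $YX\subseteq q^2XY$ and $X^*X=q^2XX^*+(1-q^2)(Y^2+c)$. It is called well-behaved if the self-adjoint operators $Y$ and $X^*X$ strongly commute and if, for the polar decomposition $X=v|X|$, the subspace $\mathcal K^u=\bigcap_{n\ge0}v^n\mathcal K$ (the unitary part in the Wold decomposition of the isometry $v$) reduces $|X|^2=X^*X$. (i) Let $(X,Y)$ be a well-behaved representation of (1) on $\mathcal K$. Then there are a Hilbert space $\mathcal K_0$ and a self-adjoint operator $Y_0$ on $\mathcal K_0$ with $\ker Y_0=\{0\}$ such that, up to unitary equivalence, $\mathcal K=\bigoplus_{n=0}^\infty\mathcal K_n$ with $\mathcal K_n=\mathcal K_0$ for all $n$, and $$X\zeta_n=\lambda_{n+1}(q^{2n}Y_0^2+c)^{1/2}\zeta_{n+1},\qquad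 X^*\zeta_n=\lambda_n(q^{2n-2}Y_0^2+c)^{1/2}\zeta_{n-1},\qquad Y\zeta_n=q^{2n}Y_0\zeta_n,\qquad(2)$$ where $X^*\zeta_0=0$, $\zeta_n$ denotes the vector $\zeta\in\mathcal K_0$ placed in the summand $\mathcal K_n$ of $\mathcal K$, and the operators act summandwise on their maximal domains. (ii) Conversely, let $Y_0$ be a self-adjoint operator with trivial kernel on a Hilbert space $\mathcal K_0$. Then the operators $X$ and $Y$ given by (2) on $\bigoplus_{n=0}^\infty\mathcal K_0$ form a representation of (1), and the adjoint of $X$ is the operator $X^*$ given in (2). Moreover, there is a dense subspace $\mathcal D$, a core for $X$, $X^*$ and $Y$, which $X$, $X^*$ and $Y$ map into itself, which $Y$ maps bijectively onto itself, and on which $YX=q^2XY$, $YX^*=q^{-2}X^*Y$ and $X^*X-q^2XX^*=(1-q^2)(Y^2+c)$ hold; so the operators define a representation on $\mathcal D$ of the $*$-algebra $\mathcal Y_c$ with generators $X,X^*,Y=Y^*,Y^{-1}$ and these relations. -/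

import Mathlib

open scoped LinearPMap InnerProductSpace

universe u

namespace QSphere

noncomputable section

variable {H : Type u} [NormedAddCommGroup H] [InnerProductSpace ℂ H]

/-! ### Unbounded operators -/

/-- The product `S T` of unbounded operators on its natural domain
`{x ∈ D(T) : T x ∈ D(S)}`, given through its graph. -/
def opMul (S T : H →ₗ.[ℂ] H) : H →ₗ.[ℂ] H :=
  Submodule.toLinearPMap
    { carrier := {p | ∃ y, (p.1, y) ∈ T.graph ∧ (y, p.2) ∈ S.graph}
      zero_mem' := ⟨0, T.graph.zero_mem, S.graph.zero_mem⟩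
      add_mem' := by
        rintro a b ⟨y, h1, h2⟩ ⟨z, h3, h4⟩
        exact ⟨y + z, T.graph.add_mem h1 h3, S.graph.add_mem h2 h4⟩
      smul_mem' := by
        rintro k a ⟨y, h1, h2⟩
        exact ⟨k • y, T.graph.smul_mem k h1, S.graph.smul_mem k h2⟩ }

theorem mem_graph_opMul (S T : H →ₗ.[ℂ] H) (x z : H) :
    (x, z) ∈ (opMul S T).graph ↔ ∃ y, (x, y) ∈ T.graph ∧ (y, z) ∈ S.graph := by
  unfold opMul
  rw [Submodule.toLinearPMap_graph_eq]
  · rfl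
  · rintro ⟨a, b⟩ ⟨y, h1, h2⟩ (rfl : a = 0)
    have hy : y = 0 := T.graph_fst_eq_zero_snd h1 rfl
    exact S.graph_fst_eq_zero_snd h2 hy

theorem mem_domain_opMul (S T : H →ₗ.[ℂ] H) (x : H) :
    x ∈ (opMul S T).domain ↔ ∃ h : x ∈ T.domain, T ⟨x, h⟩ ∈ S.domain := by
  rw [LinearPMap.mem_domain_iff]
  constructor
  · rintro ⟨z, hz⟩
    obtain ⟨y, h1, h2⟩ := (mem_graph_opMul S T x z).1 hz
    obtain ⟨a, rfl, rfl⟩ := LinearPMap.mem_graph_iff _ |>.1 h1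
    exact ⟨a.2, LinearPMap.mem_domain_of_mem_graph h2⟩
  · rintro ⟨h, hS⟩
    exact ⟨S ⟨_, hS⟩, (mem_graph_opMul S T x _).2
      ⟨T ⟨x, h⟩, T.mem_graph ⟨x, h⟩, S.mem_graph ⟨_, hS⟩⟩⟩

theorem opMul_apply (S T : H →ₗ.[ℂ] H) (x : (opMul S T).domain) :
    ∃ (h : (x : H) ∈ T.domain) (h' : T ⟨x, h⟩ ∈ S.domain),
      opMul S T x = S ⟨T ⟨x, h⟩, h'⟩ := by
  obtain ⟨h, h'⟩ := (mem_domain_opMul S T x).1 x.2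
  refine ⟨h, h', ?_⟩
  have h1 : ((x : H), S ⟨T ⟨x, h⟩, h'⟩) ∈ (opMul S T).graph :=
    (mem_graph_opMul S T x _).2 ⟨T ⟨x, h⟩, T.mem_graph ⟨x, h⟩, S.mem_graph ⟨_, h'⟩⟩
  exact (LinearPMap.mem_graph_snd_inj _ ((opMul S T).mem_graph x) h1 rfl)

/-- The scalar operator `a I`, defined everywhere. -/
def scalarOp (H : Type u) [NormedAddCommGroup H] [InnerProductSpace ℂ H] (a : ℂ) : H →ₗ.[ℂ] H :=
  (a • (LinearMap.id : H →ₗ[ℂ] H)).toPMap ⊤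

/-- `ker A = {0}`. -/
def HasTrivialKernel (A : H →ₗ.[ℂ] H) : Prop :=
  ∀ x : A.domain, A x = 0 → (x : H) = 0

/-- `B` is a non-negative self-adjoint square root of `A`; there is exactly one if `A` is
self-adjoint and non-negative. -/
structure IsPosSqrt [CompleteSpace H] (A B : H →ₗ.[ℂ] H) : Prop where
  selfAdjoint : IsSelfAdjoint B
  nonneg : ∀ x : B.domain, 0 ≤ (⟪(x : H), B x⟫_ℂ).re
  sq : opMul B B = A

open Classical in
/-- The non-negative self-adjoint square root `A^{1/2}` of a non-negative self-adjoint operator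
(the zero operator if there is none). -/
def posSqrt [CompleteSpace H] (A : H →ₗ.[ℂ] H) : H →ₗ.[ℂ] H :=
  if h : ∃ B, IsPosSqrt A B then h.choose else 0

/-- The modulus `|X| = (X^* X)^{1/2}`. -/
def modulus [CompleteSpace H] (X : H →ₗ.[ℂ] H) : H →ₗ.[ℂ] H :=
  posSqrt (opMul X† X)

/-- `X = v |X|` is the polar decomposition of `X`: the bounded operator `v` is isometric on the
orthogonal complement of `ker X` and vanishes on `ker X`. -/
structure IsPolarDecomposition [CompleteSpace H] (X : H →ₗ.[ℂ] H) (v : H →L[ℂ] H) : Prop where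
  eq : X = (v : H →ₗ[ℂ] H).compPMap (modulus X)
  isometric : ∀ x ∈ ((LinearMap.ker X.toFun).map X.domain.subtype)ᗮ, ‖v x‖ = ‖x‖
  ker : ∀ x : X.domain, X x = 0 → v x = 0

/-- The bounded operator `R` is the resolvent `(A - z)⁻¹`. -/
def IsResolventAt (A : H →ₗ.[ℂ] H) (z : ℂ) (R : H →L[ℂ] H) : Prop :=
  (∀ y, ∃ h : R y ∈ A.domain, A ⟨R y, h⟩ - z • R y = y) ∧
    ∀ x : A.domain, R (A x - z • (x : H)) = x

/-- Strong commutativity of self-adjoint operators: their resolvents at non-real points commute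
(equivalently, their spectral projections commute). -/
def StronglyCommute (A B : H →ₗ.[ℂ] H) : Prop :=
  ∀ (z w : ℂ) (R S : H →L[ℂ] H), z.im ≠ 0 → w.im ≠ 0 →
    IsResolventAt A z R → IsResolventAt B w S → Commute R S

/-- The subspace `M` reduces `A`: `A` is the direct sum of an operator on `M` and one on `Mᗮ`. -/
def Reduces (M : Submodule ℂ H) (A : H →ₗ.[ℂ] H) : Prop :=
  ∀ x : A.domain, ∃ y z : A.domain, (x : H) = y + z ∧
    (y : H) ∈ M ∧ A y ∈ M ∧ (z : H) ∈ Mᗮ ∧ A z ∈ Mᗮ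

/-- The space `⋂ₙ vⁿ H` of the unitary part in the Wold decomposition of an isometry `v`. -/
def unitaryPart (v : H →L[ℂ] H) : Submodule ℂ H :=
  ⨅ n : ℕ, LinearMap.range ((v ^ n : H →L[ℂ] H) : H →ₗ[ℂ] H)

/-! ### The relations -/

/-- A representation by unbounded operators of the relations
`Y X = q² X Y` and `X^* X - q² X X^* = (1 - q²) (Y² + c)`.

Products and sums of operators carry their natural domains. The first relation is
`Y X ⊆ q² X Y`, the second one is the operator equality
`X^* X = q² X X^* + (1 - q²) (Y² + c)`. -/
structure IsRepresentation [CompleteSpace H] (q c : ℝ) (X Y : H →ₗ.[ℂ] H) : Prop where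
  dense : Dense (X.domain : Set H)
  closed : X.IsClosed
  selfAdjoint : IsSelfAdjoint Y
  kernel : HasTrivialKernel Y
  rel_YX : opMul Y X ≤ ((q : ℂ) ^ 2) • opMul X Y
  rel_XX : opMul X† X =
    ((q : ℂ) ^ 2) • opMul X X† + (1 - (q : ℂ) ^ 2) • (opMul Y Y + scalarOp H (c : ℂ))

/-- `Y` and `X^* X` strongly commute, and the unitary part of the isometry in the polar
decomposition of `X` reduces `|X|² = X^* X`. -/
structure IsWellBehaved [CompleteSpace H] (X Y : H →ₗ.[ℂ] H) : Prop where
  strongly_commute : StronglyCommute Y (opMul X† X)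
  reduces : ∀ v : H →L[ℂ] H, IsPolarDecomposition X v →
    Reduces (unitaryPart v) (opMul X† X)

/-- `X`, `X^*`, `Y` and `Y⁻¹` restrict to linear maps of a dense subspace `D` into itself which
satisfy all defining relations of the `*`-algebra generated by `X`, `X^*`, `Y = Y^*`, `Y⁻¹`, and
`D` is a core of `X`, `X^*` and `Y`. -/
def InducesStarRepresentation [CompleteSpace H] (q c : ℝ) (X Y : H →ₗ.[ℂ] H) : Prop :=
  ∃ (D : Submodule ℂ H) (x x' y y' : Module.End ℂ D),
    Dense (D : Set H) ∧ X.HasCore D ∧ X†.HasCore D ∧ Y.HasCore D ∧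
    (∀ d : D, ((d : H), (x d : H)) ∈ X.graph) ∧
    (∀ d : D, ((d : H), (x' d : H)) ∈ X†.graph) ∧
    (∀ d : D, ((d : H), (y d : H)) ∈ Y.graph) ∧
    y * y' = 1 ∧ y' * y = 1 ∧
    y * x = ((q : ℂ) ^ 2) • (x * y) ∧
    y * x' = ((q : ℂ) ^ 2)⁻¹ • (x' * y) ∧
    x' * x - ((q : ℂ) ^ 2) • (x * x') = (1 - (q : ℂ) ^ 2) • (y ^ 2 + (c : ℂ) • 1)

/-! ### The operators on `⨁ₙ K₀` -/

/-- The Hilbert space direct sum `⨁ₙ Kₙ` over `n = 0, 1, 2, …` with all `Kₙ` equal to `K₀`. -/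
abbrev HSum (H : Type u) [NormedAddCommGroup H] [InnerProductSpace ℂ H] : Type u :=
  lp (fun _ : ℕ => H) 2

/-- The operator `ζₙ ↦ Aₙ ζₙ` on `⨁ₙ K₀`, with its maximal domain. -/
def diagOp (A : ℕ → H →ₗ.[ℂ] H) : HSum H →ₗ.[ℂ] HSum H :=
  Submodule.toLinearPMap
    { carrier := {p | ∀ n, (p.1 n, p.2 n) ∈ (A n).graph}
      zero_mem' := fun n => (A n).graph.zero_mem
      add_mem' := fun h1 h2 n => (A n).graph.add_mem (h1 n) (h2 n)
      smul_mem' := fun k _ h n => (A n).graph.smul_mem k (h n) }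

/-- The operator which sends the vector `ζₙ` in the `n`-th summand of `⨁ₙ K₀` to the vector
`Aₙ ζₙ` in summand `n + 1`, with its maximal domain. -/
def raisingOp (A : ℕ → H →ₗ.[ℂ] H) : HSum H →ₗ.[ℂ] HSum H :=
  Submodule.toLinearPMap
    { carrier := {p | p.2 0 = 0 ∧ ∀ n, (p.1 n, p.2 (n + 1)) ∈ (A n).graph}
      zero_mem' := ⟨rfl, fun n => (A n).graph.zero_mem⟩
      add_mem' := by
        rintro a b ⟨h1, h2⟩ ⟨h3, h4⟩
        refine ⟨?_, fun n => (A n).graph.add_mem (h2 n) (h4 n)⟩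
        simp [h1, h3]
      smul_mem' := by
        rintro k a ⟨h1, h2⟩
        refine ⟨?_, fun n => (A n).graph.smul_mem k (h2 n)⟩
        simp [h1] }

/-- The operator which sends the vector `ζₙ` in the `n`-th summand of `⨁ₙ K₀` to the vector
`Aₙ₋₁ ζₙ` in summand `n - 1` if `n ≥ 1`, and to `0` if `n = 0`, with its maximal domain. -/
def loweringOp (A : ℕ → H →ₗ.[ℂ] H) : HSum H →ₗ.[ℂ] HSum H :=
  Submodule.toLinearPMap
    { carrier := {p | ∀ n, (p.1 (n + 1), p.2 n) ∈ (A n).graph}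
      zero_mem' := fun n => (A n).graph.zero_mem
      add_mem' := fun h1 h2 n => (A n).graph.add_mem (h1 n) (h2 n)
      smul_mem' := fun k _ h n => (A n).graph.smul_mem k (h n) }

theorem mem_graph_diagOp (A : ℕ → H →ₗ.[ℂ] H) (ζ η : HSum H) :
    (ζ, η) ∈ (diagOp A).graph ↔ ∀ n, (ζ n, η n) ∈ (A n).graph := by
  unfold diagOp
  rw [Submodule.toLinearPMap_graph_eq]
  · rfl
  · rintro ⟨a, b⟩ h (rfl : a = 0)
    ext n
    exact (A n).graph_fst_eq_zero_snd (h n) rfl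

theorem mem_graph_raisingOp (A : ℕ → H →ₗ.[ℂ] H) (ζ η : HSum H) :
    (ζ, η) ∈ (raisingOp A).graph ↔ η 0 = 0 ∧ ∀ n, (ζ n, η (n + 1)) ∈ (A n).graph := by
  unfold raisingOp
  rw [Submodule.toLinearPMap_graph_eq]
  · rfl
  · rintro ⟨a, b⟩ ⟨h0, h⟩ (rfl : a = 0)
    ext n
    cases n with
    | zero => exact h0
    | succ n => exact (A n).graph_fst_eq_zero_snd (h n) rfl

/-- The description of `loweringOp` needs no condition on the summand `n = 0` of `ζ`. -/
theorem mem_graph_loweringOp (A : ℕ → H →ₗ.[ℂ] H) (ζ η : HSum H) :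
    (ζ, η) ∈ (loweringOp A).graph ↔ ∀ n, (ζ (n + 1), η n) ∈ (A n).graph := by
  unfold loweringOp
  rw [Submodule.toLinearPMap_graph_eq]
  · rfl
  · rintro ⟨a, b⟩ h (rfl : a = 0)
    ext n
    exact (A n).graph_fst_eq_zero_snd (h n) rfl

/-- `λₙ = (1 - q^{2n})^{1/2}`. -/
def lam (q : ℝ) (n : ℕ) : ℝ := Real.sqrt (1 - q ^ (2 * n))

/-- The operator `λₙ₊₁ (q^{2n} Y₀² + c)^{1/2}` on `K₀`. -/
def weight [CompleteSpace H] (q c : ℝ) (Y₀ : H →ₗ.[ℂ] H) (n : ℕ) : H →ₗ.[ℂ] H :=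
  (lam q (n + 1) : ℂ) •
    posSqrt (((q : ℂ) ^ (2 * n)) • opMul Y₀ Y₀ + scalarOp H (c : ℂ))

/-- `X ζₙ = λₙ₊₁ (q^{2n} Y₀² + c)^{1/2} ζₙ₊₁`. -/
def modelX [CompleteSpace H] (q c : ℝ) (Y₀ : H →ₗ.[ℂ] H) : HSum H →ₗ.[ℂ] HSum H :=
  raisingOp (weight q c Y₀)

/-- `X^* ζₙ = λₙ (q^{2n-2} Y₀² + c)^{1/2} ζₙ₋₁`. -/
def modelXstar [CompleteSpace H] (q c : ℝ) (Y₀ : H →ₗ.[ℂ] H) : HSum H →ₗ.[ℂ] HSum H :=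
  loweringOp (weight q c Y₀)

/-- `Y ζₙ = q^{2n} Y₀ ζₙ`. -/
def modelY (q : ℝ) (Y₀ : H →ₗ.[ℂ] H) : HSum H →ₗ.[ℂ] HSum H :=
  diagOp fun n => ((q : ℂ) ^ (2 * n)) • Y₀

/-- The unitary `U` carries the operator `A` to the operator `B`, that is `U A U⁻¹ = B`. -/
def Intertwines {H₁ H₂ : Type u} [NormedAddCommGroup H₁] [InnerProductSpace ℂ H₁]
    [NormedAddCommGroup H₂] [InnerProductSpace ℂ H₂] (U : H₁ ≃ₗᵢ[ℂ] H₂)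
    (A : H₁ →ₗ.[ℂ] H₁) (B : H₂ →ₗ.[ℂ] H₂) : Prop :=
  ∀ x y, (x, y) ∈ A.graph ↔ (U x, U y) ∈ B.graph

end

end QSphere

namespace QSphere

/-! ### Calculus of graphs, adjoints and cores. -/

section Graph

variable {H : Type u} [NormedAddCommGroup H] [InnerProductSpace ℂ H]

/-! Each unbounded operator is written as a quotient of commuting bounded ones: its graph is `{(a u,
g u)}`, so domains and products become algebra of bounded operators (`IsQuot`, `QuotPair`). Von
Neumann's construction of `(1 + X* X)⁻¹` yields such quotients (`exists_bounded_transform`), and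
with them the polar decomposition and the uniqueness of positive square roots.

Part (i). The second relation forces `ker X = 0`, so `v` in `X = v |X|` is an isometry. Strong
commutativity makes the bounded operators of `X* X` commute with those of `Y`, and the first
relation turns into `v* Y ⊆ q² Y v*` (`RepData.star_v_comm`): `v` and `v*` scale `Y` by `q²` and
`q⁻²`. For `x` in the unitary part and in the domain of `X* X` this gives `‖Y v*ⁿ x‖ = q⁻²ⁿ ‖Y x‖`.
Iterating the second relation along `v*ⁿ x` yields `⟨x, X* X x⟩ ≥ n (1 - q²) ‖Y x‖²` for all `n`,
hence `Y x = 0` and `x = 0`. As the unitary part reduces `X* X`, it is zero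
(`RepData.unitaryPart_eq_bot`). By Wold, `v` is then the shift on copies of `ker v*`, and `Y` acts
in summand `n` as `q²ⁿ Y₀`, where `Y₀` is the part of `Y` in `ker v*`. The second relation becomes a
recursion in `n` for `X* X`, solved by `λₙ₊₁² (q²ⁿ Y₀² + c)`; uniqueness of square roots identifies
`|X|`, and so `X`.

Part (ii). In each summand the relations are scalar identities in `Y₀`. The content lies in the
domains: `q²ⁿ Y₀` and `q⁴ⁿ Y₀²` are bounded relative to the weight and to its square, uniformly in
`n` (`WeightData.norm_left_le`, `WeightData.norm_left_left_le`). The core consists of the finite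
sequences with entries in a dense space on which the bounded operators `a`, `b` with `Y₀ = b a⁻¹`
are invertible (`WeightData.exists_common_core`). -/

theorem le_of_forall_mem_graph {A B : H →ₗ.[ℂ] H}
    (h : ∀ x y, (x, y) ∈ A.graph → (x, y) ∈ B.graph) : A ≤ B :=
  LinearPMap.le_of_le_graph fun p hp => h p.1 p.2 hp

theorem eq_of_forall_mem_graph_iff {A B : H →ₗ.[ℂ] H}
    (h : ∀ x y, (x, y) ∈ A.graph ↔ (x, y) ∈ B.graph) : A = B :=
  LinearPMap.eq_of_eq_graph (by ext ⟨x, y⟩; exact h x y)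

theorem eq_of_mem_graph {A : H →ₗ.[ℂ] H} {x y z : H} (hy : (x, y) ∈ A.graph)
    (hz : (x, z) ∈ A.graph) : y = z :=
  A.mem_graph_snd_inj hy hz rfl

theorem mem_graph_smul (k : ℂ) (A : H →ₗ.[ℂ] H) (x z : H) :
    (x, z) ∈ (k • A).graph ↔ ∃ y, (x, y) ∈ A.graph ∧ z = k • y := by
  simp only [LinearPMap.mem_graph_iff]
  constructor
  · rintro ⟨d, rfl, rfl⟩
    exact ⟨A ⟨d, d.2⟩, ⟨⟨d, d.2⟩, rfl, rfl⟩, rfl⟩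
  · rintro ⟨_, ⟨d, rfl, rfl⟩, rfl⟩
    exact ⟨⟨d, d.2⟩, rfl, rfl⟩

theorem mem_graph_add (A B : H →ₗ.[ℂ] H) (x z : H) :
    (x, z) ∈ (A + B).graph ↔ ∃ y y', (x, y) ∈ A.graph ∧ (x, y') ∈ B.graph ∧ z = y + y' := by
  simp only [LinearPMap.mem_graph_iff]
  constructor
  · rintro ⟨d, rfl, rfl⟩
    exact ⟨A ⟨d, d.2.1⟩, B ⟨d, d.2.2⟩, ⟨⟨d, d.2.1⟩, rfl, rfl⟩, ⟨⟨d, d.2.2⟩, rfl, rfl⟩, rfl⟩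
  · rintro ⟨_, _, ⟨d, rfl, rfl⟩, ⟨e, he, rfl⟩, rfl⟩
    obtain ⟨e, he'⟩ := e
    dsimp at he
    subst he
    exact ⟨⟨d, d.2, he'⟩, rfl, rfl⟩

theorem mem_graph_scalarOp (a : ℂ) (x z : H) :
    (x, z) ∈ (scalarOp H a).graph ↔ z = a • x := by
  simp only [LinearPMap.mem_graph_iff]
  constructor
  · rintro ⟨d, rfl, rfl⟩
    rfl
  · rintro rfl
    exact ⟨⟨x, trivial⟩, rfl, rfl⟩

theorem hasTrivialKernel_iff (A : H →ₗ.[ℂ] H) :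
    HasTrivialKernel A ↔ ∀ x, (x, (0 : H)) ∈ A.graph → x = 0 := by
  constructor
  · intro h x hx
    obtain ⟨d, rfl, hd⟩ := (LinearPMap.mem_graph_iff _).1 hx
    exact h d hd
  · intro h x hx
    exact h x (by rw [← hx]; exact A.mem_graph x)

/-- The restriction of a closed operator is closable, and the graph of its closure is the closure of
the restricted graph, so being a core is a density statement about graphs. -/
theorem hasCore_of_subset_closure {A : H →ₗ.[ℂ] H} (hA : A.IsClosed) {D : Submodule ℂ H}
    (hD : ∀ d ∈ D, ∃ e, (d, e) ∈ A.graph)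
    (h : ∀ x y, (x, y) ∈ A.graph → (x, y) ∈ closure {p : H × H | p.1 ∈ D ∧ p ∈ A.graph}) :
    A.HasCore D := by
  have hle : A.domRestrict D ≤ A := LinearPMap.domRestrict_le
  have hcl : (A.domRestrict D).IsClosable := hA.isClosable.leIsClosable hle
  refine ⟨fun d hd => LinearPMap.mem_domain_iff.2 (hD d hd), ?_⟩
  apply LinearPMap.eq_of_eq_graph
  rw [← hcl.graph_closure_eq_closure_graph]
  apply le_antisymm
  · exact Submodule.topologicalClosure_minimal _ (LinearPMap.le_graph_of_le hle) hA
  · rintro ⟨x, y⟩ hxy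
    refine closure_mono ?_ (h x y hxy)
    rintro ⟨p, r⟩ ⟨hp, hpr⟩
    obtain ⟨d, hd, hd'⟩ := (LinearPMap.mem_graph_iff _).1 hpr
    dsimp at hp hd hd'
    subst hd hd'
    exact (LinearPMap.mem_graph_iff _).2 ⟨⟨d, hp, d.2⟩, rfl, rfl⟩

variable [CompleteSpace H]

theorem mem_graph_adjoint {A : H →ₗ.[ℂ] H} (hA : Dense (A.domain : Set H)) (y z : H) :
    (y, z) ∈ A†.graph ↔ ∀ a b, (a, b) ∈ A.graph → ⟪b, y⟫_ℂ = ⟪a, z⟫_ℂ := by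
  rw [LinearPMap.adjoint_graph_eq_graph_adjoint hA, Submodule.mem_adjoint_iff]
  simp only [sub_eq_zero]

theorem mem_graph_iff_of_isSelfAdjoint {A : H →ₗ.[ℂ] H} (hA : IsSelfAdjoint A) (y z : H) :
    (y, z) ∈ A.graph ↔ ∀ a b, (a, b) ∈ A.graph → ⟪b, y⟫_ℂ = ⟪a, z⟫_ℂ := by
  have := mem_graph_adjoint hA.dense_domain y z
  rwa [LinearPMap.isSelfAdjoint_def.1 hA] at this

theorem isSelfAdjoint_of_forall_mem_graph_iff {A : H →ₗ.[ℂ] H} (hA : Dense (A.domain : Set H))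
    (h : ∀ y z, (y, z) ∈ A.graph ↔ ∀ a b, (a, b) ∈ A.graph → ⟪b, y⟫_ℂ = ⟪a, z⟫_ℂ) :
    IsSelfAdjoint A :=
  LinearPMap.isSelfAdjoint_def.2 <| eq_of_forall_mem_graph_iff fun x y => by
    rw [mem_graph_adjoint hA, h]

end Graph

/-! ### Bounded self-adjoint operators. -/

section Bounded

variable {H : Type u} [NormedAddCommGroup H] [InnerProductSpace ℂ H]

theorem commute_apply {a b : H →L[ℂ] H} (h : Commute a b) (x : H) : a (b x) = b (a x) :=
  DFunLike.congr_fun h.eq x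

theorem clm_eq_of_comp_eq {a b c : H →L[ℂ] H} (hc : DenseRange c) (h : ∀ x, a (c x) = b (c x)) :
    a = b := by
  ext x
  exact congrFun (hc.equalizer a.continuous b.continuous (funext h)) x

theorem injective_of_mul_self {a : H →L[ℂ] H} (h : ∀ x, (a * a) x = 0 → x = 0) (x : H)
    (hx : a x = 0) : x = 0 :=
  h x (by rw [mul_apply_eq_comp, hx, map_zero])

variable [CompleteSpace H]

theorem inner_left_of_isSelfAdjoint {a : H →L[ℂ] H} (h : IsSelfAdjoint a) (x y : H) :
    ⟪a x, y⟫_ℂ = ⟪x, a y⟫_ℂ := by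
  conv_lhs => rw [← h.adjoint_eq]
  exact ContinuousLinearMap.adjoint_inner_left _ _ _

theorem denseRange_of_injective {a : H →L[ℂ] H} (h : IsSelfAdjoint a)
    (hinj : ∀ x, a x = 0 → x = 0) : DenseRange a := by
  have h1 : (LinearMap.range (a : H →ₗ[ℂ] H)).topologicalClosure = ⊤ := by
    rw [Submodule.topologicalClosure_eq_top_iff, Submodule.eq_bot_iff]
    intro x hx
    apply hinj
    rw [Submodule.mem_orthogonal] at hx
    have := hx (a (a x)) ⟨a x, rfl⟩
    rw [inner_left_of_isSelfAdjoint h] at this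
    exact inner_self_eq_zero.1 this
  exact (Submodule.dense_iff_topologicalClosure_eq_top).2 h1

theorem sqrt_commute {T c : H →L[ℂ] H} (h : Commute T c) : Commute (CFC.sqrt T) c := by
  rw [CFC.sqrt_eq_cfc]
  exact h.cfc_nnreal _

theorem isSelfAdjoint_iff_inner {a : H →L[ℂ] H} :
    IsSelfAdjoint a ↔ ∀ x y, ⟪a x, y⟫_ℂ = ⟪x, a y⟫_ℂ := by
  refine ⟨inner_left_of_isSelfAdjoint, fun h => ?_⟩
  rw [ContinuousLinearMap.isSelfAdjoint_iff']
  exact ((ContinuousLinearMap.eq_adjoint_iff a a).2 h).symm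

theorem nonneg_iff_inner {a : H →L[ℂ] H} :
    0 ≤ a ↔ IsSelfAdjoint a ∧ ∀ x, 0 ≤ (⟪x, a x⟫_ℂ).re := by
  rw [ContinuousLinearMap.nonneg_iff_isPositive, ContinuousLinearMap.isPositive_def']
  refine and_congr_right fun h => forall_congr' fun x => ?_
  rw [← inner_left_of_isSelfAdjoint h]
  rfl

end Bounded

/-! ### The resolvent of `X* X` and the bounded transform. -/

section Resolvent

variable {H : Type u} [NormedAddCommGroup H] [InnerProductSpace ℂ H]

/-- The graph of `A` is `{(a u, g u)}`. -/
def IsQuot (A : H →ₗ.[ℂ] H) (a g : H →L[ℂ] H) : Prop :=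
  ∀ x y, (x, y) ∈ A.graph ↔ ∃ u, a u = x ∧ g u = y

theorem IsQuot.mem {A : H →ₗ.[ℂ] H} {a g : H →L[ℂ] H} (h : IsQuot A a g) (u : H) :
    (a u, g u) ∈ A.graph := (h _ _).2 ⟨u, rfl, rfl⟩

theorem IsQuot.eq {A B : H →ₗ.[ℂ] H} {a g : H →L[ℂ] H} (hA : IsQuot A a g) (hB : IsQuot B a g) :
    A = B :=
  eq_of_forall_mem_graph_iff fun x y => by rw [hA, hB]

variable [CompleteSpace H]

open ContinuousLinearMap in
/-- Von Neumann: the orthogonal projection onto the graph of `X` yields the bounded operators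
`T = (1 + X* X)⁻¹` and `S = X T`. -/
theorem exists_resolvent_adjoint_mul_self {X : H →ₗ.[ℂ] H} (hd : Dense (X.domain : Set H))
    (hc : X.IsClosed) :
    ∃ T S : H →L[ℂ] H, ∀ u, (T u, S u) ∈ X.graph ∧ (S u, u - T u) ∈ X†.graph := by
  -- The sup norm on `H × H` is not Hilbertian; the projection lives in the `L²` product, which has
  -- the same topology.
  let e := WithLp.prodContinuousLinearEquiv 2 ℂ H H
  let G : Submodule ℂ (WithLp 2 (H × H)) := X.graph.comap (e : WithLp 2 (H × H) →ₗ[ℂ] H × H)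
  have hG : IsClosed (G : Set (WithLp 2 (H × H))) := hc.preimage e.continuous
  have : CompleteSpace G := hG.completeSpace_coe
  let P : H →L[ℂ] H × H := (e : WithLp 2 (H × H) →L[ℂ] H × H) ∘L G.starProjection ∘L
    (e.symm : H × H →L[ℂ] WithLp 2 (H × H)) ∘L ContinuousLinearMap.inl ℂ H H
  refine ⟨ContinuousLinearMap.fst ℂ H H ∘L P, ContinuousLinearMap.snd ℂ H H ∘L P, fun u => ?_⟩
  have hP : G.starProjection (e.symm (u, 0)) ∈ G := Submodule.starProjection_apply_mem _ _
  refine ⟨hP, ?_⟩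
  rw [mem_graph_adjoint hd]
  intro a b hab
  have hab' : e.symm (a, b) ∈ G := by
    change e (e.symm (a, b)) ∈ X.graph
    simpa using hab
  -- The residual `(u - T u, -S u)` is orthogonal to the graph of `X`, which says that `(S u, u - T
  -- u)` is in the graph of `X*`.
  have h := Submodule.sub_starProjection_mem_orthogonal (K := G) (e.symm (u, 0))
  have h2 := (Submodule.mem_orthogonal _ _).1 h _ hab'
  rw [WithLp.prod_inner_apply] at h2
  change ⟪a, u - (P u).1⟫_ℂ + ⟪b, 0 - (P u).2⟫_ℂ = 0 at h2
  rw [zero_sub, inner_neg_right] at h2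
  change ⟪b, (P u).2⟫_ℂ = ⟪a, u - (P u).1⟫_ℂ
  linear_combination -h2

/-- For a closed densely defined `X`, with `T = (1 + X* X)⁻¹`, `a = T^{1/2}` and
`b = (1 - T)^{1/2}`: the bounded operator `w = X a` satisfies `w* w = b²`, and the graphs of `X` and
`X* X` are parametrized by `a`, `b` and `w`. -/
theorem exists_bounded_transform {X : H →ₗ.[ℂ] H} (hd : Dense (X.domain : Set H))
    (hc : X.IsClosed) :
    ∃ a b w : H →L[ℂ] H, 0 ≤ a ∧ 0 ≤ b ∧ Commute a b ∧ a * a + b * b = 1 ∧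
      (∀ x, a x = 0 → x = 0) ∧ star w * w = b * b ∧ IsQuot X a w ∧
      IsQuot (opMul X† X) (a * a) (b * b) := by
  obtain ⟨T, S, hTS⟩ := exists_resolvent_adjoint_mul_self hd hc
  have key : ∀ x y u, (x, y) ∈ X.graph → ⟪y, S u⟫_ℂ = ⟪x, u - T u⟫_ℂ := fun x y u h =>
    (mem_graph_adjoint hd _ _).1 (hTS u).2 x y h
  have hinner : ∀ u u', ⟪T u, u'⟫_ℂ = ⟪T u, T u'⟫_ℂ + ⟪S u, S u'⟫_ℂ := fun u u' => by
    rw [key _ _ _ (hTS u).1, inner_sub_right]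
    ring
  have hT : T = star T * T + star S * S := by
    have : star T = star T * T + star S * S := by
      refine ContinuousLinearMap.ext fun x => ext_inner_left ℂ fun y => ?_
      simp only [ContinuousLinearMap.star_eq_adjoint, add_apply,
        mul_apply_eq_comp, inner_add_right, ContinuousLinearMap.adjoint_inner_right]
      exact hinner y x
    have h2 := congrArg star this
    rw [star_star] at h2
    simpa using h2
  have hT0 : 0 ≤ T := by
    rw [hT]
    exact add_nonneg (star_mul_self_nonneg _) (star_mul_self_nonneg _)
  have hTs : IsSelfAdjoint T := IsSelfAdjoint.of_nonneg hT0
  have hSS : star S * S = T * (1 - T) := by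
    rw [hTs.star_eq] at hT
    rw [mul_sub, mul_one, eq_sub_iff_add_eq, add_comm]
    exact hT.symm
  have hT1 : 0 ≤ 1 - T := by
    have : 1 - T = star (1 - T) * (1 - T) + star S * S := by
      rw [hSS, star_sub, star_one, hTs.star_eq]
      noncomm_ring
    rw [this]
    exact add_nonneg (star_mul_self_nonneg _) (star_mul_self_nonneg _)
  have hTinj : ∀ u, T u = 0 → u = 0 := by
    intro u hu
    have h1 := hTS u
    have hS : S u = 0 := by
      rw [hu] at h1
      exact eq_of_mem_graph h1.1 X.graph.zero_mem
    rw [hu, hS, sub_zero] at h1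
    exact eq_of_mem_graph h1.2 X†.graph.zero_mem
  set a := CFC.sqrt T with ha
  set b := CFC.sqrt (1 - T) with hb
  have haa : a * a = T := CFC.sqrt_mul_sqrt_self T
  have hbb : b * b = 1 - T := CFC.sqrt_mul_sqrt_self (1 - T)
  have ha0 : 0 ≤ a := CFC.sqrt_nonneg T
  have has : IsSelfAdjoint a := IsSelfAdjoint.of_nonneg ha0
  have hab : Commute a b := by
    refine sqrt_commute (Commute.symm (sqrt_commute ?_))
    exact ((Commute.one_left T).sub_left (Commute.refl T))
  have hainj : ∀ x, a x = 0 → x = 0 := injective_of_mul_self (by rw [haa]; exact hTinj)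
  have hadense : DenseRange a := denseRange_of_injective has hainj
  have hnorm : ∀ u, ‖S u‖ ≤ 1 * ‖a u‖ := by
    intro u
    rw [one_mul]
    have h1 : ⟪a u, a u⟫_ℂ = ⟪T u, T u⟫_ℂ + ⟪S u, S u⟫_ℂ := by
      rw [inner_left_of_isSelfAdjoint has, ← mul_apply_eq_comp, haa, ← hinner,
        inner_left_of_isSelfAdjoint hTs]
    have h2 : ‖a u‖ ^ 2 = ‖T u‖ ^ 2 + ‖S u‖ ^ 2 := by
      simp only [inner_self_eq_norm_sq_to_K] at h1
      exact_mod_cast h1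
    refine abs_le_of_sq_le_sq' ?_ (norm_nonneg _) |>.2
    nlinarith [sq_nonneg ‖T u‖]
  -- Since `‖a u‖² = ‖T u‖² + ‖S u‖²`, the map `a u ↦ S u` is a contraction on the dense range of
  -- `a`; its extension is `X a`.
  let w : H →L[ℂ] H := (S : H →ₗ[ℂ] H).extendOfNorm (a : H →ₗ[ℂ] H)
  have hwa : ∀ u, w (a u) = S u := LinearMap.extendOfNorm_eq (f := (S : H →ₗ[ℂ] H))
    (e := (a : H →ₗ[ℂ] H)) hadense ⟨1, hnorm⟩
  have hww : star w * w = b * b := by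
    refine clm_eq_of_comp_eq hadense fun x => hadense.eq_of_inner_left ℂ fun y => ?_
    rw [mul_apply_eq_comp, ContinuousLinearMap.star_eq_adjoint,
      ContinuousLinearMap.adjoint_inner_left, hwa, hwa, ← ContinuousLinearMap.adjoint_inner_left,
      ← ContinuousLinearMap.star_eq_adjoint, ← mul_apply_eq_comp, hSS,
      ← inner_left_of_isSelfAdjoint has, ← mul_apply_eq_comp, ← mul_apply_eq_comp, ← hbb]
    congr 2
    rw [← haa, mul_assoc, mul_assoc, (hab.mul_right hab).eq]
  have hmem : ∀ u, (a u, w u) ∈ X.graph := by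
    intro u
    refine hadense.induction_on (p := fun u => (a u, w u) ∈ X.graph) u
      (hc.preimage (by fun_prop : Continuous fun u => (a u, w u))) ?_
    intro v
    rw [hwa, ← mul_apply_eq_comp, haa]
    exact (hTS v).1
  refine ⟨a, b, w, ha0, CFC.sqrt_nonneg _, hab, by rw [haa, hbb]; abel, hainj, hww, ?_, ?_⟩
  · intro x y
    constructor
    · intro hxy
      -- The map `u ↦ (a u, w u)` is isometric, so the parameter of `(x, y)` has to be its adjoint
      -- at `(x, y)`. The remainder is orthogonal to the range and still in the graph, which forces
      -- it to vanish.
      have hde := X.graph.sub_mem hxy (hmem (a x + star w y))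
      set u := a x + star w y with hu
      have h0 : a (x - a u) + star w (y - w u) = 0 := by
        have h1 : a (a u) + star w (w u) = u := by
          rw [← mul_apply_eq_comp, ← mul_apply_eq_comp, hww, haa, hbb]
          simp
        rw [map_sub, map_sub, sub_add_sub_comm, h1, sub_eq_zero]
      have hd0 : x - a u = 0 := by
        refine ext_inner_right ℂ fun v => ?_
        have h1 := key _ _ v hde
        have h2 : ⟪y - w u, S v⟫_ℂ = -⟪x - a u, T v⟫_ℂ := by
          rw [← hwa, ← ContinuousLinearMap.adjoint_inner_left,
            ← ContinuousLinearMap.star_eq_adjoint, eq_neg_of_add_eq_zero_right h0, inner_neg_left,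
            inner_left_of_isSelfAdjoint has, ← mul_apply_eq_comp, haa]
        rw [inner_zero_left]
        change ⟪y - w u, S v⟫_ℂ = ⟪x - a u, v - T v⟫_ℂ at h1
        rw [inner_sub_right] at h1
        linear_combination h2 - h1
      have he0 : y - w u = 0 := by
        have h1 : (x - a u, y - w u) ∈ X.graph := hde
        rw [hd0] at h1
        exact eq_of_mem_graph h1 X.graph.zero_mem
      exact ⟨u, (sub_eq_zero.1 hd0).symm, (sub_eq_zero.1 he0).symm⟩
    · rintro ⟨u, rfl, rfl⟩
      exact hmem u
  · rw [haa, hbb]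
    intro x y
    rw [mem_graph_opMul]
    constructor
    · rintro ⟨m, hxm, hmy⟩
      -- As `T` inverts `1 + X* X`, the parameter must be `x + y`. The error `d` satisfies `X* X d =
      -- -d`, so `‖X d‖² = -‖d‖²`.
      have h1 : (x - T (x + y), m - S (x + y)) ∈ X.graph := X.graph.sub_mem hxm (hTS (x + y)).1
      have h2 : (m - S (x + y), y - (x + y - T (x + y))) ∈ X†.graph :=
        X†.graph.sub_mem hmy (hTS (x + y)).2
      have h3 := (mem_graph_adjoint hd _ _).1 h2 _ _ h1
      set d := x - T (x + y) with hd
      rw [show y - (x + y - T (x + y)) = -d by rw [hd]; abel, inner_neg_right,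
        inner_self_eq_norm_sq_to_K, inner_self_eq_norm_sq_to_K] at h3
      have h4 : ‖m - S (x + y)‖ ^ 2 = -‖d‖ ^ 2 := by exact_mod_cast h3
      have h5 : ‖d‖ = 0 := by nlinarith [sq_nonneg ‖m - S (x + y)‖, sq_nonneg ‖d‖]
      have h6 : x = T (x + y) := sub_eq_zero.1 (norm_eq_zero.1 h5)
      refine ⟨x + y, h6.symm, ?_⟩
      rw [sub_apply, ← h6, one_apply_eq_self]
      abel
    · rintro ⟨u, rfl, rfl⟩
      exact ⟨S u, hTS u⟩

end Resolvent

/-! ### Quotients of bounded operators and positive square roots. -/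

section Quot

variable {H : Type u} [NormedAddCommGroup H] [InnerProductSpace ℂ H]

theorem IsQuot.smul {A : H →ₗ.[ℂ] H} {a g : H →L[ℂ] H} (h : IsQuot A a g) (k : ℂ) :
    IsQuot (k • A) a (k • g) := by
  intro x z
  rw [mem_graph_smul]
  constructor
  · rintro ⟨y, hy, rfl⟩
    obtain ⟨u, rfl, rfl⟩ := (h _ _).1 hy
    exact ⟨u, rfl, rfl⟩
  · rintro ⟨u, rfl, rfl⟩
    exact ⟨_, h.mem u, rfl⟩

theorem IsQuot.add_scalarOp {A : H →ₗ.[ℂ] H} {a g : H →L[ℂ] H} (h : IsQuot A a g) (k : ℂ) :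
    IsQuot (A + scalarOp H k) a (g + k • a) := by
  intro x z
  rw [mem_graph_add]
  constructor
  · rintro ⟨y, y', hy, hy', rfl⟩
    obtain ⟨u, rfl, rfl⟩ := (h _ _).1 hy
    rw [(mem_graph_scalarOp _ _ _).1 hy']
    exact ⟨u, rfl, rfl⟩
  · rintro ⟨u, rfl, rfl⟩
    exact ⟨_, _, h.mem u, (mem_graph_scalarOp _ _ _).2 rfl, rfl⟩

theorem IsQuot.dense_domain {A : H →ₗ.[ℂ] H} {a g : H →L[ℂ] H} (h : IsQuot A a g)
    (ha : DenseRange a) : Dense (A.domain : Set H) :=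
  ha.mono (by rintro _ ⟨u, rfl⟩; exact LinearPMap.mem_domain_of_mem_graph (h.mem u))

/-- The operator with graph `{(a u, g u)}`, for injective `a`. -/
noncomputable def quot (a g : H →L[ℂ] H) : H →ₗ.[ℂ] H :=
  (LinearMap.range ((a.prod g : H →L[ℂ] H × H) : H →ₗ[ℂ] H × H)).toLinearPMap

theorem isQuot_quot {a : H →L[ℂ] H} (ha : ∀ x, a x = 0 → x = 0) (g : H →L[ℂ] H) :
    IsQuot (quot a g) a g := by
  intro x y
  unfold quot
  rw [Submodule.toLinearPMap_graph_eq]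
  · simp [LinearMap.mem_range, Prod.ext_iff]
  · rintro ⟨x, y⟩ ⟨u, hu⟩ (rfl : x = 0)
    have h1 : a u = 0 := congrArg Prod.fst hu
    have h2 : g u = y := congrArg Prod.snd hu
    rw [← h2, ha u h1, map_zero]

/-- A commuting pair of bounded self-adjoint operators with `a` injective, such that `g a⁻¹` has the
same graph as `a⁻¹ g`; this operator is then self-adjoint. -/
structure QuotPair [CompleteSpace H] (a g : H →L[ℂ] H) : Prop where
  left : IsSelfAdjoint a
  right : IsSelfAdjoint g
  comm : Commute a g
  inj : ∀ x, a x = 0 → x = 0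
  exists_of_eq : ∀ {x y}, g x = a y → ∃ u, a u = x ∧ g u = y

variable [CompleteSpace H] {A B : H →ₗ.[ℂ] H} {a g g' : H →L[ℂ] H}

/-- From `a u = x` and `g u = y` follows `(a² + g²) u = a x + g y`, so invertibility of `a² + g²`
dictates the solution. -/
theorem QuotPair.of_isUnit {a g : H →L[ℂ] H} (ha : IsSelfAdjoint a) (hg : IsSelfAdjoint g)
    (hag : Commute a g) (hinj : ∀ x, a x = 0 → x = 0) (hu : IsUnit (a * a + g * g)) :
    QuotPair a g := by
  refine ⟨ha, hg, hag, hinj, fun {x y} h => ?_⟩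
  obtain ⟨k, hk⟩ := hu
  have hka : Commute (k : H →L[ℂ] H) a := by
    rw [hk]
    exact ((Commute.refl a).mul_left (Commute.refl a)).add_left (hag.symm.mul_left hag.symm)
  have hkg : Commute (k : H →L[ℂ] H) g := by
    rw [hk]
    exact (hag.mul_left hag).add_left ((Commute.refl g).mul_left (Commute.refl g))
  have hk' : ∀ z, (↑k⁻¹ : H →L[ℂ] H) (a (a z)) + (↑k⁻¹ : H →L[ℂ] H) (g (g z)) = z := fun z => by
    rw [← map_add]
    exact DFunLike.congr_fun (show (↑k⁻¹ : H →L[ℂ] H) * (a * a + g * g) = 1 by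
      rw [← hk, k.inv_mul]) z
  refine ⟨(↑k⁻¹ : H →L[ℂ] H) (a x + g y), ?_, ?_⟩
  · rw [← commute_apply hka.units_inv_left, map_add, ← commute_apply hag.symm, ← h, map_add, hk']
  · rw [← commute_apply hkg.units_inv_left, map_add, commute_apply hag.symm, h, map_add, hk']

/-- If `a + g = 1`, the only candidate for `u` is `x + y`. This is the case of `A = g a⁻¹` with `a =
(1 + A)⁻¹`. -/
theorem QuotPair.of_add_eq_one {a g : H →L[ℂ] H} (ha : IsSelfAdjoint a) (hg : IsSelfAdjoint g)
    (hinj : ∀ x, a x = 0 → x = 0) (h : a + g = 1) : QuotPair a g := by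
  have hga : g = 1 - a := eq_sub_of_add_eq' h
  refine ⟨ha, hg, ?_, hinj, fun {x y} hxy => ⟨x + y, ?_, ?_⟩⟩
  · rw [hga]
    exact (Commute.one_right a).sub_right (Commute.refl a)
  · rw [map_add, ← hxy]
    exact DFunLike.congr_fun h x
  · rw [map_add, hxy]
    exact DFunLike.congr_fun h y

theorem IsQuot.mem_iff (h : IsQuot A a g) (hp : QuotPair a g) (x y : H) :
    (x, y) ∈ A.graph ↔ g x = a y := by
  rw [h]
  refine ⟨?_, hp.exists_of_eq⟩
  rintro ⟨u, rfl, rfl⟩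
  exact (commute_apply hp.comm u).symm

theorem IsQuot.isSelfAdjoint (h : IsQuot A a g) (hp : QuotPair a g) : IsSelfAdjoint A := by
  refine isSelfAdjoint_of_forall_mem_graph_iff
    (h.dense_domain (denseRange_of_injective hp.left hp.inj)) fun y z => ?_
  rw [h.mem_iff hp]
  constructor
  · intro hyz p r hpr
    obtain ⟨u, rfl, rfl⟩ := (h _ _).1 hpr
    rw [inner_left_of_isSelfAdjoint hp.left, inner_left_of_isSelfAdjoint hp.right, hyz]
  · intro hyz
    refine ext_inner_left ℂ fun u => ?_
    rw [← inner_left_of_isSelfAdjoint hp.left, ← inner_left_of_isSelfAdjoint hp.right,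
      hyz _ _ (h.mem u)]

/-- An intermediate vector has two descriptions `g u = a u'`; `exists_of_eq` merges them into one
parameter `w` with `u = a w` and `u' = g w`. Hence the natural domain of the product is exactly the
range of `a²`. -/
theorem IsQuot.opMul (hA : IsQuot A a g) (hB : IsQuot B a g') (hp : QuotPair a g) :
    IsQuot (opMul B A) (a * a) (g' * g) := by
  intro x y
  rw [mem_graph_opMul]
  constructor
  · rintro ⟨m, hxm, hmy⟩
    obtain ⟨u, rfl, rfl⟩ := (hA _ _).1 hxm
    obtain ⟨u', hu', rfl⟩ := (hB _ _).1 hmy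
    obtain ⟨w, rfl, rfl⟩ := hp.exists_of_eq hu'.symm
    exact ⟨w, rfl, rfl⟩
  · rintro ⟨u, rfl, rfl⟩
    refine ⟨g (a u), hA.mem (a u), ?_⟩
    rw [← commute_apply hp.comm]
    exact hB.mem (g u)

theorem IsQuot.re_inner_nonneg (h : IsQuot A a g) (ha : 0 ≤ a) (hg : 0 ≤ g) (hag : Commute a g)
    (x : A.domain) : 0 ≤ (⟪(x : H), A x⟫_ℂ).re := by
  obtain ⟨u, hu, hu'⟩ := (h _ _).1 (A.mem_graph x)
  rw [← hu, ← hu', inner_left_of_isSelfAdjoint (.of_nonneg ha)]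
  exact (nonneg_iff_inner.1 (hag.mul_nonneg ha hg)).2 u

theorem QuotPair.of_sq_add_sq (ha : IsSelfAdjoint a) (hg : IsSelfAdjoint g) (hag : Commute a g)
    (hinj : ∀ x, a x = 0 → x = 0) (h : a * a + g * g = 1) : QuotPair a g :=
  .of_isUnit ha hg hag hinj (by rw [h]; exact isUnit_one)

theorem IsQuot.isPosSqrt (h : IsQuot B a g) (hp : QuotPair a g) (ha : 0 ≤ a) (hg : 0 ≤ g)
    (hA : IsQuot A (a * a) (g * g)) : IsPosSqrt A B :=
  ⟨h.isSelfAdjoint hp, h.re_inner_nonneg ha hg hp.comm, (h.opMul h hp).eq hA⟩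

/-- The bounded transform of a self-adjoint operator. -/
theorem exists_bounded_transform_of_isSelfAdjoint {Y : H →ₗ.[ℂ] H} (hY : IsSelfAdjoint Y) :
    ∃ a g : H →L[ℂ] H, 0 ≤ a ∧ QuotPair a g ∧ a * a + g * g = 1 ∧ IsQuot Y a g := by
  obtain ⟨a, b, w, ha, hb, hab, h1, hinj, hw, hYq, hYY⟩ :=
    exists_bounded_transform hY.dense_domain hY.isClosed
  rw [LinearPMap.isSelfAdjoint_def.1 hY] at hYY
  have h1' : ∀ x, a (a x) + b (b x) = x := DFunLike.congr_fun h1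
  have hcomm : Commute (a * a) w := by
    refine ContinuousLinearMap.ext fun u => ?_
    have hs := hYq.mem (a (a u))
    obtain ⟨m, hm, hm'⟩ := (mem_graph_opMul Y Y _ _).1 (hYY.mem (a u))
    rw [eq_of_mem_graph hm hs] at hm'
    -- It follows that `w a² u` is in the domain of `Y²` with `(1 + Y²) w a² u = w u`. Applying the
    -- resolvent `a²` gives `w a² u = a² w u`.
    have hsub : (a u - a (a (a u)), w u - w (a (a u))) ∈ Y.graph :=
      Y.graph.sub_mem (hYq.mem u) hs
    have hbb : (b * b) (a u) = a u - a (a (a u)) := by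
      rw [mul_apply_eq_comp, eq_sub_iff_add_eq, add_comm, h1']
    rw [hbb] at hm'
    obtain ⟨t, ht, ht'⟩ := (hYY _ _).1 ((mem_graph_opMul Y Y _ _).2 ⟨_, hm', hsub⟩)
    have htw : t = w u := by
      rw [← h1' t]
      change a (a t) = _ at ht
      change b (b t) = _ at ht'
      rw [ht, ht']
      abel
    rw [htw] at ht
    exact ht
  have haw : Commute a w := by
    rw [← CFC.sqrt_mul_self a]
    exact sqrt_commute hcomm
  have has : IsSelfAdjoint a := IsSelfAdjoint.of_nonneg ha
  have hws : IsSelfAdjoint w := by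
    refine isSelfAdjoint_iff_inner.2 fun u v => ?_
    refine (denseRange_of_injective has hinj).induction_on
      (p := fun v => ⟪w u, v⟫_ℂ = ⟪u, w v⟫_ℂ) v
      (isClosed_eq (by fun_prop) (by fun_prop)) fun v => ?_
    rw [← commute_apply haw, ← inner_left_of_isSelfAdjoint has u]
    exact (mem_graph_iff_of_isSelfAdjoint hY _ _).1 (hYq.mem v) _ _ (hYq.mem u)
  have hww : a * a + w * w = 1 := by
    rw [hws.star_eq] at hw
    rw [hw, h1]
  exact ⟨a, w, ha, .of_sq_add_sq has hws haw hinj hww, hww, hYq⟩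

theorem sqrt_injective_of_nonneg (ha : 0 ≤ a) (hinj : ∀ x, a x = 0 → x = 0) :
    ∀ x, CFC.sqrt a x = 0 → x = 0 :=
  injective_of_mul_self (by rwa [CFC.sqrt_mul_sqrt_self a])

/-- Positivity of `B` says `⟨a u, g u⟩ ≥ 0`. As `g` commutes with `r = a^{1/2}`, this number is `⟨r
u, g r u⟩`, and the vectors `r u` are dense; hence `g ≥ 0`. -/
theorem IsPosSqrt.exists_isQuot (h : IsPosSqrt A B) :
    ∃ a b : H →L[ℂ] H, 0 ≤ a ∧ 0 ≤ b ∧ QuotPair a b ∧ a * a + b * b = 1 ∧ IsQuot B a b := by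
  obtain ⟨a, g, ha, hp, h1, hB⟩ := exists_bounded_transform_of_isSelfAdjoint h.selfAdjoint
  refine ⟨a, g, ha, nonneg_iff_inner.2 ⟨hp.right, fun x => ?_⟩, hp, h1, hB⟩
  have hr0 : IsSelfAdjoint (CFC.sqrt a) := .of_nonneg (CFC.sqrt_nonneg a)
  refine (denseRange_of_injective hr0 (sqrt_injective_of_nonneg ha hp.inj)).induction_on
    (p := fun x => 0 ≤ (⟪x, g x⟫_ℂ).re) x ?_ fun u => ?_
  · exact isClosed_le continuous_const (Complex.continuous_re.comp (by fun_prop))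
  · rw [inner_left_of_isSelfAdjoint hr0, commute_apply (sqrt_commute hp.comm),
      ← commute_apply (sqrt_commute hp.comm), ← commute_apply (sqrt_commute hp.comm),
      ← mul_apply_eq_comp, CFC.sqrt_mul_sqrt_self a]
    obtain ⟨d, hd, hd'⟩ := (LinearPMap.mem_graph_iff _).1 (hB.mem u)
    dsimp at hd hd'
    have := h.nonneg d
    rwa [hd, hd', inner_left_of_isSelfAdjoint hp.left] at this

theorem IsPosSqrt.isSelfAdjoint (h : IsPosSqrt A B) : IsSelfAdjoint A := by
  obtain ⟨a, b, ha, hb, hp, h1, hB⟩ := h.exists_isQuot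
  have hA := hB.opMul hB hp
  rw [h.sq] at hA
  have hsq : ∀ s : H →L[ℂ] H, IsSelfAdjoint s → IsSelfAdjoint (s * s) := fun s hs =>
    (hs.commute_iff hs).1 (Commute.refl s)
  exact hA.isSelfAdjoint (.of_add_eq_one (hsq a hp.left) (hsq b hp.right)
    (fun x hx => hp.inj _ (hp.inj _ hx)) h1)

/-- `A = B²` determines `a² = (1 + A)⁻¹` and `b² = 1 - a²`, so uniqueness of bounded positive roots
determines `a`, `b` and `B = b a⁻¹`. -/
theorem IsPosSqrt.unique {B' : H →ₗ.[ℂ] H} (h : IsPosSqrt A B) (h' : IsPosSqrt A B') :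
    B = B' := by
  obtain ⟨a, b, ha, hb, hp, h1, hB⟩ := h.exists_isQuot
  obtain ⟨a', b', ha', hb', hp', h1', hB'⟩ := h'.exists_isQuot
  have hA := hB.opMul hB hp
  have hA' := hB'.opMul hB' hp'
  rw [h.sq] at hA
  rw [h'.sq] at hA'
  have haa : a * a = a' * a' ∧ b * b = b' * b' := by
    have : ∀ u, a (a u) = a' (a' u) ∧ b (b u) = b' (b' u) := fun u => by
      obtain ⟨t, ht, ht'⟩ := (hA' _ _).1 (hA.mem u)
      have htu : t = u := by
        have e1 : a (a u) + b (b u) = u := DFunLike.congr_fun h1 u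
        have e2 : a' (a' t) + b' (b' t) = t := DFunLike.congr_fun h1' t
        rw [← e1, ← e2]
        exact congrArg₂ (· + ·) ht ht'
      rw [htu] at ht ht'
      exact ⟨ht.symm, ht'.symm⟩
    exact ⟨ContinuousLinearMap.ext fun u => (this u).1, ContinuousLinearMap.ext fun u => (this u).2⟩
  have e1 : a = a' := by rw [← CFC.sqrt_mul_self a, haa.1, CFC.sqrt_mul_self a']
  have e2 : b = b' := by rw [← CFC.sqrt_mul_self b, haa.2, CFC.sqrt_mul_self b']
  subst e1 e2
  exact hB.eq hB'

theorem IsPosSqrt.posSqrt_eq (h : IsPosSqrt A B) : posSqrt A = B := by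
  have hex : ∃ B, IsPosSqrt A B := ⟨B, h⟩
  unfold posSqrt
  rw [dif_pos hex]
  exact hex.choose_spec.unique h

end Quot

/-! ### Polar decomposition of an injective closed operator. -/

section Polar

variable {H : Type u} [NormedAddCommGroup H] [InnerProductSpace ℂ H] [CompleteSpace H]

/-- The polar decomposition of an injective closed operator, in terms of
`a = (1 + X* X)^{-1/2}` and `b = |X| a`. -/
theorem exists_polar_decomposition {X : H →ₗ.[ℂ] H} (hd : Dense (X.domain : Set H))
    (hc : X.IsClosed) (hX : ∀ x, (x, (0 : H)) ∈ X.graph → x = 0) :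
    ∃ a b v : H →L[ℂ] H, 0 ≤ a ∧ 0 ≤ b ∧ QuotPair a b ∧ a * a + b * b = 1 ∧
      (∀ x, b x = 0 → x = 0) ∧ star v * v = 1 ∧ IsQuot X a (v * b) ∧
      IsQuot (opMul X† X) (a * a) (b * b) ∧ IsQuot (modulus X) a b ∧
      (∀ y z, (y, z) ∈ X†.graph ↔ b (star v y) = a z) ∧ IsPolarDecomposition X v := by
  obtain ⟨a, b, w, ha, hb, hab, h1, hinj, hw, hXq, hXX⟩ := exists_bounded_transform hd hc
  have has : IsSelfAdjoint a := IsSelfAdjoint.of_nonneg ha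
  have hbs : IsSelfAdjoint b := IsSelfAdjoint.of_nonneg hb
  have hp : QuotPair a b := .of_sq_add_sq has hbs hab hinj h1
  have hinner : ∀ x y, ⟪w x, w y⟫_ℂ = ⟪b x, b y⟫_ℂ := fun x y => by
    rw [← ContinuousLinearMap.adjoint_inner_right, ← ContinuousLinearMap.star_eq_adjoint,
      ← mul_apply_eq_comp, hw, inner_left_of_isSelfAdjoint hbs, mul_apply_eq_comp]
  have hnorm : ∀ x, ‖w x‖ = ‖b x‖ := fun x => by
    have := hinner x x
    rw [inner_self_eq_norm_sq_to_K, inner_self_eq_norm_sq_to_K] at this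
    have h2 : ‖w x‖ ^ 2 = ‖b x‖ ^ 2 := by exact_mod_cast this
    exact (sq_eq_sq₀ (norm_nonneg _) (norm_nonneg _)).1 h2
  -- Because `‖w x‖ = ‖b x‖` and `w = X a`, injectivity of `X` and of `a` passes to `b`.
  have hbinj : ∀ x, b x = 0 → x = 0 := fun x hx => by
    have h2 : w x = 0 := by rw [← norm_eq_zero, hnorm, hx, norm_zero]
    have h3 := hXq.mem x
    rw [h2] at h3
    exact hinj _ (hX _ h3)
  have hbd : DenseRange b := denseRange_of_injective hbs hbinj
  -- The isometry is prescribed on the dense range of `b` by `b u ↦ w u`, that is `|X| a u ↦ X a u`.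
  let v : H →L[ℂ] H := (w : H →ₗ[ℂ] H).extendOfNorm (b : H →ₗ[ℂ] H)
  have hvb : ∀ u, v (b u) = w u := LinearMap.extendOfNorm_eq (f := (w : H →ₗ[ℂ] H))
    (e := (b : H →ₗ[ℂ] H)) hbd ⟨1, fun x => by rw [one_mul]; exact (hnorm x).le⟩
  have hvb' : v * b = w := ContinuousLinearMap.ext hvb
  have hvv : star v * v = 1 := by
    refine clm_eq_of_comp_eq hbd fun x => hbd.eq_of_inner_left ℂ fun y => ?_
    rw [mul_apply_eq_comp, ContinuousLinearMap.star_eq_adjoint,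
      ContinuousLinearMap.adjoint_inner_left, hvb, hvb, hinner]
    rfl
  have hviso : ∀ x, ‖v x‖ = ‖x‖ := (ContinuousLinearMap.norm_map_iff_adjoint_comp_self v).2 hvv
  have hmod : IsQuot (modulus X) a b := by
    have h2 := isQuot_quot hinj b
    unfold modulus
    rwa [(h2.isPosSqrt hp ha hb hXX).posSqrt_eq]
  refine ⟨a, b, v, ha, hb, hp, h1, hbinj, hvv, by rwa [hvb'], hXX, hmod, ?_, ?_, ?_, ?_⟩
  · intro y z
    rw [mem_graph_adjoint hd]
    constructor
    · intro h
      refine ext_inner_left ℂ fun u => ?_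
      rw [← inner_left_of_isSelfAdjoint has, ← inner_left_of_isSelfAdjoint hbs,
        ContinuousLinearMap.star_eq_adjoint, ContinuousLinearMap.adjoint_inner_right, hvb]
      exact h _ _ (hXq.mem u)
    · intro h p r hpr
      obtain ⟨u, rfl, rfl⟩ := (hXq _ _).1 hpr
      rw [inner_left_of_isSelfAdjoint has, ← h, ← inner_left_of_isSelfAdjoint hbs,
        ContinuousLinearMap.star_eq_adjoint, ContinuousLinearMap.adjoint_inner_right, hvb]
  · refine eq_of_forall_mem_graph_iff fun x y => ?_
    rw [hXq]
    constructor
    · rintro ⟨u, rfl, rfl⟩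
      obtain ⟨d, hd, hd'⟩ := (LinearPMap.mem_graph_iff _).1 (hmod.mem u)
      refine (LinearPMap.mem_graph_iff _).2 ⟨d, hd, ?_⟩
      change v (modulus X d) = _
      rw [hd']
      exact hvb u
    · intro h
      obtain ⟨d, rfl, rfl⟩ := (LinearPMap.mem_graph_iff _).1 h
      obtain ⟨u, hu, hu'⟩ := (hmod _ _).1 ((modulus X).mem_graph d)
      refine ⟨u, hu, ?_⟩
      change w u = v (modulus X d)
      rw [← hvb, hu']
  · exact fun x _ => hviso x
  · intro x hx
    rw [(hasTrivialKernel_iff X).2 hX x hx, map_zero]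

end Polar

/-! ### Diagonal and shift operators on the Hilbert sum. -/

section HSum

variable {H : Type u} [NormedAddCommGroup H] [InnerProductSpace ℂ H]

theorem continuous_eval (n : ℕ) : Continuous fun x : HSum H => x n :=
  (lp.lipschitzWith_one_eval 2 n).continuous

theorem summable_norm_sq (x : HSum H) : Summable fun n => ‖x n‖ ^ 2 := by
  have := (memℓp_gen_iff (p := 2) (by norm_num)).1 (lp.memℓp x)
  simpa using this

theorem exists_hSum_of_summable {f : ℕ → H} (hf : Summable fun n => ‖f n‖ ^ 2) :
    ∃ y : HSum H, ∀ n, y n = f n :=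
  ⟨⟨f, (memℓp_gen_iff (p := 2) (by norm_num)).2 (by simpa using hf)⟩, fun _ => rfl⟩

theorem summable_norm_sq_succ (x : HSum H) : Summable fun n => ‖x (n + 1)‖ ^ 2 :=
  (summable_nat_add_iff (f := fun n => ‖x n‖ ^ 2) 1).2 (summable_norm_sq x)

theorem exists_hSum_shift (y : HSum H) : ∃ s : HSum H, s 0 = 0 ∧ ∀ n, s (n + 1) = y n := by
  let f : ℕ → H := fun n => match n with
    | 0 => 0
    | n + 1 => y n
  obtain ⟨s, hs⟩ := exists_hSum_of_summable (f := f)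
    ((summable_nat_add_iff (f := fun n => ‖f n‖ ^ 2) 1).1 (summable_norm_sq y))
  exact ⟨s, hs 0, fun n => hs (n + 1)⟩

theorem exists_hSum_of_norm_le {f g : ℕ → H} (hg : Summable fun n => ‖g n‖ ^ 2) (C : ℝ)
    (h : ∀ n, ‖f n‖ ≤ C * ‖g n‖) : ∃ y : HSum H, ∀ n, y n = f n := by
  refine exists_hSum_of_summable (Summable.of_nonneg_of_le (fun n => by positivity) (fun n => ?_)
    (hg.mul_left (C ^ 2)))
  rw [← mul_pow]
  exact pow_le_pow_left₀ (norm_nonneg _) (h n) 2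

/-- For intermediate vectors of `Aₙ²` one has `‖m n‖² = ⟨f n, g n⟩ ≤ ‖f n‖² + ‖g n‖²`, so they are
square summable for free. This is why domains of products can be tested in each summand. -/
theorem exists_hSum_of_inner {f g m : ℕ → H} (hf : Summable fun n => ‖f n‖ ^ 2)
    (hg : Summable fun n => ‖g n‖ ^ 2) (h : ∀ n, ⟪m n, m n⟫_ℂ = ⟪f n, g n⟫_ℂ) :
    ∃ y : HSum H, ∀ n, y n = m n := by
  refine exists_hSum_of_summable (Summable.of_nonneg_of_le (fun n => by positivity) (fun n => ?_)
    (hf.add hg))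
  have h1 := norm_inner_le_norm (𝕜 := ℂ) (f n) (g n)
  rw [← h n, inner_self_eq_norm_sq_to_K] at h1
  have h2 : ‖m n‖ ^ 2 ≤ ‖f n‖ * ‖g n‖ := by simpa using h1
  nlinarith [sq_nonneg (‖f n‖ - ‖g n‖), sq_nonneg ‖f n‖, sq_nonneg ‖g n‖]

theorem dense_of_single_mem {M : Submodule ℂ (HSum H)} {D : ℕ → Set H} (hD : ∀ n, Dense (D n))
    (h : ∀ n, ∀ x ∈ D n, lp.single 2 n x ∈ M) : Dense (M : Set (HSum H)) := by
  intro x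
  have h1 : ∀ n y, lp.single 2 n y ∈ M.topologicalClosure := by
    intro n y
    have hc : Continuous fun y : H => (lp.single 2 n y : HSum H) :=
      (lp.singleContinuousLinearMap ℂ (fun _ : ℕ => H) 2 n).continuous
    have := closure_mono (t := (M : Set (HSum H))) (by
      rintro _ ⟨z, hz, rfl⟩
      exact h n z hz) (image_closure_subset_closure_image hc ⟨y, hD n y, rfl⟩)
    exact this
  have h2 := lp.hasSum_single (by norm_num) x
  exact (Submodule.isClosed_topologicalClosure M).mem_of_tendsto h2
    (Filter.Eventually.of_forall fun s => Submodule.sum_mem _ fun n _ => h1 n _)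

variable {A : ℕ → H →ₗ.[ℂ] H}

theorem single_mem_graph_diagOp {n : ℕ} {x y : H} (h : (x, y) ∈ (A n).graph) :
    (lp.single 2 n x, lp.single 2 n y) ∈ (diagOp A).graph := by
  rw [mem_graph_diagOp]
  intro k
  rcases eq_or_ne k n with rfl | hk
  · simpa using h
  · rw [lp.single_apply_ne _ _ _ hk, lp.single_apply_ne _ _ _ hk]
    exact (A k).graph.zero_mem

theorem single_mem_graph_raisingOp {n : ℕ} {x y : H} (h : (x, y) ∈ (A n).graph) :
    (lp.single 2 n x, lp.single 2 (n + 1) y) ∈ (raisingOp A).graph := by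
  rw [mem_graph_raisingOp]
  refine ⟨lp.single_apply_ne _ _ _ (by simp), fun k => ?_⟩
  rcases eq_or_ne k n with rfl | hk
  · simpa using h
  · rw [lp.single_apply_ne _ _ _ hk, lp.single_apply_ne _ _ _ (by simpa using hk)]
    exact (A k).graph.zero_mem

theorem single_succ_mem_graph_loweringOp {n : ℕ} {x y : H} (h : (x, y) ∈ (A n).graph) :
    (lp.single 2 (n + 1) x, lp.single 2 n y) ∈ (loweringOp A).graph := by
  rw [mem_graph_loweringOp]
  intro k
  rcases eq_or_ne k n with rfl | hk
  · simpa using h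
  · rw [lp.single_apply_ne _ _ _ hk, lp.single_apply_ne _ _ _ (by simpa using hk)]
    exact (A k).graph.zero_mem

theorem single_zero_mem_graph_loweringOp (x : H) :
    (lp.single 2 0 x, 0) ∈ (loweringOp A).graph := by
  rw [mem_graph_loweringOp]
  intro k
  rw [lp.single_apply_ne _ _ _ (by simp)]
  exact (A k).graph.zero_mem

theorem dense_domain_raisingOp (hA : ∀ n, Dense ((A n).domain : Set H)) :
    Dense ((raisingOp A).domain : Set (HSum H)) :=
  dense_of_single_mem hA fun _ _ hx => by
    obtain ⟨y, hy⟩ := LinearPMap.mem_domain_iff.1 hx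
    exact LinearPMap.mem_domain_of_mem_graph (single_mem_graph_raisingOp hy)

theorem dense_domain_diagOp (hA : ∀ n, Dense ((A n).domain : Set H)) :
    Dense ((diagOp A).domain : Set (HSum H)) :=
  dense_of_single_mem hA fun _ _ hx => by
    obtain ⟨y, hy⟩ := LinearPMap.mem_domain_iff.1 hx
    exact LinearPMap.mem_domain_of_mem_graph (single_mem_graph_diagOp hy)

theorem isClosed_raisingOp (hA : ∀ n, (A n).IsClosed) : (raisingOp A).IsClosed := by
  have : ((raisingOp A).graph : Set (HSum H × HSum H)) = {p | p.2 0 = 0} ∩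
      ⋂ n, {p | (p.1 n, p.2 (n + 1)) ∈ (A n).graph} := by
    ext ⟨x, y⟩
    simpa using mem_graph_raisingOp A x y
  unfold LinearPMap.IsClosed
  rw [this]
  refine IsClosed.inter (isClosed_eq ((continuous_eval 0).comp continuous_snd) continuous_const)
    (isClosed_iInter fun n => (hA n).preimage ?_)
  exact ((continuous_eval n).comp continuous_fst).prodMk
    ((continuous_eval (n + 1)).comp continuous_snd)

variable [CompleteSpace H]

/-- Testing against vectors in a single summand reduces adjointness to each entry; conversely inner
products are summed termwise. -/
theorem isSelfAdjoint_diagOp (hA : ∀ n, IsSelfAdjoint (A n)) : IsSelfAdjoint (diagOp A) := by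
  refine isSelfAdjoint_of_forall_mem_graph_iff
    (dense_domain_diagOp fun n => (hA n).dense_domain) fun y z => ?_
  rw [mem_graph_diagOp]
  constructor
  · intro h a b hab
    rw [lp.inner_eq_tsum, lp.inner_eq_tsum]
    rw [mem_graph_diagOp] at hab
    exact tsum_congr fun n => (mem_graph_iff_of_isSelfAdjoint (hA n) _ _).1 (h n) _ _ (hab n)
  · intro h n
    rw [mem_graph_iff_of_isSelfAdjoint (hA n)]
    intro a b hab
    have := h _ _ (single_mem_graph_diagOp hab)
    rwa [lp.inner_single_left, lp.inner_single_left] at this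

/-- As for diagonal operators, with one change: a raised vector vanishes in summand `0`, so the sum
starts at `1` and can be reindexed. -/
theorem adjoint_raisingOp (hA : ∀ n, IsSelfAdjoint (A n)) : (raisingOp A)† = loweringOp A := by
  have hd : Dense ((raisingOp A).domain : Set (HSum H)) :=
    dense_domain_raisingOp fun n => (hA n).dense_domain
  refine eq_of_forall_mem_graph_iff fun y z =>
    (mem_graph_adjoint hd y z).trans (Iff.trans ?_ (mem_graph_loweringOp A y z).symm)
  constructor
  · intro h n
    rw [mem_graph_iff_of_isSelfAdjoint (hA n)]
    intro a b hab
    have := h _ _ (single_mem_graph_raisingOp hab)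
    rwa [lp.inner_single_left, lp.inner_single_left] at this
  · intro h a b hab
    obtain ⟨hb, hab⟩ := (mem_graph_raisingOp A _ _).1 hab
    have h1 : ⟪b, y⟫_ℂ = ∑' n, ⟪b (n + 1), y (n + 1)⟫_ℂ := by
      rw [lp.inner_eq_tsum, Summable.tsum_eq_zero_add (f := fun n => ⟪b n, y n⟫_ℂ)
        (lp.summable_inner (𝕜 := ℂ) b y), hb, inner_zero_left, zero_add]
    rw [h1, lp.inner_eq_tsum]
    exact tsum_congr fun n => (mem_graph_iff_of_isSelfAdjoint (hA n) _ _).1 (h n) _ _ (hab n)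

theorem inner_self_of_mem_graph {A : H →ₗ.[ℂ] H} (hA : IsSelfAdjoint A) {x m z : H}
    (h : (x, m) ∈ A.graph) (h' : (m, z) ∈ A.graph) : ⟪m, m⟫_ℂ = ⟪x, z⟫_ℂ :=
  (mem_graph_iff_of_isSelfAdjoint hA _ _).1 h' _ _ h

theorem mem_graph_opMul_diagOp (hA : ∀ n, IsSelfAdjoint (A n)) (x z : HSum H) :
    (x, z) ∈ (opMul (diagOp A) (diagOp A)).graph ↔
      ∀ n, (x n, z n) ∈ (opMul (A n) (A n)).graph := by
  simp only [mem_graph_opMul, mem_graph_diagOp]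
  constructor
  · rintro ⟨m, h, h'⟩ n
    exact ⟨m n, h n, h' n⟩
  · intro h
    choose m h h' using h
    obtain ⟨y, hy⟩ := exists_hSum_of_inner (f := x) (g := z) (m := m) (summable_norm_sq x)
      (summable_norm_sq z) fun n => inner_self_of_mem_graph (hA n) (h n) (h' n)
    exact ⟨y, fun n => by rw [hy]; exact h n, fun n => by rw [hy]; exact h' n⟩

theorem opMul_loweringOp_raisingOp (hA : ∀ n, IsSelfAdjoint (A n)) :
    opMul (loweringOp A) (raisingOp A) = opMul (diagOp A) (diagOp A) := by
  refine eq_of_forall_mem_graph_iff fun x z => ?_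
  rw [mem_graph_opMul_diagOp hA]
  simp only [mem_graph_opMul, mem_graph_raisingOp, mem_graph_loweringOp]
  constructor
  · rintro ⟨m, h, h'⟩ n
    exact ⟨m (n + 1), h.2 n, h' n⟩
  · intro h
    choose m h h' using h
    obtain ⟨y, hy⟩ := exists_hSum_of_inner (f := x) (g := z) (m := m) (summable_norm_sq x)
      (summable_norm_sq z) fun n => inner_self_of_mem_graph (hA n) (h n) (h' n)
    obtain ⟨s, hs0, hs⟩ := exists_hSum_shift y
    refine ⟨s, ⟨hs0, fun n => ?_⟩, fun n => ?_⟩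
    · rw [hs, hy]
      exact h n
    · rw [hs, hy]
      exact h' n

theorem mem_graph_opMul_raisingOp_loweringOp (hA : ∀ n, IsSelfAdjoint (A n)) (x z : HSum H) :
    (x, z) ∈ (opMul (raisingOp A) (loweringOp A)).graph ↔
      z 0 = 0 ∧ ∀ n, (x (n + 1), z (n + 1)) ∈ (opMul (A n) (A n)).graph := by
  simp only [mem_graph_opMul, mem_graph_raisingOp, mem_graph_loweringOp]
  constructor
  · rintro ⟨m, h, h0, h'⟩
    exact ⟨h0, fun n => ⟨m n, h n, h' n⟩⟩
  · rintro ⟨h0, h⟩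
    choose m h h' using h
    obtain ⟨y, hy⟩ := exists_hSum_of_inner (f := fun n => x (n + 1)) (g := fun n => z (n + 1))
      (m := m) (summable_norm_sq_succ x) (summable_norm_sq_succ z)
      fun n => inner_self_of_mem_graph (hA n) (h n) (h' n)
    exact ⟨y, fun n => by rw [hy]; exact h n, h0, fun n => by rw [hy]; exact h' n⟩

end HSum

/-! ### The weights as quotients of bounded operators. -/

section Weights

variable {H : Type u} [NormedAddCommGroup H] [InnerProductSpace ℂ H] [CompleteSpace H]

theorem ofReal_smul_nonneg {r : ℝ} (hr : 0 ≤ r) {g : H →L[ℂ] H} (hg : 0 ≤ g) :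
    0 ≤ (r : ℂ) • g := by
  rw [nonneg_iff_inner] at hg ⊢
  refine ⟨IsSelfAdjoint.smul (Complex.conj_ofReal r) hg.1, fun x => ?_⟩
  rw [smul_apply, inner_smul_right, Complex.re_ofReal_mul]
  exact mul_nonneg hr (hg.2 x)

theorem mul_self_nonneg_of_isSelfAdjoint {g : H →L[ℂ] H} (hg : IsSelfAdjoint g) : 0 ≤ g * g := by
  nth_rewrite 1 [← hg.star_eq]
  exact star_mul_self_nonneg g

theorem inner_mul_self {g : H →L[ℂ] H} (hg : IsSelfAdjoint g) (x : H) :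
    ⟪(g * g) x, x⟫_ℂ = ((‖g x‖ ^ 2 : ℝ) : ℂ) := by
  rw [mul_apply_eq_comp, inner_left_of_isSelfAdjoint hg, inner_self_eq_norm_sq_to_K]
  norm_cast

/-- Since `s ≥ 0` and `r ≤ 1`, one has `a² + g² ≥ r (a² + b²) = r > 0`, which makes `a² + g²`
invertible. -/
theorem QuotPair.of_mul_self_eq {a b g : H →L[ℂ] H} (hp : QuotPair a b)
    (h1 : a * a + b * b = 1) {r s : ℝ} (hr : 0 < r) (hr1 : r ≤ 1) (hs : 0 ≤ s)
    (hg : IsSelfAdjoint g) (hag : Commute a g)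
    (hgg : g * g = (r : ℂ) • (b * b) + (s : ℂ) • (a * a)) : QuotPair a g := by
  refine .of_isUnit hp.left hg hag hp.inj ?_
  refine ContinuousLinearMap.isUnit_of_forall_le_norm_inner_map (c := ⟨r, hr.le⟩) _ hr fun x => ?_
  have e1 : ‖a x‖ ^ 2 + ‖b x‖ ^ 2 = ‖x‖ ^ 2 := by
    have : ⟪(a * a + b * b) x, x⟫_ℂ = ⟪x, x⟫_ℂ := by rw [h1, one_apply_eq_self]
    rw [add_apply, inner_add_left, inner_mul_self hp.left,
      inner_mul_self hp.right, inner_self_eq_norm_sq_to_K] at this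
    refine Complex.ofReal_injective ?_
    rw [Complex.ofReal_add, this]
    norm_cast
  have e2 : ⟪(a * a + g * g) x, x⟫_ℂ
      = ((‖a x‖ ^ 2 + (r * ‖b x‖ ^ 2 + s * ‖a x‖ ^ 2) : ℝ) : ℂ) := by
    rw [hgg, add_apply, add_apply, smul_apply, smul_apply, inner_add_left, inner_add_left,
      inner_smul_left, inner_smul_left, inner_mul_self hp.left, inner_mul_self hp.right,
      Complex.conj_ofReal, Complex.conj_ofReal]
    push_cast
    rfl
  rw [e2, Complex.norm_real, Real.norm_of_nonneg (by positivity), ← e1]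
  change (‖a x‖ ^ 2 + ‖b x‖ ^ 2) * r ≤ _
  nlinarith [mul_nonneg hs (sq_nonneg ‖a x‖), mul_nonneg (sub_nonneg.2 hr1) (sq_nonneg ‖a x‖)]

theorem lam_sq {q : ℝ} (hq₀ : 0 < q) (hq₁ : q < 1) (n : ℕ) : lam q n ^ 2 = 1 - q ^ (2 * n) := by
  unfold lam
  exact Real.sq_sqrt (sub_nonneg.2 (pow_le_one₀ hq₀.le hq₁.le))

/-- Bounded operators which parametrize the graphs of `Y₀` and of the weights. -/
structure WeightData (q c : ℝ) (Y₀ : H →ₗ.[ℂ] H) (a b : H →L[ℂ] H) (g : ℕ → H →L[ℂ] H) :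
    Prop where
  left_nonneg : 0 ≤ a
  pair : QuotPair a b
  sq_add_sq : a * a + b * b = 1
  isQuot : IsQuot Y₀ a b
  weight_nonneg : ∀ n, 0 ≤ g n
  weight_pair : ∀ n, QuotPair a (g n)
  weight_isQuot : ∀ n, IsQuot (weight q c Y₀ n) a (g n)
  weight_sq : ∀ n, g n * g n =
    (1 - (q : ℂ) ^ (2 * n + 2)) • ((q : ℂ) ^ (2 * n) • (b * b) + (c : ℂ) • (a * a))
  weight_commute : ∀ n s, Commute a s → Commute b s → Commute (g n) s

/-- If `Y₀ = b a⁻¹`, then `q²ⁿ Y₀² + c` is the quotient of `q²ⁿ b² + c a²` by `a²`; its positive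
root is the quotient of the bounded root by `a`. All weights share the denominator `a`. -/
theorem exists_weightData {q c : ℝ} (hq₀ : 0 < q) (hq₁ : q < 1) (hc : 0 ≤ c) {Y₀ : H →ₗ.[ℂ] H}
    (hY : IsSelfAdjoint Y₀) : ∃ a b g, WeightData q c Y₀ a b g := by
  obtain ⟨a, b, ha, hp, h1, hYq⟩ := exists_bounded_transform_of_isSelfAdjoint hY
  let G : ℕ → H →L[ℂ] H := fun n => ((q ^ (2 * n) : ℝ) : ℂ) • (b * b) + (c : ℂ) • (a * a)
  have hG : ∀ n, 0 ≤ G n := fun n => add_nonneg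
    (ofReal_smul_nonneg (by positivity) (mul_self_nonneg_of_isSelfAdjoint hp.right))
    (ofReal_smul_nonneg hc (mul_self_nonneg_of_isSelfAdjoint hp.left))
  have hs0 : ∀ n, 0 ≤ CFC.sqrt (G n) := fun n => CFC.sqrt_nonneg _
  have hss : ∀ n, CFC.sqrt (G n) * CFC.sqrt (G n) = G n := fun n =>
    CFC.sqrt_mul_sqrt_self _ (hG n)
  have hcomm : ∀ n s, Commute a s → Commute b s → Commute (CFC.sqrt (G n)) s :=
    fun n s has hbs => sqrt_commute
      (((hbs.mul_left hbs).smul_left _).add_left ((has.mul_left has).smul_left _))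
  have hq1 : ∀ n, q ^ n ≤ 1 := fun n => pow_le_one₀ hq₀.le hq₁.le
  have hpair : ∀ n, QuotPair a (CFC.sqrt (G n)) := fun n =>
    hp.of_mul_self_eq h1 (r := q ^ (2 * n)) (s := c) (by positivity) (hq1 _) hc
      (.of_nonneg (hs0 n)) (hcomm n a (Commute.refl a) hp.comm.symm).symm (hss n)
  have hroot : ∀ n, posSqrt (((q : ℂ) ^ (2 * n)) • opMul Y₀ Y₀ + scalarOp H (c : ℂ)) =
      quot a (CFC.sqrt (G n)) := fun n => by
    refine ((isQuot_quot hp.inj _).isPosSqrt (hpair n) ha (hs0 n) ?_).posSqrt_eq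
    rw [hss]
    have := ((hYq.opMul hYq hp).smul ((q : ℂ) ^ (2 * n))).add_scalarOp (c : ℂ)
    simpa [G] using this
  have hlam : ∀ n, 0 ≤ lam q n := fun n => Real.sqrt_nonneg _
  have hw0 : ∀ n, 0 ≤ (lam q (n + 1) : ℂ) • CFC.sqrt (G n) := fun n =>
    ofReal_smul_nonneg (hlam _) (hs0 n)
  have hwc : ∀ n s, Commute a s → Commute b s →
      Commute ((lam q (n + 1) : ℂ) • CFC.sqrt (G n)) s :=
    fun n s has hbs => (hcomm n s has hbs).smul_left _
  have hws : ∀ n, ((lam q (n + 1) : ℂ) • CFC.sqrt (G n)) * ((lam q (n + 1) : ℂ) • CFC.sqrt (G n))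
      = (1 - (q : ℂ) ^ (2 * n + 2)) • ((q : ℂ) ^ (2 * n) • (b * b) + (c : ℂ) • (a * a)) :=
    fun n => by
      have e : (lam q (n + 1) : ℂ) * lam q (n + 1) = 1 - (q : ℂ) ^ (2 * n + 2) := by
        have := lam_sq hq₀ hq₁ (n + 1)
        rw [← sq]
        exact_mod_cast this
      rw [smul_mul_smul_comm, hss, e]
      simp [G]
  refine ⟨a, b, fun n => (lam q (n + 1) : ℂ) • CFC.sqrt (G n), ha, hp, h1, hYq, hw0, fun n => ?_,
    fun n => ?_, hws, hwc⟩
  · have hq2 : q ^ (2 * n + 2) < 1 := pow_lt_one₀ hq₀.le hq₁ (by simp)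
    have h3 : 0 < 1 - q ^ (2 * n + 2) := sub_pos.2 hq2
    have h4 : 1 - q ^ (2 * n + 2) ≤ 1 := sub_le_self _ (by positivity)
    -- The constants carry the factor `λₙ₊₁²`; it is positive because `q < 1`, so the scaled root
    -- keeps the full denominator `a`.
    refine hp.of_mul_self_eq h1 (r := (1 - q ^ (2 * n + 2)) * q ^ (2 * n))
      (s := (1 - q ^ (2 * n + 2)) * c) (by positivity) (mul_le_one₀ h4 (by positivity) (hq1 _))
      (by positivity) (.of_nonneg (hw0 n)) (hwc n a (Commute.refl a) hp.comm.symm).symm ?_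
    rw [hws, smul_add, smul_smul, smul_smul]
    push_cast
    rfl
  · unfold weight
    rw [hroot]
    exact (isQuot_quot hp.inj _).smul _

end Weights

/-! ### The model satisfies the relations. -/

section Model

theorem hasTrivialKernel_modelY {H : Type u} [NormedAddCommGroup H] [InnerProductSpace ℂ H]
    {q : ℝ} {Y₀ : H →ₗ.[ℂ] H} (hq₀ : 0 < q) (hY : HasTrivialKernel Y₀) :
    HasTrivialKernel (modelY q Y₀) := by
  rw [hasTrivialKernel_iff] at hY ⊢
  intro x hx
  ext n
  obtain ⟨y, hy, hy0⟩ := (mem_graph_smul _ _ _ _).1 ((mem_graph_diagOp _ _ _).1 hx n)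
  have hqn : (q : ℂ) ^ (2 * n) ≠ 0 := pow_ne_zero _ (by exact_mod_cast hq₀.ne')
  rw [(smul_eq_zero.1 hy0.symm).resolve_left hqn] at hy
  exact hY _ hy

variable {H : Type u} [NormedAddCommGroup H] [InnerProductSpace ℂ H] [CompleteSpace H]
  {q c : ℝ} {Y₀ : H →ₗ.[ℂ] H} {a b : H →L[ℂ] H} {g : ℕ → H →L[ℂ] H}

theorem WeightData.isSelfAdjoint_weight (hw : WeightData q c Y₀ a b g) (n : ℕ) :
    IsSelfAdjoint (weight q c Y₀ n) :=
  (hw.weight_isQuot n).isSelfAdjoint (hw.weight_pair n)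

theorem WeightData.scaled_pair (hw : WeightData q c Y₀ a b g) (hq₀ : 0 < q) (hq₁ : q < 1) (n : ℕ) :
    QuotPair a ((q : ℂ) ^ (2 * n) • b) := by
  refine hw.pair.of_mul_self_eq hw.sq_add_sq (r := q ^ (2 * n) * q ^ (2 * n)) (s := 0)
    (by positivity) ?_ le_rfl ?_ (hw.pair.comm.smul_right _) ?_
  · exact mul_le_one₀ (pow_le_one₀ hq₀.le hq₁.le) (by positivity) (pow_le_one₀ hq₀.le hq₁.le)
  · have : IsSelfAdjoint ((q : ℂ) ^ (2 * n)) := by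
      have h : IsSelfAdjoint (q : ℂ) := Complex.conj_ofReal q
      exact h.pow _
    exact this.smul hw.pair.right
  · rw [smul_mul_smul_comm]
    simp

theorem WeightData.isSelfAdjoint_scaled (hw : WeightData q c Y₀ a b g) (hq₀ : 0 < q) (hq₁ : q < 1)
    (n : ℕ) : IsSelfAdjoint ((q : ℂ) ^ (2 * n) • Y₀) :=
  (hw.isQuot.smul _).isSelfAdjoint (hw.scaled_pair hq₀ hq₁ n)

theorem WeightData.adjoint_modelX (hw : WeightData q c Y₀ a b g) :
    (modelX q c Y₀)† = modelXstar q c Y₀ :=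
  adjoint_raisingOp hw.isSelfAdjoint_weight

theorem WeightData.dense_modelX (hw : WeightData q c Y₀ a b g) :
    Dense ((modelX q c Y₀).domain : Set (HSum H)) :=
  dense_domain_raisingOp fun n => (hw.isSelfAdjoint_weight n).dense_domain

theorem WeightData.isClosed_modelX (hw : WeightData q c Y₀ a b g) : (modelX q c Y₀).IsClosed :=
  isClosed_raisingOp fun n => (hw.isSelfAdjoint_weight n).isClosed

theorem WeightData.isSelfAdjoint_modelY (hw : WeightData q c Y₀ a b g) (hq₀ : 0 < q)
    (hq₁ : q < 1) : IsSelfAdjoint (modelY q Y₀) :=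
  isSelfAdjoint_diagOp (hw.isSelfAdjoint_scaled hq₀ hq₁)

theorem WeightData.weight_sq_apply (hw : WeightData q c Y₀ a b g) (n : ℕ) (x : H) :
    g n (g n x) = (1 - (q : ℂ) ^ (2 * n + 2)) • ((q : ℂ) ^ (2 * n) • b (b x) + (c : ℂ) • a (a x)) :=
  DFunLike.congr_fun (hw.weight_sq n) x

theorem WeightData.norm_weight_sq (hw : WeightData q c Y₀ a b g) (n : ℕ) (x : H) :
    ‖g n x‖ ^ 2 = (1 - q ^ (2 * n + 2)) * (q ^ (2 * n) * ‖b x‖ ^ 2 + c * ‖a x‖ ^ 2) := by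
  have h := inner_mul_self (hw.weight_pair n).right x
  have hq : ∀ n, (starRingEnd ℂ) ((q : ℂ) ^ n) = (q : ℂ) ^ n := fun n => by
    rw [map_pow, Complex.conj_ofReal]
  rw [hw.weight_sq, smul_apply, inner_smul_left, add_apply, inner_add_left, smul_apply, smul_apply,
    inner_smul_left, inner_smul_left, inner_mul_self hw.pair.left, inner_mul_self hw.pair.right,
    map_sub, map_one, hq, hq, Complex.conj_ofReal] at h
  exact_mod_cast h.symm

/-- The bound is uniform in `n` because `λₙ₊₁² ≥ 1 - q²` and `q⁴ⁿ ≤ q²ⁿ`. It shows that vectors in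
the domain of `X` are in the domain of `Y`. The sharper constant would be `(1 - q²)^{-1/2}`. -/
theorem WeightData.norm_left_le (hw : WeightData q c Y₀ a b g) (hq₀ : 0 < q) (hq₁ : q < 1)
    (hc : 0 ≤ c) (n : ℕ) (x : H) :
    ‖(q : ℂ) ^ (2 * n) • b x‖ ≤ (1 - q ^ 2)⁻¹ * ‖g n x‖ := by
  have h := hw.norm_weight_sq n x
  have h1 : 0 < 1 - q ^ 2 := sub_pos.2 (pow_lt_one₀ hq₀.le hq₁ (by simp))
  rw [norm_smul, norm_pow, Complex.norm_real, Real.norm_of_nonneg hq₀.le, inv_mul_eq_div,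
    le_div_iff₀ h1]
  refine abs_le_of_sq_le_sq' ?_ (norm_nonneg _) |>.2
  rw [h]
  have hr1 : q ^ (2 * n) ≤ 1 := pow_le_one₀ hq₀.le hq₁.le
  have hr0 : 0 < q ^ (2 * n) := by positivity
  have hp : q ^ (2 * n + 2) ≤ q ^ 2 := pow_le_pow_of_le_one hq₀.le hq₁.le (by omega)
  have hd1 : 1 - q ^ 2 ≤ 1 := sub_le_self _ (by positivity)
  have hn := sq_nonneg ‖b x‖
  calc (q ^ (2 * n) * ‖b x‖ * (1 - q ^ 2)) ^ 2
      = (q ^ (2 * n) * (1 - q ^ 2)) * ((1 - q ^ 2) * (q ^ (2 * n) * ‖b x‖ ^ 2)) := by ring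
    _ ≤ 1 * ((1 - q ^ 2) * (q ^ (2 * n) * ‖b x‖ ^ 2)) :=
        mul_le_mul_of_nonneg_right (mul_le_one₀ hr1 h1.le hd1) (by positivity)
    _ ≤ (1 - q ^ (2 * n + 2)) * (q ^ (2 * n) * ‖b x‖ ^ 2 + c * ‖a x‖ ^ 2) := by
        rw [one_mul]
        exact mul_le_mul (by linarith) (le_add_of_nonneg_right (by positivity)) (by positivity)
          (by linarith)

/-- Dropping the term `c a² x` cannot increase the norm, since the cross term `⟨b² x, a² x⟩ = ‖a b
x‖²` is non-negative. It shows that vectors in the domain of `X* X` are in the domain of `Y²`. -/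
theorem WeightData.norm_left_left_le (hw : WeightData q c Y₀ a b g) (hq₀ : 0 < q) (hq₁ : q < 1)
    (hc : 0 ≤ c) (n : ℕ) (x : H) :
    ‖(q : ℂ) ^ (4 * n) • b (b x)‖ ≤ (1 - q ^ 2)⁻¹ * ‖g n (g n x)‖ := by
  have h1 : 0 < 1 - q ^ 2 := sub_pos.2 (pow_lt_one₀ hq₀.le hq₁ (by simp))
  have hp : q ^ (2 * n + 2) ≤ q ^ 2 := pow_le_pow_of_le_one hq₀.le hq₁.le (by omega)
  have hr1 : q ^ (2 * n) ≤ 1 := pow_le_one₀ hq₀.le hq₁.le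
  rw [hw.weight_sq_apply, norm_smul, norm_smul, norm_pow, Complex.norm_real,
    Real.norm_of_nonneg hq₀.le, inv_mul_eq_div, le_div_iff₀ h1]
  have e1 : ‖(1 - (q : ℂ) ^ (2 * n + 2))‖ = 1 - q ^ (2 * n + 2) := by
    rw [← Real.norm_of_nonneg (show 0 ≤ 1 - q ^ (2 * n + 2) by linarith), ← Complex.norm_real]
    norm_cast
  have e2 : q ^ (2 * n) * ‖b (b x)‖ ≤ ‖(q : ℂ) ^ (2 * n) • b (b x) + (c : ℂ) • a (a x)‖ := by
    refine abs_le_of_sq_le_sq' ?_ (norm_nonneg _) |>.2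
    have hcross : ⟪b (b x), a (a x)⟫_ℂ = ((‖a (b x)‖ ^ 2 : ℝ) : ℂ) := by
      rw [← inner_mul_self hw.pair.left, inner_left_of_isSelfAdjoint hw.pair.right,
        commute_apply hw.pair.comm.symm, commute_apply hw.pair.comm.symm, mul_apply_eq_comp,
        inner_left_of_isSelfAdjoint hw.pair.left, inner_left_of_isSelfAdjoint hw.pair.left]
    rw [norm_add_sq (𝕜 := ℂ), norm_smul, norm_pow, Complex.norm_real, Real.norm_of_nonneg hq₀.le]
    have : 0 ≤ RCLike.re ⟪(q : ℂ) ^ (2 * n) • b (b x), (c : ℂ) • a (a x)⟫_ℂ := by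
      rw [inner_smul_left, inner_smul_right, hcross, map_pow, Complex.conj_ofReal]
      have : (q : ℂ) ^ (2 * n) * (c * ((‖a (b x)‖ ^ 2 : ℝ) : ℂ))
        = ((q ^ (2 * n) * (c * ‖a (b x)‖ ^ 2) : ℝ) : ℂ) := by push_cast; rfl
      rw [this, RCLike.re_eq_complex_re, Complex.ofReal_re]
      positivity
    nlinarith [sq_nonneg ‖(c : ℂ) • a (a x)‖]
  rw [e1]
  calc q ^ (4 * n) * ‖b (b x)‖ * (1 - q ^ 2)
      = q ^ (2 * n) * ((1 - q ^ 2) * (q ^ (2 * n) * ‖b (b x)‖)) := by ring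
    _ ≤ 1 * ((1 - q ^ 2) * (q ^ (2 * n) * ‖b (b x)‖)) :=
        mul_le_mul_of_nonneg_right hr1 (by positivity)
    _ ≤ _ := by
        rw [one_mul]
        exact mul_le_mul (by linarith) e2 (by positivity) (by linarith)

theorem WeightData.opMul_modelY_modelX_le (hw : WeightData q c Y₀ a b g) (hq₀ : 0 < q)
    (hq₁ : q < 1) (hc : 0 ≤ c) :
    opMul (modelY q Y₀) (modelX q c Y₀) ≤ ((q : ℂ) ^ 2) • opMul (modelX q c Y₀) (modelY q Y₀) := by
  refine le_of_forall_mem_graph fun x z hxz => ?_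
  have hq : (q : ℂ) ≠ 0 := by exact_mod_cast hq₀.ne'
  obtain ⟨m, hX, hY⟩ := (mem_graph_opMul _ _ _ _).1 hxz
  obtain ⟨hm0, hX⟩ := (mem_graph_raisingOp _ _ _).1 hX
  replace hY := (mem_graph_diagOp _ _ _).1 hY
  have hu : ∀ n, ∃ u, a (a u) = x n ∧ (q : ℂ) ^ (2 * (n + 1)) • b (g n u) = z (n + 1) := fun n =>
    ((hw.weight_isQuot n).opMul (hw.isQuot.smul _) (hw.weight_pair n) _ _).1
      ((mem_graph_opMul _ _ _ _).2 ⟨_, hX n, hY (n + 1)⟩)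
  choose u hux huz using hu
  have hm : ∀ n, m (n + 1) = g n (a (u n)) := fun n => by
    have h1 := hX n
    rw [← hux] at h1
    exact eq_of_mem_graph h1 ((hw.weight_isQuot n).mem _)
  -- Entrywise both products are `q²ⁿ⁺²` times `Y₀` times the weight; what needs proof is that `Y x`
  -- is square summable.
  obtain ⟨y, hy⟩ := exists_hSum_of_norm_le (f := fun n => (q : ℂ) ^ (2 * n) • b (a (u n)))
    (summable_norm_sq_succ m) (1 - q ^ 2)⁻¹ fun n => by
      rw [hm]
      exact hw.norm_left_le hq₀ hq₁ hc n _
  refine (mem_graph_smul _ _ _ _).2 ⟨((q : ℂ) ^ 2)⁻¹ • z, (mem_graph_opMul _ _ _ _).2 ⟨y, ?_, ?_⟩, ?_⟩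
  · refine (mem_graph_diagOp _ _ _).2 fun n => ?_
    rw [hy, ← hux]
    exact (hw.isQuot.smul _).mem _
  · refine (mem_graph_raisingOp _ _ _).2 ⟨?_, fun n => ?_⟩
    · have h0 := hY 0
      rw [hm0] at h0
      rw [lp.coeFn_smul, Pi.smul_apply, eq_of_mem_graph h0 (Submodule.zero_mem _), smul_zero]
    · rw [lp.coeFn_smul, Pi.smul_apply, hy, ← huz, ← commute_apply hw.pair.comm,
        commute_apply (hw.weight_commute n b hw.pair.comm (Commute.refl b)).symm, smul_smul,
        show ((q : ℂ) ^ 2)⁻¹ * (q : ℂ) ^ (2 * (n + 1)) = (q : ℂ) ^ (2 * n) by field_simp; ring]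
      exact (weight q c Y₀ n).graph.smul_mem _ ((hw.weight_isQuot n).mem _)
  · rw [smul_smul, mul_inv_cancel₀ (pow_ne_zero _ hq), one_smul]

/-- In summand `n ≥ 1` the relation is `λₙ₊₁² (q²ⁿ Y₀² + c) = q² λₙ² (q²ⁿ⁻² Y₀² + c) + (1 - q²) (q⁴ⁿ
Y₀² + c)`; in summand `0` the middle term is absent. Equality of domains holds since membership in
the domain of `X* X` already controls `Y²`, hence also `X X*`. -/
theorem WeightData.modelXstar_mul_modelX (hw : WeightData q c Y₀ a b g) (hq₀ : 0 < q)
    (hq₁ : q < 1) (hc : 0 ≤ c) :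
    opMul (modelXstar q c Y₀) (modelX q c Y₀) =
      ((q : ℂ) ^ 2) • opMul (modelX q c Y₀) (modelXstar q c Y₀) +
        (1 - (q : ℂ) ^ 2) • (opMul (modelY q Y₀) (modelY q Y₀) + scalarOp (HSum H) (c : ℂ)) := by
  have hq : (q : ℂ) ≠ 0 := by exact_mod_cast hq₀.ne'
  have hWW := fun n => (hw.weight_isQuot n).opMul (hw.weight_isQuot n) (hw.weight_pair n)
  have hYY := fun n => (hw.isQuot.smul ((q : ℂ) ^ (2 * n))).opMul
    (hw.isQuot.smul ((q : ℂ) ^ (2 * n))) (hw.scaled_pair hq₀ hq₁ n)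
  have haa : ∀ u v, a (a u) = a (a v) → u = v := fun u v h => by
    rw [← sub_eq_zero]
    refine hw.pair.inj _ (hw.pair.inj _ ?_)
    rw [map_sub, map_sub, h, sub_self]
  have hzero : ∀ u, g 0 (g 0 u) = (1 - (q : ℂ) ^ 2) • (b (b u) + (c : ℂ) • a (a u)) := fun u => by
    rw [hw.weight_sq_apply]
    simp
  have hsucc : ∀ n u, g (n + 1) (g (n + 1) u) = (q : ℂ) ^ 2 • g n (g n u) +
      (1 - (q : ℂ) ^ 2) • ((q : ℂ) ^ (4 * (n + 1)) • b (b u) + (c : ℂ) • a (a u)) := fun n u => by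
    rw [hw.weight_sq_apply, hw.weight_sq_apply]
    match_scalars <;> ring
  have hqq : ∀ n, ∀ u, (q : ℂ) ^ (2 * n) • b ((q : ℂ) ^ (2 * n) • b u)
      = (q : ℂ) ^ (4 * n) • b (b u) := fun n u => by
    rw [map_smul, smul_smul, ← pow_add]
    ring_nf
  have hL : ∀ x z, (x, z) ∈ (opMul (modelXstar q c Y₀) (modelX q c Y₀)).graph ↔
      ∀ n, ∃ u, a (a u) = x n ∧ g n (g n u) = z n := fun x z => by
    unfold modelX modelXstar
    rw [opMul_loweringOp_raisingOp hw.isSelfAdjoint_weight,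
      mem_graph_opMul_diagOp hw.isSelfAdjoint_weight]
    exact forall_congr' fun n => hWW n _ _
  have hR : ∀ x z, (x, z) ∈ (opMul (modelX q c Y₀) (modelXstar q c Y₀)).graph ↔
      z 0 = 0 ∧ ∀ n, ∃ u, a (a u) = x (n + 1) ∧ g n (g n u) = z (n + 1) := fun x z => by
    unfold modelX modelXstar
    rw [mem_graph_opMul_raisingOp_loweringOp hw.isSelfAdjoint_weight]
    exact and_congr_right fun _ => forall_congr' fun n => hWW n _ _
  have hD : ∀ x z, (x, z) ∈ (opMul (modelY q Y₀) (modelY q Y₀)).graph ↔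
      ∀ n, ∃ u, a (a u) = x n ∧ (q : ℂ) ^ (4 * n) • b (b u) = z n := fun x z => by
    unfold modelY
    rw [mem_graph_opMul_diagOp (hw.isSelfAdjoint_scaled hq₀ hq₁)]
    refine forall_congr' fun n => (hYY n _ _).trans (exists_congr fun u => ?_)
    rw [← hqq]
    rfl
  refine eq_of_forall_mem_graph_iff fun x z => ?_
  simp only [mem_graph_add, mem_graph_smul, mem_graph_scalarOp]
  constructor
  · intro h
    choose u hux huz using (hL x z).1 h
    obtain ⟨y, hy⟩ := exists_hSum_of_norm_le (f := fun n => (q : ℂ) ^ (4 * n) • b (b (u n)))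
      (summable_norm_sq z) (1 - q ^ 2)⁻¹ fun n => by
        rw [← huz]
        exact hw.norm_left_left_le hq₀ hq₁ hc n _
    refine ⟨_, _, ⟨((q : ℂ) ^ 2)⁻¹ • (z - (1 - (q : ℂ) ^ 2) • (y + (c : ℂ) • x)), ?_, rfl⟩,
      ⟨_, ⟨y, (c : ℂ) • x, ?_, rfl, rfl⟩, rfl⟩, ?_⟩
    · refine (hR _ _).2 ⟨?_, fun n => ⟨u (n + 1), hux _, ?_⟩⟩
      · have h1 : z 0 = (1 - (q : ℂ) ^ 2) • (y 0 + (c : ℂ) • x 0) := by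
          rw [← huz, hzero, hy, ← hux]
          simp
        change ((q : ℂ) ^ 2)⁻¹ • (z 0 - (1 - (q : ℂ) ^ 2) • (y 0 + (c : ℂ) • x 0)) = 0
        rw [h1, sub_self, smul_zero]
      · change _ = ((q : ℂ) ^ 2)⁻¹ •
          (z (n + 1) - (1 - (q : ℂ) ^ 2) • (y (n + 1) + (c : ℂ) • x (n + 1)))
        rw [eq_inv_smul_iff₀ (pow_ne_zero _ hq), ← huz, hsucc, hy, ← hux, add_sub_cancel_right]
    · exact (hD _ _).2 fun n => ⟨u n, hux n, (hy n).symm⟩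
    · rw [smul_smul, mul_inv_cancel₀ (pow_ne_zero _ hq), one_smul, sub_add_cancel]
  · rintro ⟨_, _, ⟨z₁, h1, rfl⟩, ⟨_, ⟨z₂, _, h2, rfl, rfl⟩, rfl⟩, rfl⟩
    obtain ⟨h10, h1⟩ := (hR _ _).1 h1
    refine (hL _ _).2 fun n => ?_
    obtain ⟨u, hux, huz⟩ := (hD _ _).1 h2 n
    refine ⟨u, hux, ?_⟩
    change _ = (q : ℂ) ^ 2 • z₁ n + (1 - (q : ℂ) ^ 2) • (z₂ n + (c : ℂ) • x n)
    cases n with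
    | zero =>
      rw [h10, ← huz, ← hux, hzero]
      simp
    | succ n =>
      -- The parameters coming from `X X*` and from `Y²` coincide because `a²` is injective.
      obtain ⟨u', hux', huz'⟩ := h1 n
      rw [hsucc, ← huz, ← huz', ← hux, haa u' u (hux'.trans hux.symm)]

theorem WeightData.isRepresentation (hw : WeightData q c Y₀ a b g) (hq₀ : 0 < q)
    (hq₁ : q < 1) (hc : 0 ≤ c) (hY : HasTrivialKernel Y₀) :
    IsRepresentation q c (modelX q c Y₀) (modelY q Y₀) where
  dense := hw.dense_modelX
  closed := hw.isClosed_modelX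
  selfAdjoint := hw.isSelfAdjoint_modelY hq₀ hq₁
  kernel := hasTrivialKernel_modelY hq₀ hY
  rel_YX := hw.opMul_modelY_modelX_le hq₀ hq₁ hc
  rel_XX := by
    rw [hw.adjoint_modelX]
    exact hw.modelXstar_mul_modelX hq₀ hq₁ hc

end Model

/-! ### From operator relations to a representation on an invariant core. -/

section StarRepresentation

variable {H : Type u} [NormedAddCommGroup H] [InnerProductSpace ℂ H]

theorem exists_end_of_graph {D : Submodule ℂ H} {G : Submodule ℂ (H × H)}
    (hG : ∀ y, ((0 : H), y) ∈ G → y = 0) (h : ∀ d ∈ D, ∃ e ∈ D, (d, e) ∈ G) :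
    ∃ x : Module.End ℂ D, ∀ d : D, ((d : H), (x d : H)) ∈ G := by
  have huniq : ∀ x y z, (x, y) ∈ G → (x, z) ∈ G → y = z := fun x y z hy hz => by
    have := G.sub_mem hy hz
    rw [Prod.mk_sub_mk, sub_self] at this
    exact sub_eq_zero.1 (hG _ this)
  choose! f hfD hf using h
  refine ⟨{ toFun := fun d => ⟨f d, hfD d d.2⟩, map_add' := ?_, map_smul' := ?_ }, fun d => hf d d.2⟩
  · intro d e
    exact Subtype.ext (huniq _ _ _ (hf _ (d + e).2) (G.add_mem (hf d d.2) (hf e e.2)))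
  · intro k d
    exact Subtype.ext (huniq _ _ _ (hf _ (k • d).2) (G.smul_mem k (hf d d.2)))

variable [CompleteSpace H]

/-- On an invariant `D` the two operator relations can be evaluated pointwise, because graphs are
single valued. The relation for `Y X*` is not among them and comes from taking adjoints of the one
for `Y X`. -/
theorem IsRepresentation.inducesStarRepresentation {q c : ℝ} {X Y : H →ₗ.[ℂ] H} (hq₀ : 0 < q)
    (h : IsRepresentation q c X Y) {D : Submodule ℂ H} (hD : Dense (D : Set H))
    (hXc : X.HasCore D) (hXc' : X†.HasCore D) (hYc : Y.HasCore D)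
    (hX : ∀ d ∈ D, ∃ e ∈ D, (d, e) ∈ X.graph) (hX' : ∀ d ∈ D, ∃ e ∈ D, (d, e) ∈ X†.graph)
    (hY : ∀ d ∈ D, ∃ e ∈ D, (d, e) ∈ Y.graph) (hY' : ∀ d ∈ D, ∃ e ∈ D, (e, d) ∈ Y.graph) :
    InducesStarRepresentation q c X Y := by
  have hq : (q : ℂ) ≠ 0 := by exact_mod_cast hq₀.ne'
  have hker := (hasTrivialKernel_iff Y).1 h.kernel
  have hinj : ∀ x x' y, (x, y) ∈ Y.graph → (x', y) ∈ Y.graph → x = x' := fun x x' y hx hx' => by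
    have := Y.graph.sub_mem hx hx'
    rw [Prod.mk_sub_mk, sub_self] at this
    exact sub_eq_zero.1 (hker _ this)
  obtain ⟨x, hx⟩ := exists_end_of_graph (fun y hy => eq_of_mem_graph hy X.graph.zero_mem) hX
  obtain ⟨x', hx'⟩ := exists_end_of_graph (fun y hy => eq_of_mem_graph hy X†.graph.zero_mem) hX'
  obtain ⟨y, hy⟩ := exists_end_of_graph (fun y hy => eq_of_mem_graph hy Y.graph.zero_mem) hY
  -- The flipped graph of `Y` is single valued exactly because `ker Y = {0}`.
  obtain ⟨y', hy'⟩ := exists_end_of_graph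
    (G := Y.graph.comap (LinearEquiv.prodComm ℂ H H : H × H →ₗ[ℂ] H × H)) hker hY'
  replace hy' : ∀ d : D, ((y' d : H), (d : H)) ∈ Y.graph := hy'
  have hyx : y * x = ((q : ℂ) ^ 2) • (x * y) := by
    ext d
    obtain ⟨w, hw, hw'⟩ := (mem_graph_smul _ _ _ _).1 (LinearPMap.le_graph_of_le h.rel_YX
      ((mem_graph_opMul _ _ _ _).2 ⟨_, hx d, hy (x d)⟩))
    have := eq_of_mem_graph hw ((mem_graph_opMul _ _ _ _).2 ⟨_, hy d, hx (y d)⟩)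
    rw [this] at hw'
    exact hw'
  have hadj : ∀ d e : D, ⟪(x e : H), d⟫_ℂ = ⟪(e : H), x' d⟫_ℂ := fun d e =>
    (mem_graph_adjoint h.dense _ _).1 (hx' d) _ _ (hx e)
  have hsym : ∀ d e : D, ⟪(y e : H), d⟫_ℂ = ⟪(e : H), y d⟫_ℂ := fun d e =>
    (mem_graph_iff_of_isSelfAdjoint h.selfAdjoint _ _).1 (hy d) _ _ (hy e)
  refine ⟨D, x, x', y, y', hD, hXc, hXc', hYc, hx, hx', hy, ?_, ?_, hyx, ?_, ?_⟩
  · ext d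
    exact eq_of_mem_graph (hy (y' d)) (hy' d)
  · ext d
    exact hinj _ _ _ (hy' (y d)) (hy d)
  · ext d
    -- Pairing with the dense `D` moves `Y` and `X*` to the left, where `Y X = q² X Y` applies.
    refine hD.eq_of_inner_right ℂ fun e he => ?_
    have h1 := hsym (x' d) ⟨e, he⟩
    have h2 := hadj d (y ⟨e, he⟩)
    have h3 : (y (x ⟨e, he⟩) : H) = (q : ℂ) ^ 2 • (x (y ⟨e, he⟩) : H) :=
      congrArg Subtype.val (DFunLike.congr_fun hyx ⟨e, he⟩)
    have h4 := hsym d (x ⟨e, he⟩)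
    have h5 := hadj (y d) ⟨e, he⟩
    change ⟪e, (y (x' d) : H)⟫_ℂ = ⟪e, ((q : ℂ) ^ 2)⁻¹ • (x' (y d) : H)⟫_ℂ
    rw [h3, inner_smul_left, map_pow, Complex.conj_ofReal] at h4
    rw [inner_smul_right, ← h5, ← h4, ← h1, ← h2, ← mul_assoc, inv_mul_cancel₀ (pow_ne_zero _ hq),
      one_mul]
  · ext d
    have h1 : ((d : H), (x' (x d) : H)) ∈ (opMul X† X).graph :=
      (mem_graph_opMul _ _ _ _).2 ⟨_, hx d, hx' (x d)⟩
    rw [h.rel_XX] at h1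
    have h2 : ((d : H), (x (x' d) : H)) ∈ (opMul X X†).graph :=
      (mem_graph_opMul _ _ _ _).2 ⟨_, hx' d, hx (x' d)⟩
    have h3 : ((d : H), (y (y d) : H)) ∈ (opMul Y Y).graph :=
      (mem_graph_opMul _ _ _ _).2 ⟨_, hy d, hy (y d)⟩
    have h4 := eq_of_mem_graph h1 ((mem_graph_add _ _ _ _).2 ⟨_, _,
      (mem_graph_smul _ _ _ _).2 ⟨_, h2, rfl⟩, (mem_graph_smul _ _ _ _).2 ⟨_,
        (mem_graph_add _ _ _ _).2 ⟨_, _, h3, (mem_graph_scalarOp _ _ _).2 rfl, rfl⟩, rfl⟩, rfl⟩)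
    change (x' (x d) : H) - (q : ℂ) ^ 2 • (x (x' d) : H)
      = (1 - (q : ℂ) ^ 2) • ((y (y d) : H) + (c : ℂ) • (d : H))
    rw [h4]
    abel

end StarRepresentation

/-! ### A dense invariant subspace from spectral cutoffs. -/

section Cutoff

/-- A continuous cutoff at `1 / k`. -/
noncomputable def cutoff (k t : ℝ) : ℝ := min 1 (max 0 (k * t - 1))

theorem continuous_cutoff (k : ℝ) : Continuous (cutoff k) := by
  unfold cutoff
  fun_prop

/-- Where `cutoff k` is nonzero, `k t > 1`, so `l t - 1 > 1` and `cutoff l` equals `1`. -/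
theorem cutoff_mul_cutoff {k l : ℝ} (hk : 0 < k) (h : 2 * k ≤ l) (t : ℝ) :
    cutoff l t * cutoff k t = cutoff k t := by
  rcases le_or_gt (k * t - 1) 0 with h1 | h1
  · have : cutoff k t = 0 := by simp [cutoff, max_eq_left h1]
    rw [this, mul_zero]
  · have ht : 0 < t := (pos_iff_pos_of_mul_pos (by linarith)).1 hk
    have h2 : 1 ≤ l * t - 1 := by nlinarith
    have : cutoff l t = 1 := by
      unfold cutoff
      rw [max_eq_right (by linarith), min_eq_left h2]
    rw [this, one_mul]

/-- Dividing by `max t k⁻¹` instead of `t` keeps the quotient continuous and changes it only where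
the cutoff vanishes. -/
theorem mul_cutoff_div {k : ℝ} (hk : 0 < k) (t : ℝ) :
    t * (cutoff k t / max t k⁻¹) = cutoff k t := by
  rcases le_or_gt t k⁻¹ with h1 | h1
  · have h2 : k * t - 1 ≤ 0 := by
      have := mul_le_mul_of_nonneg_left h1 hk.le
      rw [mul_inv_cancel₀ hk.ne'] at this
      linarith
    have : cutoff k t = 0 := by simp [cutoff, max_eq_left h2]
    simp [this]
  · have : 0 < t := (inv_pos.2 hk).trans h1
    rw [max_eq_left h1.le]
    field_simp

theorem abs_cutoff_mul_sub_le {k t : ℝ} (hk : 0 < k) (ht : 0 ≤ t) :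
    |cutoff k t * t - t| ≤ 2 / k := by
  have h0 : 0 ≤ cutoff k t := le_min zero_le_one (le_max_left _ _)
  have h1 : cutoff k t ≤ 1 := min_le_left _ _
  rcases le_or_gt (2 / k) t with h2 | h2
  · have h3 : 1 ≤ k * t - 1 := by
      rw [div_le_iff₀ hk] at h2
      linarith
    have : cutoff k t = 1 := by
      unfold cutoff
      rw [max_eq_right (by linarith), min_eq_left h3]
    rw [this, one_mul, sub_self, abs_zero]
    positivity
  · rw [abs_le]
    constructor <;> nlinarith

variable {H : Type u} [NormedAddCommGroup H] [InnerProductSpace ℂ H] [CompleteSpace H]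

/-- For a non-negative injective bounded operator `s`, the vectors on which `s` is bounded below
in a spectral sense form a dense subspace, on which `s` is invertible. -/
theorem exists_dense_invariant {s : H →L[ℂ] H} (hs : 0 ≤ s) (hinj : ∀ x, s x = 0 → x = 0) :
    ∃ D : Submodule ℂ H, Dense (D : Set H) ∧ (∀ r, Commute s r → ∀ x ∈ D, r x ∈ D) ∧
      ∀ x ∈ D, ∃ y ∈ D, s y = x := by
  have hsa : IsSelfAdjoint s := .of_nonneg hs
  let φ : ℕ → H →L[ℂ] H := fun k => cfc (cutoff (k + 1)) s
  let ψ : ℕ → H →L[ℂ] H := fun k => cfc (fun t => cutoff (k + 1) t / max t ((k : ℝ) + 1)⁻¹) s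
  have hk : ∀ k : ℕ, (0 : ℝ) < k + 1 := fun k => by positivity
  have hcont : ∀ k : ℕ, Continuous fun t : ℝ => cutoff (k + 1) t / max t ((k : ℝ) + 1)⁻¹ :=
    fun k => (continuous_cutoff _).div (by fun_prop) fun t =>
      (lt_of_lt_of_le (inv_pos.2 (hk k)) (le_max_right _ _)).ne'
  have hφφ : ∀ k l : ℕ, 2 * (k + 1 : ℝ) ≤ l + 1 → φ l * φ k = φ k := fun k l hkl => by
    simp only [φ]
    rw [← cfc_mul _ _ s (continuous_cutoff _).continuousOn (continuous_cutoff _).continuousOn]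
    exact cfc_congr fun t _ => cutoff_mul_cutoff (hk k) hkl t
  have hψ : ∀ k, s * ψ k = φ k := fun k => by
    simp only [φ, ψ]
    nth_rewrite 1 [← cfc_id' ℝ s]
    rw [← cfc_mul (fun x => x) _ s continuous_id.continuousOn (hcont k).continuousOn]
    exact cfc_congr fun t _ => mul_cutoff_div (hk k) t
  have hφc : ∀ k r, Commute s r → Commute (φ k) r := fun k r hr => hr.cfc_real _
  have hψφ : ∀ k, Commute (φ k) (ψ k) := fun k =>
    hφc k _ (Commute.symm (Commute.cfc_real (Commute.refl s) _))
  have hφs : ∀ k, ‖φ k * s - s‖ ≤ 2 / (k + 1) := fun k => by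
    have : φ k * s - s = cfc (fun t => cutoff (k + 1) t * t - t) s := by
      rw [cfc_sub (fun t => cutoff (k + 1) t * t) (fun t => t) s
        ((continuous_cutoff _).mul continuous_id).continuousOn continuous_id.continuousOn,
        cfc_mul (cutoff (k + 1)) (fun t => t) s (continuous_cutoff _).continuousOn
        continuous_id.continuousOn, cfc_id' ℝ s]
    rw [this]
    refine norm_cfc_le (by positivity) fun t ht => ?_
    exact abs_cutoff_mul_sub_le (hk k) (spectrum_nonneg_of_nonneg hs ht)
  -- The union over `k` of the fixed spaces of the cutoffs of `s`.
  let D : Submodule ℂ H :=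
    { carrier := {x | ∃ k, φ k x = x}
      zero_mem' := ⟨0, map_zero _⟩
      add_mem' := by
        rintro x y ⟨k, hx⟩ ⟨l, hy⟩
        -- The parameter of the cutoff is the index plus one, here `2 (k + l + 1)`, which is at
        -- least twice both `k + 1` and `l + 1`.
        refine ⟨2 * (k + l) + 1, ?_⟩
        have h1 := hφφ k (2 * (k + l) + 1) (by
          push_cast
          nlinarith [(Nat.cast_nonneg l : (0 : ℝ) ≤ l)])
        have h2 := hφφ l (2 * (k + l) + 1) (by
          push_cast
          nlinarith [(Nat.cast_nonneg k : (0 : ℝ) ≤ k)])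
        rw [map_add]
        nth_rewrite 1 [← hx]
        nth_rewrite 1 [← hy]
        rw [← mul_apply_eq_comp, ← mul_apply_eq_comp, h1, h2, hx, hy]
      smul_mem' := by
        rintro r x ⟨k, hx⟩
        exact ⟨k, by rw [map_smul, hx]⟩ }
  have hφD : ∀ k x, φ k x ∈ D := fun k x => ⟨2 * k + 1, by
    rw [← mul_apply_eq_comp, hφφ k (2 * k + 1) (by push_cast; linarith)]⟩
  have hinv : ∀ r, Commute s r → ∀ x ∈ D, r x ∈ D := by
    rintro r hr x ⟨k, hx⟩
    exact ⟨k, by rw [commute_apply (hφc k r hr), hx]⟩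
  refine ⟨D, ?_, hinv, ?_⟩
  -- The cutoffs satisfy `φₖ s → s` in norm, and the range of `s` is dense.
  · have h1 : ∀ x, s x ∈ closure (D : Set H) := fun x => by
      refine mem_closure_of_tendsto (f := fun k : ℕ => φ k (s x)) (b := Filter.atTop) ?_
        (Filter.Eventually.of_forall fun k => hφD k _)
      rw [tendsto_iff_norm_sub_tendsto_zero]
      have h2 : Filter.Tendsto (fun k : ℕ => 2 / ((k : ℝ) + 1) * ‖x‖) Filter.atTop (nhds 0) := by
        have h3 := (tendsto_one_div_add_atTop_nhds_zero_nat (𝕜 := ℝ)).const_mul (2 * ‖x‖)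
        rw [mul_zero] at h3
        refine h3.congr fun k => ?_
        ring
      refine squeeze_zero (fun k => norm_nonneg _) (fun k => ?_) h2
      exact (ContinuousLinearMap.le_opNorm (φ k * s - s) x).trans
        (mul_le_mul_of_nonneg_right (hφs k) (norm_nonneg _))
    exact fun x => closure_minimal (Set.range_subset_iff.2 h1) isClosed_closure
      (denseRange_of_injective hsa hinj x)
  · rintro x ⟨k, hx⟩
    refine ⟨ψ k x, ⟨k, by rw [commute_apply (hψφ k), hx]⟩, ?_⟩
    rw [← mul_apply_eq_comp, hψ, hx]

end Cutoff

/-! ### A common invariant core of the model operators. -/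

section ModelCore

variable {H : Type u} [NormedAddCommGroup H] [InnerProductSpace ℂ H]

/-- The finitely supported sequences in `⨁ₙ H` with entries in `D`. -/
def finSupported (D : Submodule ℂ H) : Submodule ℂ (HSum H) where
  carrier := {x | (∀ n, x n ∈ D) ∧ ∃ N, ∀ n, N ≤ n → x n = 0}
  zero_mem' := ⟨fun _ => D.zero_mem, 0, fun _ _ => rfl⟩
  add_mem' := by
    rintro x y ⟨hx, N, hN⟩ ⟨hy, M, hM⟩
    refine ⟨fun n => D.add_mem (hx n) (hy n), max N M, fun n hn => ?_⟩
    rw [lp.coeFn_add, Pi.add_apply, hN n (le_of_max_le_left hn), hM n (le_of_max_le_right hn),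
      add_zero]
  smul_mem' := by
    rintro k x ⟨hx, N, hN⟩
    refine ⟨fun n => D.smul_mem k (hx n), N, fun n hn => ?_⟩
    rw [lp.coeFn_smul, Pi.smul_apply, hN n hn, smul_zero]

theorem single_mem_finSupported {D : Submodule ℂ H} (n : ℕ) {x : H} (hx : x ∈ D) :
    lp.single 2 n x ∈ finSupported D := by
  refine ⟨fun k => ?_, n + 1, fun k hk => lp.single_apply_ne _ _ _ (by omega)⟩
  rcases eq_or_ne k n with rfl | hk
  · rwa [lp.single_apply_self]
  · rw [lp.single_apply_ne _ _ _ hk]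
    exact D.zero_mem

theorem dense_finSupported {D : Submodule ℂ H} (hD : Dense (D : Set H)) :
    Dense (finSupported D : Set (HSum H)) :=
  dense_of_single_mem (D := fun _ => D) (fun _ => hD) fun n _ hx => single_mem_finSupported n hx

theorem exists_mem_finSupported {D : Submodule ℂ H} {f : ℕ → H} (hf : ∀ n, f n ∈ D) {N : ℕ}
    (hN : ∀ n, N ≤ n → f n = 0) : ∃ x ∈ finSupported D, ∀ n, x n = f n := by
  obtain ⟨x, hx⟩ := exists_hSum_of_summable (f := f)
    (summable_of_ne_finset_zero (s := Finset.range N) fun n hn => by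
      rw [hN n (by simpa using hn), norm_zero, zero_pow two_ne_zero])
  exact ⟨x, ⟨fun n => by rw [hx]; exact hf n, N, fun n hn => by rw [hx, hN n hn]⟩, hx⟩

/-- Parametrizing the graph by a bounded map lets a closed condition be checked on a dense set of
parameters only. -/
theorem IsQuot.map_mem_of_dense {A : H →ₗ.[ℂ] H} {a g : H →L[ℂ] H} (h : IsQuot A a g) {D : Set H}
    (hD : Dense D) {M : Submodule ℂ (HSum H × HSum H)}
    (hM : IsClosed (M : Set (HSum H × HSum H))) {F : H × H → HSum H × HSum H} (hF : Continuous F)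
    (hFM : ∀ u ∈ D, F (a u, g u) ∈ M) {x y : H} (hxy : (x, y) ∈ A.graph) : F (x, y) ∈ M := by
  obtain ⟨u, rfl, rfl⟩ := (h _ _).1 hxy
  have hcl : IsClosed {u | F (a u, g u) ∈ M} :=
    hM.preimage (hF.comp (by fun_prop : Continuous fun u => (a u, g u)))
  exact closure_minimal (fun u hu => hFM u hu) hcl (hD u)

theorem continuous_single_prod (n m : ℕ) :
    Continuous fun p : H × H => ((lp.single 2 n p.1, lp.single 2 m p.2) : HSum H × HSum H) := by
  have h : ∀ n, Continuous fun y : H => (lp.single 2 n y : HSum H) := fun n =>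
    (lp.singleContinuousLinearMap ℂ (fun _ : ℕ => H) 2 n).continuous
  exact ((h n).comp continuous_fst).prodMk ((h m).comp continuous_snd)

theorem mem_of_hasSum {M : Submodule ℂ (HSum H × HSum H)}
    (hM : IsClosed (M : Set (HSum H × HSum H))) {f : ℕ → HSum H × HSum H} {p : HSum H × HSum H}
    (hf : HasSum f p) (h : ∀ n, f n ∈ M) : p ∈ M :=
  hM.mem_of_tendsto hf (Filter.Eventually.of_forall fun _ => Submodule.sum_mem _ fun n _ => h n)

variable [CompleteSpace H]
  {q c : ℝ} {Y₀ : H →ₗ.[ℂ] H} {a b : H →L[ℂ] H} {g : ℕ → H →L[ℂ] H}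

/-- The cutoffs are those of `(a b)²`, squared because `b` need not be non-negative. It factors
through `a` and through `b`, so both are surjective on `D`, and it commutes with every weight. -/
theorem WeightData.exists_common_core (hw : WeightData q c Y₀ a b g) (hY : HasTrivialKernel Y₀) :
    ∃ D : Submodule ℂ H, Dense (D : Set H) ∧ (∀ u ∈ D, a u ∈ D) ∧ (∀ u ∈ D, b u ∈ D) ∧
      (∀ n, ∀ u ∈ D, g n u ∈ D) ∧ (∀ x ∈ D, ∃ u ∈ D, a u = x) ∧ ∀ x ∈ D, ∃ u ∈ D, b u = x := by
  have hbinj : ∀ x, b x = 0 → x = 0 := fun x hx => by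
    have h1 := hw.isQuot.mem x
    rw [hx] at h1
    exact hw.pair.inj _ ((hasTrivialKernel_iff Y₀).1 hY _ h1)
  have hab := hw.pair.comm
  have hsa : IsSelfAdjoint (a * b) := (hw.pair.left.commute_iff hw.pair.right).1 hab
  have hcomm : ∀ s, Commute a s → Commute b s → Commute (a * b * (a * b)) s := fun s ha hb =>
    (ha.mul_left hb).mul_left (ha.mul_left hb)
  obtain ⟨D, hD, hinv, hdiv⟩ := exists_dense_invariant (mul_self_nonneg_of_isSelfAdjoint hsa)
    (fun x hx => hbinj _ (hw.pair.inj _ (hbinj _ (hw.pair.inj _ hx))))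
  have ha := hinv a (hcomm a (Commute.refl a) hab.symm)
  have hb := hinv b (hcomm b hab (Commute.refl b))
  refine ⟨D, hD, ha, hb, fun n => hinv _ (hcomm _ (hw.weight_pair n).comm
    (hw.weight_commute n b hab (Commute.refl b)).symm), fun x hx => ?_, fun x hx => ?_⟩
  · obtain ⟨y, hy, rfl⟩ := hdiv x hx
    exact ⟨_, hb _ (ha _ (hb y hy)), rfl⟩
  · obtain ⟨y, hy, rfl⟩ := hdiv x hx
    exact ⟨_, ha _ (ha _ (hb y hy)), (commute_apply hab _).symm⟩

/-- Writing entries as `a u` with `u ∈ D`, the operators act by the bounded numerators, which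
preserve `D`; for `Y⁻¹` entries are written as `b u`. The core property holds because each graph is
a sum of pieces in single summands, each approximated by parameters `u ∈ D`. -/
theorem WeightData.inducesStarRepresentation (hw : WeightData q c Y₀ a b g) (hq₀ : 0 < q)
    (hq₁ : q < 1) (hc : 0 ≤ c) (hY : HasTrivialKernel Y₀) :
    InducesStarRepresentation q c (modelX q c Y₀) (modelY q Y₀) := by
  obtain ⟨D, hD, ha, hb, hg, hda, hdb⟩ := hw.exists_common_core hY
  have hq : (q : ℂ) ≠ 0 := by exact_mod_cast hq₀.ne'
  have hrep := hw.isRepresentation hq₀ hq₁ hc hY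
  have ha0 : ∀ {u}, a u = 0 → u = 0 := hw.pair.inj _
  have hX : ∀ d ∈ finSupported D, ∃ e ∈ finSupported D, (d, e) ∈ (modelX q c Y₀).graph := by
    rintro d ⟨hd, N, hN⟩
    choose u huD hu using fun n => hda _ (hd n)
    let f : ℕ → H := fun n => match n with
      | 0 => 0
      | n + 1 => g n (u n)
    obtain ⟨e, heD, he⟩ := exists_mem_finSupported (D := D) (f := f) (N := N + 1)
      (fun n => by
        cases n with
        | zero => exact D.zero_mem
        | succ n => exact hg n _ (huD n))
      (fun n hn => by
        cases n with
        | zero => rfl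
        | succ n =>
          have : u n = 0 := ha0 (by rw [hu, hN n (by omega)])
          change g n (u n) = 0
          rw [this, map_zero])
    refine ⟨e, heD, (mem_graph_raisingOp _ _ _).2 ⟨he 0, fun n => ?_⟩⟩
    rw [he, ← hu]
    exact (hw.weight_isQuot n).mem _
  have hX' : ∀ d ∈ finSupported D, ∃ e ∈ finSupported D, (d, e) ∈ (modelXstar q c Y₀).graph := by
    rintro d ⟨hd, N, hN⟩
    choose u huD hu using fun n => hda _ (hd n)
    obtain ⟨e, heD, he⟩ := exists_mem_finSupported (D := D) (f := fun n => g n (u (n + 1))) (N := N)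
      (fun n => hg n _ (huD _))
      (fun n hn => by
        have : u (n + 1) = 0 := ha0 (by rw [hu, hN _ (by omega)])
        rw [this, map_zero])
    refine ⟨e, heD, (mem_graph_loweringOp _ _ _).2 fun n => ?_⟩
    rw [he, ← hu]
    exact (hw.weight_isQuot n).mem _
  have hYm : ∀ d ∈ finSupported D, ∃ e ∈ finSupported D, (d, e) ∈ (modelY q Y₀).graph := by
    rintro d ⟨hd, N, hN⟩
    choose u huD hu using fun n => hda _ (hd n)
    obtain ⟨e, heD, he⟩ := exists_mem_finSupported (D := D)
      (f := fun n => (q : ℂ) ^ (2 * n) • b (u n)) (N := N)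
      (fun n => D.smul_mem _ (hb _ (huD _)))
      (fun n hn => by
        have : u n = 0 := ha0 (by rw [hu, hN _ hn])
        rw [this, map_zero, smul_zero])
    refine ⟨e, heD, (mem_graph_diagOp _ _ _).2 fun n => ?_⟩
    rw [he, ← hu]
    exact (hw.isQuot.smul _).mem _
  have hYm' : ∀ d ∈ finSupported D, ∃ e ∈ finSupported D, (e, d) ∈ (modelY q Y₀).graph := by
    rintro d ⟨hd, N, hN⟩
    choose u huD hu using fun n => hdb _ (hd n)
    have hqn : ∀ n, (q : ℂ) ^ (2 * n) ≠ 0 := fun n => pow_ne_zero _ hq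
    obtain ⟨e, heD, he⟩ := exists_mem_finSupported (D := D)
      (f := fun n => a (((q : ℂ) ^ (2 * n))⁻¹ • u n)) (N := N)
      (fun n => ha _ (D.smul_mem _ (huD _)))
      (fun n hn => by
        have h1 := (hw.isQuot.mem (u n))
        rw [hu, hN _ hn] at h1
        rw [map_smul, (hasTrivialKernel_iff Y₀).1 hY _ h1, smul_zero])
    refine ⟨e, heD, (mem_graph_diagOp _ _ _).2 fun n => ?_⟩
    have h1 := (hw.isQuot.smul ((q : ℂ) ^ (2 * n))).mem (((q : ℂ) ^ (2 * n))⁻¹ • u n)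
    rwa [smul_apply, map_smul b, smul_inv_smul₀ (hqn n), hu, ← he] at h1
  have hXcl := hrep.closed
  have hXcl' : (modelXstar q c Y₀).IsClosed := by
    rw [← hw.adjoint_modelX]
    exact LinearPMap.adjoint_isClosed hw.dense_modelX
  have hXc : (modelX q c Y₀).HasCore (finSupported D) := by
    refine hasCore_of_subset_closure hXcl (fun d hd => (hX d hd).imp fun _ h => h.2)
      fun x y hxy => ?_
    obtain ⟨hy0, hxy⟩ := (mem_graph_raisingOp _ _ _).1 hxy
    let M := ((finSupported D).comap (LinearMap.fst ℂ _ _) ⊓ (modelX q c Y₀).graph)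
    have hM := M.isClosed_topologicalClosure
    have hsy : HasSum (fun n => (lp.single 2 (n + 1) (y (n + 1)) : HSum H)) y := by
      rw [hasSum_nat_add_iff (f := fun n => (lp.single 2 n (y n) : HSum H)) 1]
      simpa [hy0] using lp.hasSum_single (by norm_num) y
    refine mem_of_hasSum hM ((lp.hasSum_single (by norm_num) x).prodMk hsy) fun n => ?_
    refine (hw.weight_isQuot n).map_mem_of_dense hD hM (continuous_single_prod n (n + 1))
      (fun u hu => M.le_topologicalClosure ⟨?_, ?_⟩) (hxy n)
    · exact single_mem_finSupported n (ha u hu)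
    · exact single_mem_graph_raisingOp ((hw.weight_isQuot n).mem u)
  have hXc' : (modelXstar q c Y₀).HasCore (finSupported D) := by
    refine hasCore_of_subset_closure hXcl' (fun d hd => (hX' d hd).imp fun _ h => h.2)
      fun x y hxy => ?_
    replace hxy := (mem_graph_loweringOp _ _ _).1 hxy
    let M := ((finSupported D).comap (LinearMap.fst ℂ _ _) ⊓ (modelXstar q c Y₀).graph)
    have hM := M.isClosed_topologicalClosure
    have hsx : HasSum (fun n => (lp.single 2 (n + 1) (x (n + 1)) : HSum H))
        (x - lp.single 2 0 (x 0)) := by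
      rw [hasSum_nat_add_iff (f := fun n => (lp.single 2 n (x n) : HSum H)) 1]
      simpa using lp.hasSum_single (by norm_num) x
    -- Summand `0` is annihilated by `X*` and is not covered by any weight, so it is approximated on
    -- its own.
    have h0 : ((lp.single 2 0 (x 0), 0) : HSum H × HSum H) ∈ M.topologicalClosure := by
      have hcl : IsClosed {z : H | ((lp.single 2 0 z, 0) : HSum H × HSum H) ∈
          M.topologicalClosure} := hM.preimage
        (((lp.singleContinuousLinearMap ℂ (fun _ : ℕ => H) 2 0).continuous).prodMk
          continuous_const)
      have hz : ∀ z ∈ D, ((lp.single 2 0 z, 0) : HSum H × HSum H) ∈ M.topologicalClosure := by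
        refine fun z hz => M.le_topologicalClosure ⟨?_, ?_⟩
        · exact single_mem_finSupported 0 hz
        · exact single_zero_mem_graph_loweringOp z
      exact closure_minimal hz hcl (hD (x 0))
    have h1 : ((x - lp.single 2 0 (x 0), y) : HSum H × HSum H) ∈ M.topologicalClosure := by
      refine mem_of_hasSum hM (hsx.prodMk (lp.hasSum_single (by norm_num) y)) fun n => ?_
      refine (hw.weight_isQuot n).map_mem_of_dense hD hM (continuous_single_prod (n + 1) n)
        (fun u hu => M.le_topologicalClosure ⟨?_, ?_⟩) (hxy n)
      · exact single_mem_finSupported _ (ha u hu)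
      · exact single_succ_mem_graph_loweringOp ((hw.weight_isQuot n).mem u)
    have h2 := M.topologicalClosure.add_mem h1 h0
    rw [Prod.mk_add_mk, sub_add_cancel, add_zero] at h2
    exact h2
  have hYc : (modelY q Y₀).HasCore (finSupported D) := by
    refine hasCore_of_subset_closure (hw.isSelfAdjoint_modelY hq₀ hq₁).isClosed
      (fun d hd => (hYm d hd).imp fun _ h => h.2)
      fun x y hxy => ?_
    replace hxy := (mem_graph_diagOp _ _ _).1 hxy
    let M := ((finSupported D).comap (LinearMap.fst ℂ _ _) ⊓ (modelY q Y₀).graph)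
    have hM := M.isClosed_topologicalClosure
    refine mem_of_hasSum hM
      ((lp.hasSum_single (by norm_num) x).prodMk (lp.hasSum_single (by norm_num) y)) fun n => ?_
    refine (hw.isQuot.smul _).map_mem_of_dense hD hM (continuous_single_prod n n)
      (fun u hu => M.le_topologicalClosure ⟨?_, ?_⟩) (hxy n)
    · exact single_mem_finSupported _ (ha u hu)
    · exact single_mem_graph_diagOp ((hw.isQuot.smul _).mem u)
  rw [← hw.adjoint_modelX] at hX' hXc'
  exact hrep.inducesStarRepresentation hq₀ (dense_finSupported hD) hXc hXc' hYc hX hX' hYm hYm'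

end ModelCore

/-! ### Transport of operators along a unitary. -/

section Intertwining

variable {K L : Type u} [NormedAddCommGroup K] [InnerProductSpace ℂ K] [CompleteSpace K]
  [NormedAddCommGroup L] [InnerProductSpace ℂ L] [CompleteSpace L] {U : K ≃ₗᵢ[ℂ] L}
  {A : K →ₗ.[ℂ] K} {B : L →ₗ.[ℂ] L}

/-- A self-adjoint operator has no proper self-adjoint extension, so one inclusion of graphs
suffices. -/
theorem intertwines_of_isSelfAdjoint (hA : IsSelfAdjoint A) (hB : IsSelfAdjoint B)
    (h : ∀ x y, (x, y) ∈ A.graph → (U x, U y) ∈ B.graph) : Intertwines U A B := by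
  refine fun x y => ⟨h x y, fun hxy => ?_⟩
  rw [mem_graph_iff_of_isSelfAdjoint hA]
  intro p r hpr
  have := (mem_graph_iff_of_isSelfAdjoint hB _ _).1 hxy _ _ (h p r hpr)
  rwa [U.inner_map_map, U.inner_map_map] at this

theorem Intertwines.adjoint (h : Intertwines U A B) (hA : Dense (A.domain : Set K))
    (hB : Dense (B.domain : Set L)) : Intertwines U A† B† := by
  intro x y
  rw [mem_graph_adjoint hA, mem_graph_adjoint hB]
  constructor
  · intro hxy p r hpr
    have h1 := (h (U.symm p) (U.symm r)).2 (by simpa using hpr)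
    have h2 := hxy _ _ h1
    rwa [← U.inner_map_map, ← U.inner_map_map, U.apply_symm_apply, U.apply_symm_apply] at h2
  · intro hxy p r hpr
    have h2 := hxy _ _ ((h p r).1 hpr)
    rwa [U.inner_map_map, U.inner_map_map] at h2

theorem IsPosSqrt.re_inner_nonneg {A R : K →ₗ.[ℂ] K} (h : IsPosSqrt A R) {x y : K}
    (hxy : (x, y) ∈ R.graph) : 0 ≤ (⟪x, y⟫_ℂ).re := by
  obtain ⟨d, rfl, rfl⟩ := (LinearPMap.mem_graph_iff _).1 hxy
  exact h.nonneg d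

/-- The pullback of `S` along `U` is a positive square root of `A`, hence equals `R` by uniqueness.
-/
theorem Intertwines.isPosSqrt {R : K →ₗ.[ℂ] K} {S : L →ₗ.[ℂ] L} (h : Intertwines U A B)
    (hA : IsPosSqrt A R) (hB : IsPosSqrt B S) : Intertwines U R S := by
  let G : Submodule ℂ (K × K) := S.graph.comap
    ((U.toLinearEquiv : K →ₗ[ℂ] L).prodMap (U.toLinearEquiv : K →ₗ[ℂ] L))
  have hR' : Intertwines U G.toLinearPMap S := by
    intro x y
    rw [Submodule.toLinearPMap_graph_eq]
    · rfl
    · rintro ⟨x, y⟩ hxy (rfl : x = 0)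
      have h1 : (U 0, U y) ∈ S.graph := hxy
      rw [map_zero] at h1
      simpa using eq_of_mem_graph h1 S.graph.zero_mem
  have hsymm : ∀ p r, (p, r) ∈ S.graph → (U.symm p, U.symm r) ∈ G.toLinearPMap.graph :=
    fun p r hpr => (hR' _ _).2 (by simpa using hpr)
  have hd : Dense (G.toLinearPMap.domain : Set K) := by
    have h1 := U.symm.surjective.denseRange.dense_image U.symm.continuous
      hB.selfAdjoint.dense_domain
    refine h1.mono ?_
    rintro _ ⟨p, hp, rfl⟩
    obtain ⟨r, hr⟩ := LinearPMap.mem_domain_iff.1 hp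
    exact LinearPMap.mem_domain_of_mem_graph (hsymm p r hr)
  have hpos : IsPosSqrt A G.toLinearPMap := by
    refine ⟨isSelfAdjoint_of_forall_mem_graph_iff hd fun y z => ?_, fun x => ?_, ?_⟩
    · rw [hR', mem_graph_iff_of_isSelfAdjoint hB.selfAdjoint]
      constructor
      · intro hyz p r hpr
        have := hyz _ _ ((hR' p r).1 hpr)
        rwa [U.inner_map_map, U.inner_map_map] at this
      · intro hyz p r hpr
        have := hyz _ _ (hsymm p r hpr)
        rwa [← U.inner_map_map, ← U.inner_map_map, U.apply_symm_apply, U.apply_symm_apply] at this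
    · have := hB.re_inner_nonneg ((hR' _ _).1 (G.toLinearPMap.mem_graph x))
      rwa [U.inner_map_map] at this
    · refine eq_of_forall_mem_graph_iff fun x y => ?_
      rw [h, ← hB.sq, mem_graph_opMul, mem_graph_opMul]
      constructor
      · rintro ⟨m, h1, h2⟩
        exact ⟨U m, (hR' _ _).1 h1, (hR' _ _).1 h2⟩
      · rintro ⟨m, h1, h2⟩
        exact ⟨U.symm m, (hR' _ _).2 (by simpa using h1), (hR' _ _).2 (by simpa using h2)⟩
  rw [hA.unique hpos]
  exact hR'

end Intertwining

/-! ### Strong commutativity in terms of bounded operators. -/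

section Commutation

variable {H : Type u} [NormedAddCommGroup H] [InnerProductSpace ℂ H]

theorem IsQuot.isResolventAt {A : H →ₗ.[ℂ] H} {a g n : H →L[ℂ] H} {z : ℂ} (h : IsQuot A a g)
    (h1 : (g - z • a) * n = 1) (h2 : a * n * (g - z • a) = a) : IsResolventAt A z (a * n) := by
  constructor
  · intro y
    obtain ⟨d, hd, hd'⟩ := (LinearPMap.mem_graph_iff _).1 (h.mem (n y))
    dsimp at hd hd'
    refine ⟨by rw [mul_apply_eq_comp, ← hd]; exact d.2, ?_⟩
    have : A ⟨(a * n) y, by rw [mul_apply_eq_comp, ← hd]; exact d.2⟩ = g (n y) := by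
      rw [← hd']
      congr 1
      exact Subtype.ext hd.symm
    rw [this]
    exact DFunLike.congr_fun h1 y
  · intro x
    obtain ⟨u, hu, hu'⟩ := (h _ _).1 (A.mem_graph x)
    rw [← hu, ← hu']
    exact DFunLike.congr_fun h2 u

variable [CompleteSpace H]

/-- `⟨T x, x⟩` is real, so the real part of `⟨(1 - i T) x, x⟩` is `‖x‖²`. -/
theorem isUnit_one_sub_I_smul {T : H →L[ℂ] H} (hT : IsSelfAdjoint T) :
    IsUnit (1 - Complex.I • T) := by
  refine ContinuousLinearMap.isUnit_of_forall_le_norm_inner_map (c := 1) _ one_pos fun x => ?_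
  have him : (⟪T x, x⟫_ℂ).im = 0 := by
    have h1 : (starRingEnd ℂ) ⟪T x, x⟫_ℂ = ⟪T x, x⟫_ℂ := by
      rw [inner_conj_symm, inner_left_of_isSelfAdjoint hT]
    exact Complex.conj_eq_iff_im.1 h1
  have hre : (⟪(1 - Complex.I • T) x, x⟫_ℂ).re = ‖x‖ ^ 2 := by
    rw [sub_apply, smul_apply, one_apply_eq_self, inner_sub_left, inner_smul_left, Complex.conj_I,
      Complex.sub_re, Complex.mul_re, him,
      show ⟪x, x⟫_ℂ = ((‖x‖ ^ 2 : ℝ) : ℂ) by rw [inner_self_eq_norm_sq_to_K]; norm_cast,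
      Complex.ofReal_re]
    simp
  rw [NNReal.coe_one, mul_one, ← hre]
  exact Complex.re_le_norm _

/-- One resolvent of each operator is enough. That of `Y` at `i` is `J = a (b + i a)`, with real
part `a b` and imaginary part `a²`. If `J` commutes with `T = T*`, so do both parts; `a` follows as
a root and `b` by cancelling the injective `a`. -/
theorem StronglyCommute.commute {Y A : H →ₗ.[ℂ] H} {a b T S : H →L[ℂ] H}
    (h : StronglyCommute Y A) (ha : 0 ≤ a) (hp : QuotPair a b) (h1 : a * a + b * b = 1)
    (hY : IsQuot Y a b) (hT : IsSelfAdjoint T) (hTS : T + S = 1) (hA : IsQuot A T S) :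
    Commute T a ∧ Commute T b := by
  have hab : a * b = b * a := hp.comm.eq
  have hSe : S = 1 - T := eq_sub_of_add_eq' hTS
  obtain ⟨k, hk⟩ := isUnit_one_sub_I_smul hT
  have hkT : Commute (k : H →L[ℂ] H) T := by
    rw [hk]
    exact (Commute.one_left T).sub_left ((Commute.refl T).smul_left _)
  have hM : S - (-1 + Complex.I) • T = k := by
    rw [hk, hSe, add_smul, neg_one_smul]
    abel
  have hres1 : IsResolventAt Y Complex.I (a * (b + Complex.I • a)) := by
    have e : (b - Complex.I • a) * (b + Complex.I • a) = 1 := by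
      rw [sub_mul, mul_add, mul_add, smul_mul_smul_comm, Complex.I_mul_I, mul_smul_comm,
        smul_mul_assoc, hab, ← h1]
      rw [neg_one_smul]
      abel
    refine hY.isResolventAt e ?_
    have e' : (b + Complex.I • a) * (b - Complex.I • a) = 1 := by
      rw [← e, add_mul, mul_sub, mul_sub, sub_mul, mul_add, mul_add, mul_smul_comm,
        smul_mul_assoc, hab]
      abel
    rw [mul_assoc, e', mul_one]
  -- At the non-real point `-1 + i` the denominator is `S + T - i T = 1 - i T`, whose invertibility
  -- is known.
  have hres2 : IsResolventAt A (-1 + Complex.I) (T * (↑k⁻¹ : H →L[ℂ] H)) := by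
    refine hA.isResolventAt ?_ ?_
    · rw [hM, k.mul_inv]
    · rw [hM, mul_assoc, k.inv_mul, mul_one]
  have hcomm := h _ _ _ _ (by simp) (by simp) hres1 hres2
  set J := a * (b + Complex.I • a) with hJ
  -- The inverse of `1 - i T` is an affine function of the resolvent, so commuting with the
  -- resolvent implies commuting with `k` and then with `T`.
  have hkinv : (↑k⁻¹ : H →L[ℂ] H) = 1 + Complex.I • (T * (↑k⁻¹ : H →L[ℂ] H)) := by
    have := k.mul_inv
    rw [hk, sub_mul, one_mul, smul_mul_assoc] at this
    rw [← this]
    abel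
  have hJk : Commute J (k : H →L[ℂ] H) := by
    rw [← Commute.units_inv_right_iff, hkinv]
    exact (Commute.one_right J).add_right (hcomm.smul_right _)
  have hJT : Commute J T := by
    have : T = (T * (↑k⁻¹ : H →L[ℂ] H)) * k := by rw [mul_assoc, k.inv_mul, mul_one]
    rw [this]
    exact hcomm.mul_right hJk
  have hJe : J = a * b + Complex.I • (a * a) := by rw [hJ, mul_add, mul_smul_comm]
  have hJs : star J = a * b - Complex.I • (a * a) := by
    rw [hJe, star_add, star_smul, star_mul, star_mul, hp.left.star_eq, hp.right.star_eq, ← hab]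
    simp [sub_eq_add_neg]
  have hJT' : Commute (star J) T := by
    have := hJT.star_star
    rwa [hT.star_eq] at this
  have haaT : Commute (a * a) T := by
    have e : a * a = (2 * Complex.I)⁻¹ • (J - star J) := by
      rw [hJs, hJe, add_sub_sub_cancel, ← two_smul ℂ, smul_smul, smul_smul, mul_assoc,
        inv_mul_cancel₀ (by simp), one_smul]
    rw [e]
    exact (hJT.sub_left hJT').smul_left _
  have habT : Commute (a * b) T := by
    have e : a * b = J - Complex.I • (a * a) := by rw [hJe, add_sub_cancel_right]
    rw [e]
    exact hJT.sub_left (haaT.smul_left _)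
  have haT : Commute a T := by
    rw [← CFC.sqrt_mul_self a]
    exact sqrt_commute haaT
  refine ⟨haT.symm, ContinuousLinearMap.ext fun x => ?_⟩
  rw [← sub_eq_zero]
  refine hp.inj _ ?_
  rw [map_sub, mul_apply_eq_comp, mul_apply_eq_comp, commute_apply haT, sub_eq_zero]
  exact (commute_apply habT x).symm

end Commutation

/-! ### Bounded form of the relations. -/

section Representation

variable {K : Type u} [NormedAddCommGroup K] [InnerProductSpace ℂ K] [CompleteSpace K]
  {q c : ℝ} {X Y : K →ₗ.[ℂ] K}

theorem IsRepresentation.mem_graph_rel_XX (h : IsRepresentation q c X Y) {x z : K}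
    (hxz : (x, z) ∈ (opMul X† X).graph) :
    ∃ z₁ z₂, (x, z₁) ∈ (opMul X X†).graph ∧ (x, z₂) ∈ (opMul Y Y).graph ∧
      z = (q : ℂ) ^ 2 • z₁ + (1 - (q : ℂ) ^ 2) • (z₂ + (c : ℂ) • x) := by
  rw [h.rel_XX] at hxz
  obtain ⟨_, _, h1, h2, rfl⟩ := (mem_graph_add _ _ _ _).1 hxz
  obtain ⟨z₁, h6, rfl⟩ := (mem_graph_smul _ _ _ _).1 h1
  obtain ⟨_, h3, rfl⟩ := (mem_graph_smul _ _ _ _).1 h2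
  obtain ⟨z₂, _, h4, h5, rfl⟩ := (mem_graph_add _ _ _ _).1 h3
  rw [mem_graph_scalarOp] at h5
  subst h5
  exact ⟨z₁, z₂, h6, h4, rfl⟩

/-- If `X x = 0`, pairing the second relation with `x` gives `0 = q² ‖X* x‖² + (1 - q²) (‖Y x‖² + c
‖x‖²)`, so `Y x = 0`. -/
theorem IsRepresentation.eq_zero_of_mem_graph (h : IsRepresentation q c X Y) (hq₁ : q ^ 2 < 1)
    (hc : 0 ≤ c) {x : K} (hx : (x, 0) ∈ X.graph) : x = 0 := by
  obtain ⟨z₁, z₂, h1, h2, h3⟩ := h.mem_graph_rel_XX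
    ((mem_graph_opMul _ _ _ _).2 ⟨0, hx, X†.graph.zero_mem⟩)
  obtain ⟨m, hm, hm'⟩ := (mem_graph_opMul _ _ _ _).1 h1
  obtain ⟨y, hy, hy'⟩ := (mem_graph_opMul _ _ _ _).1 h2
  have e1 : ⟪z₁, x⟫_ℂ = ((‖m‖ ^ 2 : ℝ) : ℂ) := by
    rw [(mem_graph_adjoint h.dense _ _).1 hm _ _ hm', inner_self_eq_norm_sq_to_K]
    norm_cast
  have e2 : ⟪z₂, x⟫_ℂ = ((‖y‖ ^ 2 : ℝ) : ℂ) := by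
    rw [(mem_graph_iff_of_isSelfAdjoint h.selfAdjoint _ _).1 hy _ _ hy',
      inner_self_eq_norm_sq_to_K]
    norm_cast
  have e3 : ⟪x, x⟫_ℂ = ((‖x‖ ^ 2 : ℝ) : ℂ) := by
    rw [inner_self_eq_norm_sq_to_K]
    norm_cast
  have e4 := congrArg (fun w => ⟪w, x⟫_ℂ) h3
  simp only [inner_zero_left, inner_add_left, inner_smul_left, map_sub, map_pow, map_one,
    Complex.conj_ofReal, e1, e2, e3] at e4
  have e5 : 0 = q ^ 2 * ‖m‖ ^ 2 + (1 - q ^ 2) * (‖y‖ ^ 2 + c * ‖x‖ ^ 2) := by exact_mod_cast e4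
  have e6 : (1 - q ^ 2) * ‖y‖ ^ 2 ≤ 0 := by
    have := mul_nonneg (sub_nonneg.2 hq₁.le) (mul_nonneg hc (sq_nonneg ‖x‖))
    nlinarith [mul_nonneg (sq_nonneg q) (sq_nonneg ‖m‖)]
  have e7 : ‖y‖ ^ 2 ≤ 0 := nonpos_of_mul_nonpos_right e6 (sub_pos.2 hq₁)
  have e8 : y = 0 := by simpa using le_antisymm e7 (sq_nonneg _)
  rw [e8] at hy
  exact (hasTrivialKernel_iff Y).1 h.kernel _ hy

/-- Bounded operators which describe a representation `(X, Y)`: the polar decomposition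
`X = v (b a⁻¹)` with `a² = (1 + X* X)⁻¹`, the bounded transform `Y = t s⁻¹`, and maps `E`, `W`
in terms of which the second relation is written on the vectors `a² p`. -/
structure RepData (q c : ℝ) (X Y : K →ₗ.[ℂ] K) (a b v s t : K →L[ℂ] K) (E W : K → K) : Prop where
  a_nonneg : 0 ≤ a
  b_nonneg : 0 ≤ b
  pair_ab : QuotPair a b
  b_inj : ∀ x, b x = 0 → x = 0
  isometry : star v * v = 1
  isQuot_X : IsQuot X a (v * b)
  isQuot_sq : IsQuot (opMul X† X) (a * a) (b * b)
  isQuot_modulus : IsQuot (modulus X) a b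
  polar : IsPolarDecomposition X v
  pair_st : QuotPair s t
  isQuot_Y : IsQuot Y s t
  comm_as : Commute a s
  comm_at : Commute a t
  comm_bs : Commute b s
  comm_bt : Commute b t
  relE : ∀ p, s (s (E p)) = a (a p)
  relW : ∀ p, star v (a (a p)) = a (a (W p))
  rel : ∀ p, b (b p) = (q : ℂ) ^ 2 • v (b (b (W p))) +
    (1 - (q : ℂ) ^ 2) • (t (t (E p)) + (c : ℂ) • a (a p))

/-- The vectors `a² p` fill the domain of `X* X`, which the second relation places inside the
domains of `Y²` and `X X*`. The first membership yields `a² p = s² E p` with `Y² a² p = t² E p`; the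
second yields `v* a² p = a² W p` with `X X* a² p = v b² W p`, so `v*` preserves the domain of `X*
X`. -/
theorem IsRepresentation.exists_repData (h : IsRepresentation q c X Y) (hq₁ : q ^ 2 < 1)
    (hc : 0 ≤ c) (hs : StronglyCommute Y (opMul X† X)) :
    ∃ a b v s t E W, RepData q c X Y a b v s t E W := by
  obtain ⟨a, b, v, ha, hb, hab, hab1, hbinj, hv, hX, hXX, hmod, hX', hpol⟩ :=
    exists_polar_decomposition h.dense h.closed fun x => h.eq_zero_of_mem_graph hq₁ hc
  obtain ⟨s, t, hs0, hst, hst1, hY⟩ := exists_bounded_transform_of_isSelfAdjoint h.selfAdjoint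
  have haa : IsSelfAdjoint (a * a) := (hab.left.commute_iff hab.left).1 (Commute.refl a)
  obtain ⟨hc1, hc2⟩ := hs.commute hs0 hst hst1 hY haa hab1 hXX
  have ha' : ∀ r, Commute (a * a) r → Commute a r := fun r hr => by
    rw [← CFC.sqrt_mul_self a]
    exact sqrt_commute hr
  have hb' : ∀ r, Commute (a * a) r → Commute b r := fun r hr => by
    rw [← CFC.sqrt_mul_self b, eq_sub_of_add_eq' hab1]
    exact sqrt_commute ((Commute.one_left r).sub_left hr)
  have key : ∀ p, ∃ e w, s (s e) = a (a p) ∧ star v (a (a p)) = a (a w) ∧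
      b (b p) = (q : ℂ) ^ 2 • v (b (b w)) +
        (1 - (q : ℂ) ^ 2) • (t (t e) + (c : ℂ) • a (a p)) := fun p => by
    obtain ⟨z₁, z₂, h1, h2, h3⟩ := h.mem_graph_rel_XX (hXX.mem p)
    obtain ⟨e, he, rfl⟩ := (hY.opMul hY hst _ _).1 h2
    obtain ⟨m, hm, hm'⟩ := (mem_graph_opMul _ _ _ _).1 h1
    obtain ⟨r, rfl, rfl⟩ := (hX _ _).1 hm'
    obtain ⟨u, hu, hu'⟩ := hab.exists_of_eq ((hX' _ _).1 hm)
    obtain ⟨w, rfl, rfl⟩ := hab.exists_of_eq hu'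
    exact ⟨e, w, he, hu.symm, h3⟩
  choose E W hE hW hEW using key
  exact ⟨a, b, v, s, t, E, W, ha, hb, hab, hbinj, hv, hX, hXX, hmod, hpol, hst, hY,
    ha' s hc1, ha' t hc2, hb' s hc1, hb' t hc2, hE, hW, hEW⟩

variable {a b v s t : K →L[ℂ] K} {E W : K → K}

/-- `E` is only chosen, but injectivity of `s²` determines it, so it inherits commutation relations.
-/
theorem RepData.E_comm (h : RepData q c X Y a b v s t E W) {r : K →L[ℂ] K} (hra : Commute a r)
    (hrs : Commute s r) (p : K) : E (r p) = r (E p) := by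
  rw [← sub_eq_zero]
  refine h.pair_st.inj _ (h.pair_st.inj _ ?_)
  rw [map_sub, map_sub, h.relE, commute_apply hrs, commute_apply hrs, h.relE, commute_apply hra,
    commute_apply hra, sub_self]

/-- The vector `X X* a² p`, up to the factor `q²`. -/
theorem RepData.smul_v_comm (h : RepData q c X Y a b v s t E W) {r : K →L[ℂ] K}
    (hra : Commute a r) (hrb : Commute b r) (hrs : Commute s r) (hrt : Commute t r) (p : K) :
    (q : ℂ) ^ 2 • v (b (b (W (r p)))) = r ((q : ℂ) ^ 2 • v (b (b (W p)))) := by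
  have e : ∀ p, (q : ℂ) ^ 2 • v (b (b (W p))) =
      b (b p) - (1 - (q : ℂ) ^ 2) • (t (t (E p)) + (c : ℂ) • a (a p)) := fun p => by
    rw [h.rel p, add_sub_cancel_right]
  rw [e, e, h.E_comm hra hrs, map_sub, map_smul, map_add, map_smul, commute_apply hrb,
    commute_apply hrb, commute_apply hrt, commute_apply hrt, commute_apply hra, commute_apply hra]

/-- This is `v* Y ⊆ q² Y v*` in bounded form. The relation `Y X ⊆ q² X Y` is applied to `X* a⁴ p`;
the power four ensures that `X X* a⁴ p` is in the domain of `Y`. Finally `b` and the dense range of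
`a⁴` are cancelled. -/
theorem RepData.star_v_comm (h : RepData q c X Y a b v s t E W) (hrep : IsRepresentation q c X Y)
    (hq : (q : ℂ) ≠ 0) (hq₁ : q ^ 2 < 1) (hc : 0 ≤ c) :
    ((q : ℂ) ^ 2) • (t * star v * s) = s * star v * t := by
  have hq2 : (q : ℂ) ^ 2 ≠ 0 := pow_ne_zero _ hq
  have hss := Commute.refl s
  have hst := h.pair_st.comm
  have haa := Commute.refl a
  have hab := h.pair_ab.comm
  have hsub : ∀ r, Commute r a → Commute r (a * a) := fun r hr => hr.mul_right hr
  -- `Γ p = q² X X* a² p`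
  set Γ : K → K := fun p => (q : ℂ) ^ 2 • v (b (b (W p))) with hΓ
  have hΓaa : ∀ p, Γ (a (a p)) = s (s (E (Γ p))) := fun p => by
    rw [h.relE]
    exact h.smul_v_comm (hsub a haa) (hsub b hab.symm) (hsub s h.comm_as.symm)
      (hsub t h.comm_at.symm) p
  -- `z p = X* a⁴ p`
  set z : K → K := fun p => a (b (W (a (a p)))) with hz
  have hzX : ∀ p, (z p, ((q : ℂ) ^ 2)⁻¹ • s (s (E (Γ p)))) ∈ X.graph := fun p => by
    have h1 := h.isQuot_X.mem (b (W (a (a p))))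
    rw [← hΓaa]
    simp only [hΓ]
    rwa [inv_smul_smul₀ hq2]
  have hzY : ∀ p, ∃ y, (z p, y) ∈ Y.graph ∧
      (y, ((q : ℂ) ^ 2)⁻¹ • ((q : ℂ) ^ 2)⁻¹ • t (s (E (Γ p)))) ∈ X.graph := fun p => by
    have h1 := (mem_graph_opMul Y X _ _).2 ⟨_, hzX p,
      Y.graph.smul_mem ((q : ℂ) ^ 2)⁻¹ (h.isQuot_Y.mem (s (E (Γ p))))⟩
    obtain ⟨w, hw, hw'⟩ := (mem_graph_smul _ _ _ _).1 (LinearPMap.le_graph_of_le hrep.rel_YX h1)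
    rw [hw', inv_smul_smul₀ hq2]
    exact (mem_graph_opMul _ _ _ _).1 hw
  have hΓs : ∀ p, E (Γ (s p)) = s (E (Γ p)) := fun p => by
    rw [← h.E_comm h.comm_as hss]
    exact congrArg E (h.smul_v_comm h.comm_as h.comm_bs hss hst.symm p)
  have hΓt : ∀ p, E (Γ (t p)) = t (E (Γ p)) := fun p => by
    rw [← h.E_comm h.comm_at hst]
    exact congrArg E (h.smul_v_comm h.comm_at h.comm_bt hst (Commute.refl t) p)
  have hztz : ∀ p, (q : ℂ) ^ 2 • t (z (s p)) = s (z (t p)) := fun p => by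
    obtain ⟨y, hy, hy'⟩ := hzY (s p)
    have h1 := hzX (t p)
    rw [hΓs] at hy'
    rw [hΓt] at h1
    -- The vectors `q² Y z(s p)` and `z(t p)` have the same image under the injective `X`, because
    -- `s` and `t` commute.
    have h2 := X.graph.sub_mem (X.graph.smul_mem ((q : ℂ) ^ 2) hy') h1
    have h3 : ((q : ℂ) ^ 2 • y - z (t p), (0 : K)) ∈ X.graph := by
      convert h2 using 1
      refine Prod.ext rfl ?_
      change 0 = (q : ℂ) ^ 2 • ((q : ℂ) ^ 2)⁻¹ • ((q : ℂ) ^ 2)⁻¹ • t (s (s (E (Γ p)))) -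
        ((q : ℂ) ^ 2)⁻¹ • s (s (t (E (Γ p))))
      rw [smul_inv_smul₀ hq2, commute_apply hst, commute_apply hst, sub_self]
    have h4 : (q : ℂ) ^ 2 • y = z (t p) := sub_eq_zero.1 (hrep.eq_zero_of_mem_graph hq₁ hc h3)
    rw [(h.isQuot_Y.mem_iff h.pair_st _ _).1 hy, ← h4, map_smul]
  have haz : ∀ p, a (z p) = b (star v (a (a (a (a p))))) := fun p => by
    rw [h.relW]
    simp only [hz]
    rw [commute_apply hab, commute_apply hab]
  have hinj : ∀ x, (a * a * (a * a)) x = 0 → x = 0 := fun x hx =>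
    h.pair_ab.inj _ (h.pair_ab.inj _ (h.pair_ab.inj _ (h.pair_ab.inj _ hx)))
  have hself : IsSelfAdjoint (a * a * (a * a)) := by
    have h1 : IsSelfAdjoint (a * a) :=
      (h.pair_ab.left.commute_iff h.pair_ab.left).1 (Commute.refl a)
    exact (h1.commute_iff h1).1 (Commute.refl _)
  refine clm_eq_of_comp_eq (denseRange_of_injective hself hinj) fun p => ?_
  have h1 := congrArg a (hztz p)
  rw [map_smul, commute_apply h.comm_at, commute_apply h.comm_as, haz, haz,
    ← commute_apply h.comm_bt, ← commute_apply h.comm_bs, ← map_smul, ← sub_eq_zero,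
    ← map_sub] at h1
  have h2 := sub_eq_zero.1 (h.b_inj _ h1)
  have hs4 : a (a (a (a (s p)))) = s (a (a (a (a p)))) := by
    rw [commute_apply h.comm_as, commute_apply h.comm_as, commute_apply h.comm_as,
      commute_apply h.comm_as]
  have ht4 : a (a (a (a (t p)))) = t (a (a (a (a p)))) := by
    rw [commute_apply h.comm_at, commute_apply h.comm_at, commute_apply h.comm_at,
      commute_apply h.comm_at]
  rw [hs4, ht4] at h2
  exact h2

theorem RepData.mem_graph_star_v (h : RepData q c X Y a b v s t E W)
    (hrep : IsRepresentation q c X Y) (hq : (q : ℂ) ≠ 0) (hq₁ : q ^ 2 < 1) (hc : 0 ≤ c) {x y : K}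
    (hxy : (x, y) ∈ Y.graph) : (star v x, ((q : ℂ) ^ 2)⁻¹ • star v y) ∈ Y.graph := by
  obtain ⟨u, rfl, rfl⟩ := (h.isQuot_Y _ _).1 hxy
  rw [h.isQuot_Y.mem_iff h.pair_st, map_smul, eq_inv_smul_iff₀ (pow_ne_zero _ hq)]
  exact DFunLike.congr_fun (h.star_v_comm hrep hq hq₁ hc) u

/-- The adjoint of the identity for `v*` reads `q² s v t = t v s`. -/
theorem RepData.mem_graph_v (h : RepData q c X Y a b v s t E W)
    (hrep : IsRepresentation q c X Y) (hq : (q : ℂ) ≠ 0) (hq₁ : q ^ 2 < 1) (hc : 0 ≤ c) {x y : K}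
    (hxy : (x, y) ∈ Y.graph) : (v x, (q : ℂ) ^ 2 • v y) ∈ Y.graph := by
  obtain ⟨u, rfl, rfl⟩ := (h.isQuot_Y _ _).1 hxy
  rw [h.isQuot_Y.mem_iff h.pair_st, map_smul]
  have h1 := congrArg star (h.star_v_comm hrep hq hq₁ hc)
  rw [star_smul, star_mul, star_mul, star_mul, star_mul, star_star, h.pair_st.left.star_eq,
    h.pair_st.right.star_eq, star_pow, Complex.star_def, Complex.conj_ofReal] at h1
  exact (DFunLike.congr_fun h1 u).symm

end Representation

/-! ### The unitary part vanishes. -/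

section UnitaryPart

variable {K : Type u} [NormedAddCommGroup K] [InnerProductSpace ℂ K] [CompleteSpace K]

theorem star_pow_apply_pow_apply {v : K →L[ℂ] K} (hv : star v * v = 1) (n : ℕ) (x : K) :
    (star v ^ n) ((v ^ n) x) = x :=
  DFunLike.congr_fun (pow_mul_pow_eq_one n hv) x

theorem inner_pow_apply {v : K →L[ℂ] K} (n : ℕ) (x y : K) :
    ⟪(v ^ n) x, y⟫_ℂ = ⟪x, (star v ^ n) y⟫_ℂ := by
  rw [← star_pow, ContinuousLinearMap.star_eq_adjoint, ContinuousLinearMap.adjoint_inner_right]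

theorem norm_pow_apply {v : K →L[ℂ] K} (hv : star v * v = 1) (n : ℕ) (x : K) :
    ‖(v ^ n) x‖ = ‖x‖ := by
  have h : ⟪(v ^ n) x, (v ^ n) x⟫_ℂ = ⟪x, x⟫_ℂ := by
    rw [inner_pow_apply, star_pow_apply_pow_apply hv]
  rw [@norm_eq_sqrt_re_inner ℂ, h, ← @norm_eq_sqrt_re_inner ℂ]

theorem pow_apply_star_pow_apply {v : K →L[ℂ] K} (hv : star v * v = 1) {x : K}
    (hx : x ∈ unitaryPart v) (n : ℕ) : (v ^ n) ((star v ^ n) x) = x := by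
  obtain ⟨u, rfl⟩ := (Submodule.mem_iInf _).1 hx n
  exact congrArg (v ^ n) (star_pow_apply_pow_apply hv n u)

variable {q c : ℝ} {X Y : K →ₗ.[ℂ] K} {a b v s t : K →L[ℂ] K} {E W : K → K}

theorem RepData.mem_graph_star_v_pow (h : RepData q c X Y a b v s t E W)
    (hrep : IsRepresentation q c X Y) (hq : (q : ℂ) ≠ 0) (hq₁ : q ^ 2 < 1) (hc : 0 ≤ c) {x y : K}
    (hxy : (x, y) ∈ Y.graph) (n : ℕ) :
    ((star v ^ n) x, (((q : ℂ) ^ 2)⁻¹) ^ n • (star v ^ n) y) ∈ Y.graph := by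
  induction n with
  | zero => simpa using hxy
  | succ n ih =>
    have h1 := h.mem_graph_star_v hrep hq hq₁ hc ih
    rwa [map_smul, smul_smul, ← pow_succ', ← mul_apply_eq_comp, ← mul_apply_eq_comp,
      ← pow_succ'] at h1

theorem RepData.mem_graph_v_pow (h : RepData q c X Y a b v s t E W)
    (hrep : IsRepresentation q c X Y) (hq : (q : ℂ) ≠ 0) (hq₁ : q ^ 2 < 1) (hc : 0 ≤ c) {x y : K}
    (hxy : (x, y) ∈ Y.graph) (n : ℕ) :
    ((v ^ n) x, ((q : ℂ) ^ 2) ^ n • (v ^ n) y) ∈ Y.graph := by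
  induction n with
  | zero => simpa using hxy
  | succ n ih =>
    have h1 := h.mem_graph_v hrep hq hq₁ hc ih
    rwa [map_smul, smul_smul, ← pow_succ', ← mul_apply_eq_comp, ← mul_apply_eq_comp,
      ← pow_succ'] at h1

/-- Applying `vⁿ v*ⁿ` to `(x, y)` stays in the graph of `Y` and fixes `x`, hence fixes `y`; and `vⁿ`
is isometric. -/
theorem RepData.norm_star_v_pow (h : RepData q c X Y a b v s t E W)
    (hrep : IsRepresentation q c X Y) (hq : (q : ℂ) ≠ 0) (hq₁ : q ^ 2 < 1) (hc : 0 ≤ c) {x y : K}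
    (hxy : (x, y) ∈ Y.graph) (hx : x ∈ unitaryPart v) (n : ℕ) : ‖(star v ^ n) y‖ = ‖y‖ := by
  have h1 := h.mem_graph_v_pow hrep hq hq₁ hc (h.mem_graph_star_v_pow hrep hq hq₁ hc hxy n) n
  rw [pow_apply_star_pow_apply h.isometry hx, map_smul, smul_smul, ← mul_pow,
    mul_inv_cancel₀ (pow_ne_zero 2 hq), one_pow, one_smul] at h1
  conv_rhs => rw [eq_of_mem_graph hxy h1]
  exact (norm_pow_apply h.isometry n _).symm

theorem RepData.inner_nonneg (h : RepData q c X Y a b v s t E W) (p : K) :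
    0 ≤ (⟪a (a p), b (b p)⟫_ℂ).re := by
  rw [inner_left_of_isSelfAdjoint h.pair_ab.left, commute_apply h.pair_ab.comm,
    ← inner_left_of_isSelfAdjoint h.pair_ab.right, ← commute_apply h.pair_ab.comm]
  exact inner_self_nonneg (𝕜 := ℂ)

theorem RepData.inner_rel (h : RepData q c X Y a b v s t E W) (p : K) :
    (⟪a (a p), b (b p)⟫_ℂ).re = q ^ 2 * (⟪a (a (W p)), b (b (W p))⟫_ℂ).re +
      (1 - q ^ 2) * (‖t (s (E p))‖ ^ 2 + c * ‖a (a p)‖ ^ 2) := by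
  have e1 : ⟪a (a p), v (b (b (W p)))⟫_ℂ = ⟪a (a (W p)), b (b (W p))⟫_ℂ := by
    rw [← h.relW, ContinuousLinearMap.star_eq_adjoint, ContinuousLinearMap.adjoint_inner_left]
  have e2 : ⟪a (a p), t (t (E p))⟫_ℂ = ((‖t (s (E p))‖ ^ 2 : ℝ) : ℂ) := by
    rw [← h.relE, inner_left_of_isSelfAdjoint h.pair_st.left, commute_apply h.pair_st.comm,
      commute_apply h.pair_st.comm, ← inner_left_of_isSelfAdjoint h.pair_st.right,
      inner_self_eq_norm_sq_to_K]
    norm_cast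
  have e3 : ⟪a (a p), a (a p)⟫_ℂ = ((‖a (a p)‖ ^ 2 : ℝ) : ℂ) := by
    rw [inner_self_eq_norm_sq_to_K]
    norm_cast
  have e4 : (q : ℂ) ^ 2 = ((q ^ 2 : ℝ) : ℂ) := by push_cast; rfl
  have e5 : (1 : ℂ) - ((q ^ 2 : ℝ) : ℂ) = ((1 - q ^ 2 : ℝ) : ℂ) := by push_cast; rfl
  rw [h.rel p, inner_add_right, inner_smul_right, inner_smul_right, inner_add_right,
    inner_smul_right, e1, e2, e3, e4, e5, Complex.add_re, Complex.re_ofReal_mul,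
    Complex.re_ofReal_mul, Complex.add_re, Complex.re_ofReal_mul, Complex.ofReal_re,
    Complex.ofReal_re]

theorem RepData.iterate_W (h : RepData q c X Y a b v s t E W) (p : K) (n : ℕ) :
    a (a (W^[n] p)) = (star v ^ n) (a (a p)) := by
  induction n with
  | zero => rfl
  | succ n ih => rw [Function.iterate_succ_apply', ← h.relW, ih, ← mul_apply_eq_comp, ← pow_succ']

theorem RepData.mem_graph_Y (h : RepData q c X Y a b v s t E W) (p : K) :
    (a (a p), t (s (E p))) ∈ Y.graph := by
  rw [← h.relE]
  exact h.isQuot_Y.mem _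

/-- A vector of the unitary part in the domain of `X* X` vanishes. -/
theorem RepData.eq_zero_of_mem_unitaryPart (h : RepData q c X Y a b v s t E W)
    (hrep : IsRepresentation q c X Y) (hq₀ : 0 < q) (hq₁ : q < 1) (hc : 0 ≤ c) {p : K}
    (hp : a (a p) ∈ unitaryPart v) : a (a p) = 0 := by
  have hq : (q : ℂ) ≠ 0 := by exact_mod_cast hq₀.ne'
  have hq2 : q ^ 2 < 1 := pow_lt_one₀ hq₀.le hq₁ two_ne_zero
  set y : K := t (s (E p)) with hy
  have hnorm : ∀ n, ‖t (s (E (W^[n] p)))‖ = (q ^ 2)⁻¹ ^ n * ‖y‖ := fun n => by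
    have h1 := h.mem_graph_Y (W^[n] p)
    rw [h.iterate_W] at h1
    rw [eq_of_mem_graph h1 (h.mem_graph_star_v_pow hrep hq hq2 hc (h.mem_graph_Y p) n), norm_smul,
      h.norm_star_v_pow hrep hq hq2 hc (h.mem_graph_Y p) hp]
    simp [abs_of_pos hq₀, hy]
  -- With `xₙ = v*ⁿ a² p`, `α n` is `⟨xₙ, X* X xₙ⟩` and obeys `α n = q² α (n + 1) + (1 - q²) (‖Y
  -- xₙ‖² + c ‖xₙ‖²)`. The factor `q²ⁿ` makes the sum telescope, while `q²ⁿ ‖Y xₙ‖² = q⁻²ⁿ ‖y‖² ≥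
  -- ‖y‖²` prevents the increments from decaying.
  set α : ℕ → ℝ := fun n => (⟪a (a (W^[n] p)), b (b (W^[n] p))⟫_ℂ).re with hα
  have hstep : ∀ n, (q ^ 2) ^ (n + 1) * α (n + 1) + (1 - q ^ 2) * ‖y‖ ^ 2 ≤ (q ^ 2) ^ n * α n := by
    intro n
    have h1 : α n = q ^ 2 * α (n + 1) + (1 - q ^ 2) *
        (((q ^ 2)⁻¹ ^ n * ‖y‖) ^ 2 + c * ‖a (a (W^[n] p))‖ ^ 2) := by
      simp only [hα]
      rw [h.inner_rel, hnorm, Function.iterate_succ_apply']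
    have h2 : (q ^ 2) ^ n * ((q ^ 2)⁻¹ ^ n * ‖y‖) ^ 2 = (q ^ 2)⁻¹ ^ n * ‖y‖ ^ 2 := by
      rw [inv_pow]
      field_simp
    have h3 : (1 : ℝ) ≤ (q ^ 2)⁻¹ ^ n := one_le_pow₀ ((one_le_inv₀ (by positivity)).2 hq2.le)
    have h4 : 0 < 1 - q ^ 2 := sub_pos.2 hq2
    have h5 : (q ^ 2) ^ n * α n = (q ^ 2) ^ (n + 1) * α (n + 1) + (1 - q ^ 2) *
        ((q ^ 2)⁻¹ ^ n * ‖y‖ ^ 2 + (q ^ 2) ^ n * (c * ‖a (a (W^[n] p))‖ ^ 2)) := by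
      rw [← h2, h1]
      ring
    rw [h5]
    gcongr
    have h6 : 0 ≤ (q ^ 2) ^ n * (c * ‖a (a (W^[n] p))‖ ^ 2) := by positivity
    nlinarith [mul_le_mul_of_nonneg_right h3 (sq_nonneg ‖y‖)]
  have hsum : ∀ n : ℕ, n * ((1 - q ^ 2) * ‖y‖ ^ 2) + (q ^ 2) ^ n * α n ≤ α 0 := by
    intro n
    induction n with
    | zero => simp
    | succ n ih =>
      have := hstep n
      push_cast
      linarith
  have hle : (1 - q ^ 2) * ‖y‖ ^ 2 ≤ 0 := by
    by_contra! hpos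
    obtain ⟨n, hn⟩ := exists_lt_nsmul hpos (α 0)
    rw [nsmul_eq_mul] at hn
    have h1 : 0 ≤ (q ^ 2) ^ n * α n := mul_nonneg (by positivity) (h.inner_nonneg _)
    linarith [hsum n]
  have hy0 : y = 0 := by
    have h1 : ‖y‖ ^ 2 ≤ 0 := nonpos_of_mul_nonpos_right hle (sub_pos.2 hq2)
    simpa using le_antisymm h1 (sq_nonneg _)
  have h1 := h.mem_graph_Y p
  rw [← hy, hy0] at h1
  exact (hasTrivialKernel_iff Y).1 hrep.kernel _ h1

/-- The reducing property splits a vector of the domain of `X* X` into two vectors of that domain;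
the one in the unitary part is zero. So the dense domain is orthogonal to the unitary part. -/
theorem RepData.unitaryPart_eq_bot (h : RepData q c X Y a b v s t E W)
    (hrep : IsRepresentation q c X Y) (hred : Reduces (unitaryPart v) (opMul X† X)) (hq₀ : 0 < q)
    (hq₁ : q < 1) (hc : 0 ≤ c) : unitaryPart v = ⊥ := by
  have hdense : DenseRange (a * a) := by
    refine denseRange_of_injective ?_ fun x hx => h.pair_ab.inj _ (h.pair_ab.inj _ hx)
    exact (h.pair_ab.left.commute_iff h.pair_ab.left).1 (Commute.refl a)
  have hmem : ∀ d : (opMul X† X).domain, (d : K) ∈ (unitaryPart v)ᗮ := fun d => by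
    obtain ⟨y, z, hd, hy, -, hz, -⟩ := hred d
    obtain ⟨p, hp, -⟩ := (h.isQuot_sq _ _).1 ((opMul X† X).mem_graph y)
    rw [← hp] at hy
    rw [hd, ← hp, mul_apply_eq_comp, h.eq_zero_of_mem_unitaryPart hrep hq₀ hq₁ hc hy, zero_add]
    exact hz
  have htop : (unitaryPart v)ᗮ = ⊤ := by
    rw [← (Submodule.isClosed_orthogonal (unitaryPart v)).submodule_topologicalClosure_eq,
      ← Submodule.dense_iff_topologicalClosure_eq_top]
    exact (h.isQuot_sq.dense_domain hdense).mono fun d hd => hmem ⟨d, hd⟩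
  rw [Submodule.eq_bot_iff]
  intro x hx
  have h1 : x ∈ (unitaryPart v)ᗮ := htop ▸ Submodule.mem_top
  exact inner_self_eq_zero.1 (h1 x hx)

end UnitaryPart

/-! ### Wold decomposition of an isometry without unitary part. -/

section Wold

variable {K : Type u} [NormedAddCommGroup K] [InnerProductSpace ℂ K] [CompleteSpace K]

/-- The wandering subspace `ker v*` of an isometry `v`. -/
noncomputable abbrev wandering (v : K →L[ℂ] K) : Submodule ℂ K :=
  LinearMap.ker (star v : K →L[ℂ] K).toLinearMap

theorem inner_wandering {v : K →L[ℂ] K} (w : wandering v) (x : K) : ⟪(w : K), v x⟫_ℂ = 0 := by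
  have hw : star v (w : K) = 0 := w.2
  rw [← ContinuousLinearMap.adjoint_inner_left, ← ContinuousLinearMap.star_eq_adjoint, hw,
    inner_zero_left]

theorem sub_mem_wandering {v : K →L[ℂ] K} (hv : star v * v = 1) (x : K) :
    x - v (star v x) ∈ wandering v := by
  have h : star v (v (star v x)) = star v x := DFunLike.congr_fun hv _
  change star v (x - v (star v x)) = 0
  rw [map_sub, h, sub_self]

/-- The embedding of the wandering subspace as `vⁿ ker v*`. -/
noncomputable def wanderingEmbedding {v : K →L[ℂ] K} (hv : star v * v = 1) (n : ℕ) :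
    wandering v →ₗᵢ[ℂ] K where
  toLinearMap := (v ^ n).toLinearMap ∘ₗ (wandering v).subtype
  norm_map' w := norm_pow_apply hv n (w : K)

theorem wanderingEmbedding_apply {v : K →L[ℂ] K} (hv : star v * v = 1) (n : ℕ) (w : wandering v) :
    wanderingEmbedding hv n w = (v ^ n) (w : K) := rfl

theorem orthogonalFamily_wandering {v : K →L[ℂ] K} (hv : star v * v = 1) :
    OrthogonalFamily ℂ (fun _ : ℕ => wandering v) (wanderingEmbedding hv) := by
  have key : ∀ i k (w w' : wandering v),
      ⟪wanderingEmbedding hv i w, wanderingEmbedding hv (i + (k + 1)) w'⟫_ℂ = 0 := by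
    intro i k w w'
    rw [wanderingEmbedding_apply, wanderingEmbedding_apply, inner_pow_apply, pow_add,
      mul_apply_eq_comp, star_pow_apply_pow_apply hv, pow_succ', mul_apply_eq_comp,
      inner_wandering]
  intro i j hij w w'
  rcases lt_or_gt_of_ne hij with h | h
  · obtain ⟨k, rfl⟩ := Nat.exists_eq_add_of_lt h
    exact key i k w w'
  · obtain ⟨k, rfl⟩ := Nat.exists_eq_add_of_lt h
    rw [← inner_conj_symm]
    exact (congrArg _ (key j k w' w)).trans (map_zero _)

/-- If `x` is orthogonal to every `vⁿ ker v*`, then each `v*ⁿ x` is orthogonal to `ker v*`, so it is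
in the range of `v`. Inductively `x = vⁿ v*ⁿ x` for all `n`, and `x` is in the unitary part. -/
theorem isHilbertSum_wandering {v : K →L[ℂ] K} (hv : star v * v = 1) (h : unitaryPart v = ⊥) :
    IsHilbertSum ℂ (fun _ : ℕ => wandering v) (wanderingEmbedding hv) := by
  refine .mk (orthogonalFamily_wandering hv) ?_
  rw [top_le_iff, Submodule.topologicalClosure_eq_top_iff, Submodule.eq_bot_iff]
  intro x hx
  have h1 : ∀ n, ∀ w : wandering v, ⟪(w : K), (star v ^ n) x⟫_ℂ = 0 := fun n w => by
    rw [← inner_pow_apply]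
    exact hx _ (Submodule.mem_iSup_of_mem n ⟨w, rfl⟩)
  have h2 : ∀ n, (star v ^ n) x = v ((star v ^ (n + 1)) x) := fun n => by
    have h3 := sub_mem_wandering hv ((star v ^ n) x)
    have h4 := inner_sub_right (𝕜 := ℂ) ((star v ^ n) x - v (star v ((star v ^ n) x)))
      ((star v ^ n) x) (v (star v ((star v ^ n) x)))
    rw [h1 n ⟨_, h3⟩, inner_wandering ⟨_, h3⟩, sub_zero, inner_self_eq_zero] at h4
    rw [pow_succ', mul_apply_eq_comp]
    exact sub_eq_zero.1 h4
  have h3 : ∀ n, (v ^ n) ((star v ^ n) x) = x := fun n => by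
    induction n with
    | zero => rfl
    | succ n ih => rw [pow_succ v, mul_apply_eq_comp, ← h2, ih]
  have h4 : x ∈ unitaryPart v := (Submodule.mem_iInf _).2 fun n => ⟨_, h3 n⟩
  rwa [h, Submodule.mem_bot] at h4

/-- The Wold decomposition of an isometry without unitary part. -/
theorem exists_wold {v : K →L[ℂ] K} (hv : star v * v = 1) (h : unitaryPart v = ⊥) :
    ∃ U : K ≃ₗᵢ[ℂ] HSum (wandering v),
      ∀ x n, (U x n : K) = (star v ^ n) x - v ((star v ^ (n + 1)) x) := by
  refine ⟨(isHilbertSum_wandering hv h).linearIsometryEquiv, fun x n => ?_⟩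
  have h1 := sub_mem_wandering hv ((star v ^ n) x)
  rw [pow_succ', mul_apply_eq_comp]
  refine congrArg Subtype.val (a₂ := (⟨_, h1⟩ : wandering v)) (ext_inner_left ℂ fun w => ?_)
  have e1 := lp.inner_single_left (𝕜 := ℂ) n w ((isHilbertSum_wandering hv h).linearIsometryEquiv x)
  refine e1.symm.trans ?_
  rw [← LinearIsometryEquiv.inner_map_map (isHilbertSum_wandering hv h).linearIsometryEquiv.symm,
    LinearIsometryEquiv.symm_apply_apply, IsHilbertSum.linearIsometryEquiv_symm_apply_single,
    wanderingEmbedding_apply, inner_pow_apply, Submodule.coe_inner, inner_sub_right,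
    inner_wandering, sub_zero]

end Wold

/-! ### Identification with the model. -/

section Model

variable {K : Type u} [NormedAddCommGroup K] [InnerProductSpace ℂ K]

/-- The part of `Y` in the subspace `M`. -/
noncomputable def partIn (M : Submodule ℂ K) (Y : K →ₗ.[ℂ] K) : M →ₗ.[ℂ] M :=
  (Y.graph.comap (M.subtype.prodMap M.subtype)).toLinearPMap

theorem mem_graph_partIn {M : Submodule ℂ K} {Y : K →ₗ.[ℂ] K} {x y : M} :
    (x, y) ∈ (partIn M Y).graph ↔ ((x : K), (y : K)) ∈ Y.graph := by
  unfold partIn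
  rw [Submodule.toLinearPMap_graph_eq]
  · rfl
  · rintro ⟨x, y⟩ hxy (rfl : x = 0)
    have h1 : ((0 : K), (y : K)) ∈ Y.graph := hxy
    exact Subtype.ext (eq_of_mem_graph h1 Y.graph.zero_mem)

theorem hasTrivialKernel_partIn {M : Submodule ℂ K} {Y : K →ₗ.[ℂ] K} (hY : HasTrivialKernel Y) :
    HasTrivialKernel (partIn M Y) := by
  rw [hasTrivialKernel_iff] at hY ⊢
  exact fun x hx => Subtype.ext (hY x (mem_graph_partIn.1 hx))

variable [CompleteSpace K]

/-- `U` is the unitary of the Wold decomposition of the isometry `v`. -/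
def IsWold (v : K →L[ℂ] K) (U : K ≃ₗᵢ[ℂ] HSum (wandering v)) : Prop :=
  ∀ x n, (U x n : K) = (star v ^ n) x - v ((star v ^ (n + 1)) x)

theorem IsWold.apply_v_zero {v : K →L[ℂ] K} {U : K ≃ₗᵢ[ℂ] HSum (wandering v)} (hU : IsWold v U)
    (hv : star v * v = 1) (x : K) : U (v x) 0 = 0 := by
  refine Subtype.ext ((hU _ _).trans ?_)
  have h := star_pow_apply_pow_apply hv 1 x
  rw [pow_one v] at h
  rw [zero_add, h, pow_zero, one_apply_eq_self, sub_self]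
  rfl

theorem IsWold.apply_v_succ {v : K →L[ℂ] K} {U : K ≃ₗᵢ[ℂ] HSum (wandering v)} (hU : IsWold v U)
    (hv : star v * v = 1) (x : K) (n : ℕ) : U (v x) (n + 1) = U x n := by
  refine Subtype.ext ((hU _ _).trans (Eq.trans ?_ (hU _ _).symm))
  have h : ∀ n, (star v ^ (n + 1)) (v x) = (star v ^ n) x := fun n => by
    rw [pow_succ, mul_apply_eq_comp]
    exact congrArg _ (star_pow_apply_pow_apply hv 1 x)
  rw [h, h]

theorem IsWold.apply_star_v {v : K →L[ℂ] K} {U : K ≃ₗᵢ[ℂ] HSum (wandering v)} (hU : IsWold v U)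
    (x : K) (n : ℕ) : U (star v x) n = U x (n + 1) := by
  refine Subtype.ext ((hU _ _).trans (Eq.trans ?_ (hU _ _).symm))
  rw [pow_succ _ (n + 1), mul_apply_eq_comp, pow_succ, mul_apply_eq_comp, mul_apply_eq_comp]

theorem IsWold.eq_of_apply_zero {v : K →L[ℂ] K} {U : K ≃ₗᵢ[ℂ] HSum (wandering v)}
    (hU : IsWold v U) {x : K} (hx : U x 0 = 0) : v (star v x) = x := by
  have h := hU x 0
  rw [hx, zero_add, pow_one, pow_zero, one_apply_eq_self] at h
  exact (sub_eq_zero.1 h.symm).symm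

theorem IsWold.apply_coe {v : K →L[ℂ] K} {U : K ≃ₗᵢ[ℂ] HSum (wandering v)}
    (hU : IsWold v U) (w : wandering v) : U (w : K) 0 = w := by
  have hw : star v (w : K) = 0 := w.2
  refine Subtype.ext ((hU _ _).trans ?_)
  rw [zero_add, pow_one, hw, map_zero, sub_zero]
  rfl

variable {q c : ℝ} {X Y : K →ₗ.[ℂ] K} {a b v s t : K →L[ℂ] K} {E W : K → K}
  {U : K ≃ₗᵢ[ℂ] HSum (wandering v)}

/-- Component `n` is `(1 - v v*) v*ⁿ x`; the factors of `v` and `v*` on `Y` cancel in `v v*`,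
leaving `q⁻²ⁿ`. -/
theorem RepData.mem_graph_partIn_wold (h : RepData q c X Y a b v s t E W)
    (hrep : IsRepresentation q c X Y) (hq : (q : ℂ) ≠ 0) (hq₁ : q ^ 2 < 1) (hc : 0 ≤ c)
    (hU : IsWold v U) {x y : K} (hxy : (x, y) ∈ Y.graph) (n : ℕ) :
    (U x n, ((q : ℂ) ^ 2)⁻¹ ^ n • U y n) ∈ (partIn (wandering v) Y).graph := by
  rw [mem_graph_partIn, Submodule.coe_smul, hU, hU, pow_succ', mul_apply_eq_comp, mul_apply_eq_comp]
  have h1 := h.mem_graph_star_v_pow hrep hq hq₁ hc hxy n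
  have h2 := h.mem_graph_v hrep hq hq₁ hc (h.mem_graph_star_v hrep hq hq₁ hc h1)
  have h3 := Y.graph.sub_mem h1 h2
  rwa [map_smul, smul_inv_smul₀ (pow_ne_zero 2 hq), map_smul, map_smul, Prod.mk_sub_mk, ← smul_sub]
    at h3

/-- The projection `x ↦ U x 0` onto `ker v*` maps the graph of `Y` into itself, so testing against
the part of `Y` is as strong as testing against `Y`. -/
theorem RepData.isSelfAdjoint_partIn (h : RepData q c X Y a b v s t E W)
    (hrep : IsRepresentation q c X Y) (hq : (q : ℂ) ≠ 0) (hq₁ : q ^ 2 < 1) (hc : 0 ≤ c)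
    (hU : IsWold v U) : IsSelfAdjoint (partIn (wandering v) Y) := by
  have hmem : ∀ {x y : K}, (x, y) ∈ Y.graph →
      (U x 0, U y 0) ∈ (partIn (wandering v) Y).graph := fun hxy => by
    simpa using h.mem_graph_partIn_wold hrep hq hq₁ hc hU hxy 0
  refine isSelfAdjoint_of_forall_mem_graph_iff ?_ fun y z => ⟨fun hyz p r hpr => ?_, fun hyz => ?_⟩
  · have hs : Function.Surjective fun x : K => U x 0 := fun w => ⟨w, hU.apply_coe w⟩
    refine (hs.denseRange.dense_image ((continuous_eval 0).comp U.continuous)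
      hrep.selfAdjoint.dense_domain).mono ?_
    rintro _ ⟨x, hx, rfl⟩
    obtain ⟨y, hy⟩ := LinearPMap.mem_domain_iff.1 hx
    exact LinearPMap.mem_domain_of_mem_graph (hmem hy)
  · exact (mem_graph_iff_of_isSelfAdjoint hrep.selfAdjoint _ _).1 (mem_graph_partIn.1 hyz) _ _
      (mem_graph_partIn.1 hpr)
  · rw [mem_graph_partIn, mem_graph_iff_of_isSelfAdjoint hrep.selfAdjoint]
    intro p r hpr
    have key : ∀ (x : K) (w : wandering v), ⟪((U x 0 : wandering v) : K), (w : K)⟫_ℂ = ⟪x, w⟫_ℂ :=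
      fun x w => by
        rw [hU, inner_sub_left, ← inner_conj_symm (v _), inner_wandering, map_zero, sub_zero]
        rfl
    rw [← key r, ← key p]
    exact hyz _ _ (hmem hpr)

theorem RepData.intertwines_Y (h : RepData q c X Y a b v s t E W) (hrep : IsRepresentation q c X Y)
    (hq₀ : 0 < q) (hq₁ : q < 1) (hc : 0 ≤ c) (hU : IsWold v U) :
    Intertwines U Y (modelY q (partIn (wandering v) Y)) := by
  have hq : (q : ℂ) ≠ 0 := by exact_mod_cast hq₀.ne'
  have hq2 : q ^ 2 < 1 := pow_lt_one₀ hq₀.le hq₁ two_ne_zero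
  obtain ⟨α, β, γ, hw⟩ :=
    exists_weightData hq₀ hq₁ hc (h.isSelfAdjoint_partIn hrep hq hq2 hc hU)
  refine intertwines_of_isSelfAdjoint hrep.selfAdjoint (hw.isSelfAdjoint_modelY hq₀ hq₁)
    fun x y hxy => (mem_graph_diagOp _ _ _).2 fun n => (mem_graph_smul _ _ _ _).2 ⟨_,
      h.mem_graph_partIn_wold hrep hq hq2 hc hU hxy n, ?_⟩
  rw [pow_mul, inv_pow, smul_inv_smul₀ (pow_ne_zero n (pow_ne_zero 2 hq))]

variable {L : Type u} [NormedAddCommGroup L] [InnerProductSpace ℂ L] [CompleteSpace L]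

theorem WeightData.isPosSqrt_diagOp {Y₀ : L →ₗ.[ℂ] L} {α β : L →L[ℂ] L} {γ : ℕ → L →L[ℂ] L}
    (hw : WeightData q c Y₀ α β γ) :
    IsPosSqrt (opMul (diagOp (weight q c Y₀)) (diagOp (weight q c Y₀)))
      (diagOp (weight q c Y₀)) := by
  refine ⟨isSelfAdjoint_diagOp hw.isSelfAdjoint_weight, fun x => ?_, rfl⟩
  have h1 := (mem_graph_diagOp _ _ _).1 ((diagOp (weight q c Y₀)).mem_graph x)
  have h2 := lp.hasSum_inner (𝕜 := ℂ) (x : HSum L) (diagOp (weight q c Y₀) x)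
  refine (Complex.hasSum_re h2).nonneg fun n => ?_
  obtain ⟨u, hu, hu'⟩ := (hw.weight_isQuot n _ _).1 (h1 n)
  rw [← hu, ← hu', inner_left_of_isSelfAdjoint hw.pair.left]
  exact (nonneg_iff_inner.1
    ((hw.weight_pair n).comm.mul_nonneg hw.left_nonneg (hw.weight_nonneg n))).2 u

/-- Induction along the shift: in summand `n + 1` the term `X X* a² p` is `v b² W p`, whose
component is that of `b² W p` in summand `n`, known by induction since `v* a² p = a² W p`. In
summand `0` it is zero. -/
theorem RepData.exists_mem_graph_sq (h : RepData q c X Y a b v s t E W) (hq : (q : ℂ) ≠ 0)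
    (hU : IsWold v U)
    (hY : Intertwines U Y (modelY q (partIn (wandering v) Y))) (n : ℕ) (p : K) :
    ∃ η, (U (a (a p)) n, η) ∈ (opMul (partIn (wandering v) Y) (partIn (wandering v) Y)).graph ∧
      U (b (b p)) n = (1 - (q : ℂ) ^ (2 * n + 2)) •
        ((q : ℂ) ^ (2 * n) • η + (c : ℂ) • U (a (a p)) n) := by
  have hEη : ∀ (n : ℕ) (p : K), ∃ η,
      (U (a (a p)) n, η) ∈ (opMul (partIn (wandering v) Y) (partIn (wandering v) Y)).graph ∧
      U (t (t (E p))) n = (q : ℂ) ^ (4 * n) • η := fun n p => by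
    have h1 := (mem_graph_diagOp _ _ _).1 ((hY _ _).1 (h.mem_graph_Y p)) n
    have h2 := (mem_graph_diagOp _ _ _).1 ((hY _ _).1 (h.isQuot_Y.mem (t (E p)))) n
    obtain ⟨y, hy, hy'⟩ := (mem_graph_smul _ _ _ _).1 h1
    obtain ⟨z, hz, hz'⟩ := (mem_graph_smul _ _ _ _).1 h2
    rw [commute_apply h.pair_st.comm, hy'] at hz
    refine ⟨((q : ℂ) ^ (2 * n))⁻¹ • z, (mem_graph_opMul _ _ _ _).2 ⟨y, hy, ?_⟩, ?_⟩
    · have h3 := (partIn (wandering v) Y).graph.smul_mem ((q : ℂ) ^ (2 * n))⁻¹ hz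
      rwa [Prod.smul_mk, inv_smul_smul₀ (pow_ne_zero _ hq)] at h3
    · rw [hz', show 4 * n = 2 * n + 2 * n by ring, pow_add, mul_smul,
        smul_inv_smul₀ (pow_ne_zero _ hq)]
  have hUrel : ∀ n p, U (b (b p)) n = (q : ℂ) ^ 2 • U (v (b (b (W p)))) n +
      (1 - (q : ℂ) ^ 2) • (U (t (t (E p))) n + (c : ℂ) • U (a (a p)) n) := fun n p => by
    rw [h.rel p, map_add, map_smul, map_smul, map_add, map_smul]
    rfl
  induction n generalizing p with
  | zero =>
    obtain ⟨η, h1, h2⟩ := hEη 0 p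
    refine ⟨η, h1, ?_⟩
    rw [hUrel, hU.apply_v_zero h.isometry, h2, smul_zero, zero_add]
  | succ n ih =>
    obtain ⟨η, h1, h2⟩ := hEη (n + 1) p
    obtain ⟨η', h3, h4⟩ := ih (W p)
    rw [← h.relW, hU.apply_star_v] at h3 h4
    obtain rfl := eq_of_mem_graph h1 h3
    refine ⟨η, h1, ?_⟩
    rw [hUrel, hU.apply_v_succ h.isometry, h2, h4]
    module

theorem RepData.intertwines_sq (h : RepData q c X Y a b v s t E W)
    (hrep : IsRepresentation q c X Y) (hq₀ : 0 < q) (hq₁ : q < 1) (hc : 0 ≤ c) (hU : IsWold v U) :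
    Intertwines U (opMul X† X)
      (opMul (diagOp (weight q c (partIn (wandering v) Y)))
        (diagOp (weight q c (partIn (wandering v) Y)))) := by
  have hq : (q : ℂ) ≠ 0 := by exact_mod_cast hq₀.ne'
  have hq2 : q ^ 2 < 1 := pow_lt_one₀ hq₀.le hq₁ two_ne_zero
  obtain ⟨α, β, γ, hw⟩ :=
    exists_weightData hq₀ hq₁ hc (h.isSelfAdjoint_partIn hrep hq hq2 hc hU)
  have hX := h.isQuot_modulus.isPosSqrt h.pair_ab h.a_nonneg h.b_nonneg h.isQuot_sq
  refine intertwines_of_isSelfAdjoint hX.isSelfAdjoint hw.isPosSqrt_diagOp.isSelfAdjoint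
    fun x y hxy => (mem_graph_opMul_diagOp hw.isSelfAdjoint_weight _ _).2 fun n => ?_
  obtain ⟨p, rfl, rfl⟩ := (h.isQuot_sq _ _).1 hxy
  obtain ⟨η, h1, h2⟩ :=
    h.exists_mem_graph_sq hq hU (h.intertwines_Y hrep hq₀ hq₁ hc hU) n p
  obtain ⟨u, h3, h4⟩ := (hw.isQuot.opMul hw.isQuot hw.pair _ _).1 h1
  refine ((hw.weight_isQuot n).opMul (hw.weight_isQuot n) (hw.weight_pair n) _ _).2 ⟨u, h3, ?_⟩
  rw [mul_apply_eq_comp, hw.weight_sq_apply]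
  exact (h2.trans (by rw [← h3, ← h4]; rfl)).symm

/-- Uniqueness of square roots carries `|X|` to the diagonal operator of the weights, while `v`
becomes the shift. -/
theorem RepData.intertwines_X (h : RepData q c X Y a b v s t E W)
    (hrep : IsRepresentation q c X Y) (hq₀ : 0 < q) (hq₁ : q < 1) (hc : 0 ≤ c) (hU : IsWold v U) :
    Intertwines U X (modelX q c (partIn (wandering v) Y)) := by
  have hq : (q : ℂ) ≠ 0 := by exact_mod_cast hq₀.ne'
  have hq2 : q ^ 2 < 1 := pow_lt_one₀ hq₀.le hq₁ two_ne_zero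
  obtain ⟨α, β, γ, hw⟩ :=
    exists_weightData hq₀ hq₁ hc (h.isSelfAdjoint_partIn hrep hq hq2 hc hU)
  have hmod := (h.intertwines_sq hrep hq₀ hq₁ hc hU).isPosSqrt
    (h.isQuot_modulus.isPosSqrt h.pair_ab h.a_nonneg h.b_nonneg h.isQuot_sq) hw.isPosSqrt_diagOp
  intro x y
  refine Iff.trans ?_ (mem_graph_raisingOp _ _ _).symm
  constructor
  · intro hxy
    obtain ⟨u, rfl, rfl⟩ := (h.isQuot_X _ _).1 hxy
    refine ⟨hU.apply_v_zero h.isometry _, fun n => ?_⟩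
    have h1 := (mem_graph_diagOp _ _ _).1 ((hmod _ _).1 (h.isQuot_modulus.mem u)) n
    rwa [← hU.apply_v_succ h.isometry (b u)] at h1
  · rintro ⟨h0, h1⟩
    -- Undoing the shift by `v*` loses nothing: `y` vanishes in summand `0`, so `v v* y = y`.
    have h2 : (x, star v y) ∈ (modulus X).graph :=
      (hmod _ _).2 ((mem_graph_diagOp _ _ _).2 fun n => by rw [hU.apply_star_v]; exact h1 n)
    obtain ⟨u, rfl, hu⟩ := (h.isQuot_modulus _ _).1 h2
    refine (h.isQuot_X _ _).2 ⟨u, rfl, ?_⟩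
    rw [mul_apply_eq_comp, hu, hU.eq_of_apply_zero h0]

theorem IsRepresentation.exists_model (hrep : IsRepresentation q c X Y)
    (hwb : IsWellBehaved X Y) (hq₀ : 0 < q) (hq₁ : q < 1) (hc : 0 ≤ c) :
    ∃ (K₀ : Type u) (_ : NormedAddCommGroup K₀) (_ : InnerProductSpace ℂ K₀)
      (_ : CompleteSpace K₀) (Y₀ : K₀ →ₗ.[ℂ] K₀) (U : K ≃ₗᵢ[ℂ] HSum K₀),
      IsSelfAdjoint Y₀ ∧ HasTrivialKernel Y₀ ∧ Intertwines U X (modelX q c Y₀) ∧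
      Intertwines U X† (modelXstar q c Y₀) ∧ Intertwines U Y (modelY q Y₀) := by
  have hq : (q : ℂ) ≠ 0 := by exact_mod_cast hq₀.ne'
  have hq2 : q ^ 2 < 1 := pow_lt_one₀ hq₀.le hq₁ two_ne_zero
  obtain ⟨a, b, v, s, t, E, W, h⟩ := hrep.exists_repData hq2 hc hwb.strongly_commute
  obtain ⟨U, hU⟩ := exists_wold h.isometry
    (h.unitaryPart_eq_bot hrep (hwb.reduces v h.polar) hq₀ hq₁ hc)
  have hY₀ := h.isSelfAdjoint_partIn hrep hq hq2 hc hU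
  obtain ⟨α, β, γ, hw⟩ := exists_weightData hq₀ hq₁ hc hY₀
  have hX := h.intertwines_X hrep hq₀ hq₁ hc hU
  have hX' := hX.adjoint hrep.dense hw.dense_modelX
  rw [hw.adjoint_modelX] at hX'
  exact ⟨wandering v, inferInstance, inferInstance, inferInstance, partIn (wandering v) Y, U, hY₀,
    hasTrivialKernel_partIn hrep.kernel, hX, hX', h.intertwines_Y hrep hq₀ hq₁ hc hU⟩

end Model

end QSphere

theorem mainTheorem2 (q c : ℝ) (hq₀ : 0 < q) (hq₁ : q < 1) (hc : 0 ≤ c) :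
    (∀ (K : Type u) [NormedAddCommGroup K] [InnerProductSpace ℂ K] [CompleteSpace K]
        (X Y : K →ₗ.[ℂ] K),
        QSphere.IsRepresentation q c X Y → QSphere.IsWellBehaved X Y →
        ∃ (K₀ : Type u) (_ : NormedAddCommGroup K₀) (_ : InnerProductSpace ℂ K₀)
          (_ : CompleteSpace K₀) (Y₀ : K₀ →ₗ.[ℂ] K₀) (U : K ≃ₗᵢ[ℂ] QSphere.HSum K₀),
          IsSelfAdjoint Y₀ ∧ QSphere.HasTrivialKernel Y₀ ∧
          QSphere.Intertwines U X (QSphere.modelX q c Y₀) ∧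
          QSphere.Intertwines U X† (QSphere.modelXstar q c Y₀) ∧
          QSphere.Intertwines U Y (QSphere.modelY q Y₀)) ∧
    (∀ (K₀ : Type u) [NormedAddCommGroup K₀] [InnerProductSpace ℂ K₀] [CompleteSpace K₀]
        (Y₀ : K₀ →ₗ.[ℂ] K₀), IsSelfAdjoint Y₀ → QSphere.HasTrivialKernel Y₀ →
        (QSphere.modelX q c Y₀)† = QSphere.modelXstar q c Y₀ ∧
        QSphere.IsRepresentation q c (QSphere.modelX q c Y₀) (QSphere.modelY q Y₀) ∧
        QSphere.InducesStarRepresentation q c (QSphere.modelX q c Y₀)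
          (QSphere.modelY q Y₀)) := by
  refine ⟨fun K _ _ _ X Y hrep hwb => hrep.exists_model hwb hq₀ hq₁ hc,
    fun K₀ _ _ _ Y₀ hY₀ hker => ?_⟩
  obtain ⟨a, b, g, hw⟩ := QSphere.exists_weightData hq₀ hq₁ hc hY₀
  exact ⟨hw.adjoint_modelX, hw.isRepresentation hq₀ hq₁ hc hker,
    hw.inducesStarRepresentation hq₀ hq₁ hc hker⟩
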